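/- Let $M$ be a smooth manifold of dimension $n$ with a smooth Riemannian metric $h$; for $p\in T_y^*M$ let $|p|_y$ be the dual norm. Let $\mathcal V\subset M$ be an open set, $\Phi$ a smooth diffeomorphism from $\mathcal V$ onto an open subset of $\mathbb R^n$, $x\in\mathcal V$, and let $X^1,\dots,X^m$ be smooth vector fields on $\mathcal V$ (for example an orthonormal frame of a sub-Riemannian structure). We identify $\mathcal V$, its tangent vectors and its covectors with their images in $\mathbb R^n$ by means of $\Phi$. For a control $u\in L^2([0,1],\mathbb R^m)$ let $\gamma^u:[0,1]\to\mathcal V$ be, when it exists, the absolutely continuous solution of $$\dot\gamma^u(t)=\sum_{i=1}^m u_i(t)X^i(\gamma^u(t))\ \text{ for a.e. } t\in[0,1],\qquad \gamma^u(0)=x .$$ Let $U\subset L^2([0,1],\mathbb R^m)$ be an open set such that $\gamma^u$ exists for every $u\in U$, and for $u\in U$ put $E(u)=\gamma^u(1)$, $C(u)=\frac12\|u\|_{L^2}^2$, $F(u)=(E(u),C(u))$. Denote by $D_u$ the first Fréchet differential at $u$ and by $D_u^2$ the quadratic form $v\mapsto D_u^2(v,v)$ defined by the second one. Let $S^u:[0,1]\to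 M_n(\mathbb R)$ be the solution of $\dot S^u(t)=A^u(t)S^u(t)$ for a.e. $t$, $S^u(0)=I_n$, where $A^u(t)=\sum_i u_i(t)J_{X^i}(\gamma^u(t))$ and $J_{X^i}$ is the Jacobian matrix of $X^i$. For $p\in T^*_{E(u)}M$ set $$p^{u}(t):=p\cdot S^u(1)S^u(t)^{-1},\qquad t\in[0,1].$$ For a quadratic form $Q$ on a real vector space, $\mathrm{ind}_-(Q)\in\mathbb N\cup\{+\infty\}$ is the maximal dimension of a linear subspace $W$ such that $Q<0$ on $W\setminus\{0\}$. **Proposition.** Let $\bar u\in U$ (for example the control of a minimizing geodesic) and let $L>0$ be such that $\|\bar u\|_{L^\infty}<L$. Then for every $\kappa>0$ and every $N\in\mathbb N$ there are $\rho,\Lambda>0$ such that the following holds. Let $u\in U$ satisfy $\|u-\bar u\|_{L^2}<\rho$ and $\|u\|_{L^\infty}<2L$, set $y=E(u)$, and let $p\in T_y^*M$, $p_0\in\mathbb R$ with $(p,p_0)\neq(0,0)$ satisfy $$p\cdot D_uE=p_0\,D_uC,\qquad |p|_y\ge\Lambda|p_0|,\qquad \mathrm{ind}_-\Big((p,-p_0)\cdot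 (D_u^2F)_{|\mathrm{Ker}(D_uF)}\Big)<N .$$ Then $$\big|p^{u}(t)\cdot[X^i,X^j](\gamma^u(t))\big|\le\kappa\,|p|_y\qquad\forall t\in[0,1],\ \forall i,j\in\{1,\dots,m\}.$$ -/

import Mathlib

open Set MeasureTheory
open scoped ENNReal Manifold ContDiff

noncomputable section

namespace SubRiem

/-- `ℝⁿ` with its Euclidean norm. -/
abbrev E (n : ℕ) : Type := EuclideanSpace ℝ (Fin n)

/-- Lebesgue measure on `[0,1]`. -/
abbrev μ01 : Measure ℝ := volume.restrict (Icc (0 : ℝ) 1)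

/-- The space of controls `L²([0,1], ℝᵐ)`. -/
abbrev Control (m : ℕ) : Type := Lp (E m) 2 μ01

/-- `c` is, on `[0,1]`, the absolutely continuous solution, with values in the open set `Ω ⊆ ℝⁿ`,
of the Cauchy problem `c' = ∑ᵢ uᵢ(t) Yⁱ(c)` for a.e. `t`, `c(0) = a`
(written as an integral equation). -/
structure IsTrajectory {n m : ℕ} (Ω : Set (E n)) (Y : Fin m → E n → E n) (a : E n)
    (u : Control m) (c : ℝ → E n) : Prop where
  continuousOn : ContinuousOn c (Icc 0 1)
  mapsTo : MapsTo c (Icc 0 1) Ω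
  eq_integral : ∀ t ∈ Icc (0 : ℝ) 1, c t = a + ∫ s in (0 : ℝ)..t, ∑ i, u s i • Y i (c s)

open Classical in
/-- The trajectory `γᵘ` of the control `u` (constant equal to `a` if `u` has no trajectory
on `[0,1]`). Only its values on `[0,1]` are meaningful. -/
def trajectory {n m : ℕ} (Ω : Set (E n)) (Y : Fin m → E n → E n) (a : E n)
    (u : Control m) : ℝ → E n :=
  if h : ∃ c, IsTrajectory Ω Y a u c then h.choose else fun _ => a

/-- The end-point mapping `u ↦ γᵘ(1)`. -/
def endPoint {n m : ℕ} (Ω : Set (E n)) (Y : Fin m → E n → E n) (a : E n)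
    (u : Control m) : E n :=
  trajectory Ω Y a u 1

/-- The cost `C(u) = ½ ‖u‖²`. -/
def cost {m : ℕ} (u : Control m) : ℝ := 1 / 2 * ‖u‖ ^ 2

/-- The mapping `F = (E, C)`. -/
def endPointCost {n m : ℕ} (Ω : Set (E n)) (Y : Fin m → E n → E n) (a : E n)
    (u : Control m) : E n × ℝ :=
  (endPoint Ω Y a u, cost u)

/-- The matrix `Aᵘ(t) = ∑ᵢ uᵢ(t) J_{Yⁱ}(γᵘ(t))`, as a linear map. -/
def linA {n m : ℕ} (Ω : Set (E n)) (Y : Fin m → E n → E n) (a : E n)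
    (u : Control m) (t : ℝ) : E n →L[ℝ] E n :=
  ∑ i, u t i • fderiv ℝ (Y i) (trajectory Ω Y a u t)

/-- `S` is, on `[0,1]`, the absolutely continuous solution of `S' = A S` for a.e. `t`,
`S(0) = Id`. -/
structure IsFundamentalSolution {n : ℕ} (A S : ℝ → E n →L[ℝ] E n) : Prop where
  continuousOn : ContinuousOn S (Icc 0 1)
  eq_integral : ∀ t ∈ Icc (0 : ℝ) 1,
    S t = ContinuousLinearMap.id ℝ (E n) + ∫ s in (0 : ℝ)..t, (A s).comp (S s)

open Classical in
/-- The solution `Sᵘ` of `S' = Aᵘ S`, `S(0) = Id`. -/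
def fundamental {n m : ℕ} (Ω : Set (E n)) (Y : Fin m → E n → E n) (a : E n)
    (u : Control m) : ℝ → E n →L[ℝ] E n :=
  if h : ∃ S, IsFundamentalSolution (linA Ω Y a u) S then h.choose
  else fun _ => ContinuousLinearMap.id ℝ (E n)

/-- The covector part `t ↦ ξ · Sᵘ(1) Sᵘ(t)⁻¹` of the extremal of `u` with final covector `ξ`. -/
def extremalCovector {n m : ℕ} (Ω : Set (E n)) (Y : Fin m → E n → E n) (a : E n)
    (u : Control m) (ξ : E n →L[ℝ] ℝ) (t : ℝ) : E n →L[ℝ] ℝ :=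
  ξ.comp ((fundamental Ω Y a u 1).comp (fundamental Ω Y a u t).inverse)

/-- The negative index of a quadratic form `Q`: the maximal dimension (possibly `⊤`) of a
subspace on which `Q` is negative outside the origin. -/
def negIndex {V : Type*} [AddCommGroup V] [Module ℝ V] (Q : V → ℝ) : ℕ∞ :=
  ⨆ (W : Submodule ℝ V) (_ : FiniteDimensional ℝ W) (_ : ∀ v ∈ W, v ≠ 0 → Q v < 0),
    (Module.finrank ℝ W : ℕ∞)

/-- The quadratic form `(ξ, -p₀) · (D²ᵤF)` restricted to `Ker (DᵤF)`, where `D²ᵤF` is the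
second-order Fréchet differential, evaluated on the diagonal. -/
def hessianOnKer {n m : ℕ} (Ω : Set (E n)) (Y : Fin m → E n → E n) (a : E n)
    (u : Control m) (ξ : E n →L[ℝ] ℝ) (p₀ : ℝ)
    (v : LinearMap.ker (fderiv ℝ (endPointCost Ω Y a) u).toLinearMap) : ℝ :=
  let w : E n × ℝ := fderiv ℝ (fderiv ℝ (endPointCost Ω Y a)) u v v
  ξ w.1 + (-p₀) * w.2

section Chart

variable {n m : ℕ} {M : Type*} [TopologicalSpace M] [ChartedSpace (E n) M]

/-- The vector fields `Xⁱ`, read in the chart `Φ` (that is, pushed forward by `Φ`). -/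
def chartField (Φ : OpenPartialHomeomorph M (E n)) (X : Fin m → (q : M) → TangentSpace (𝓡 n) q)
    (i : Fin m) (z : E n) : E n :=
  mfderiv (𝓡 n) 𝓘(ℝ, E n) Φ (Φ.symm z) (X i (Φ.symm z))

/-- A covector `p ∈ T*M` at the point `Φ⁻¹(z)`, read in the chart `Φ`. -/
def chartCovector (Φ : OpenPartialHomeomorph M (E n)) (z : E n)
    (p : TangentSpace (𝓡 n) (Φ.symm z) →L[ℝ] ℝ) : E n →L[ℝ] ℝ :=
  p.comp (mfderiv 𝓘(ℝ, E n) (𝓡 n) Φ.symm z)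

/-- The dual norm `|p|_q` on `T*_qM` of the norm `|w|_q = √(h_q(w,w))` on `T_qM`; it is the norm
`|v|_q` of the vector `v` such that `p = h_q(v, ·)`. -/
def covectorNorm [IsManifold (𝓡 n) ∞ M]
    (h : Bundle.ContMDiffRiemannianMetric (𝓡 n) ∞ (E n) (fun q : M => TangentSpace (𝓡 n) q))
    (q : M) (p : TangentSpace (𝓡 n) q →L[ℝ] ℝ) : ℝ :=
  sSup {r : ℝ | ∃ w : TangentSpace (𝓡 n) q, h.inner q w w ≤ 1 ∧ r = |p w|}

end Chart

end SubRiem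

end

/-!
The proof shows that a large value of the extremal covector on a Lie bracket `[Xⁱ, Xʲ](γᵘ(t))`
produces many negative directions of the second variation. Let `P(s) = ξ S(1) S(s)⁻¹`, which solves
the adjoint equation `P' = -P A`, and let `B(z) e = ∑ᵢ eᵢ Yⁱ(z)`.

* Pairing the equation of the second variation with `P` gives
  `ξ D²E(v, v) = ∫ P (2 DB(γ)[y] v + D²B(γ)[y, y] u)`, where `y` is the first variation along `v`
  (`adjoint_secondVariation`).
* If `v` is supported in an interval of length `δ` around `t` and has zero mean, then
  `y = B(γ(t)) w + O(δ ‖v‖)` with `w` the primitive of `v` (`firstVariation_estimate`). Freezing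
  the coefficients at `t` gives
  `ξ D²E(v, v) = 2 ∫ P(t) DB(γ(t))[B(γ(t)) w] v + O(|ξ| δ^(3/2) ‖v‖²)`
  (`secondVariation_estimate`); the power `3/2` comes from the Cauchy–Schwarz inequality for controls
  which are merely in `L²`.
* On trigonometric loops in the plane of the `i`-th and `j`-th components, `v` and `w` are explicit,
  only the antisymmetric part of the frozen form survives, and it is the bracket
  (`lieBracket_eq_fderiv`). With the orientation of the loops chosen according to its sign, the main
  term is at most `-(δ / 2πK) |P(t)[Yⁱ, Yʲ]| ‖v‖²` on a space of dimension `K`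
  (`two_mul_integral_loopControl_le`).
* For `K = N + n + 1` this space meets the kernel of `D_uF`, of codimension at most `n + 1`, in
  dimension at least `N` (`le_negIndex_ker`). An index below `N` therefore forces
  `|P(t)[Yⁱ, Yʲ]| δ ≤ A (|ξ| δ^(3/2) + |p₀|)` (`exists_bracket_estimate`). Taking first `δ` small and
  then `Λ` large gives the bound `κ |p|`.

The constants have to be uniform for `u` near `ū`. The fields are cut off away from a compact
neighbourhood of the trajectory of `ū`, so that they have bounded derivatives. The trajectories then
depend on `u` through a `C²` map into the space of continuous paths, by the implicit function theorem
applied to the integral equation (`exists_solutionMap`, `exists_localization`); the partial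
differential is invertible because Volterra operators are quasi-nilpotent
(`isUnit_one_sub_volterra`). Finally the Euclidean norm of a covector read in the chart is locally
uniformly bounded by the Riemannian one (`exists_norm_chartCovector_le`).
-/

noncomputable section

-- instances on nested spaces of continuous linear maps are otherwise not found
set_option maxSynthPendingDepth 3

namespace SubRiem

/-! ### Integrals of square integrable functions on `[0,1]` -/

section Integrals

set_option linter.unusedSectionVars false

variable {F F' G : Type*} [NormedAddCommGroup F] [NormedSpace ℝ F]
  [NormedAddCommGroup F'] [NormedSpace ℝ F'] [NormedAddCommGroup G] [NormedSpace ℝ G]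

instance : IsProbabilityMeasure μ01 := ⟨by simp⟩

theorem memLp_control {m : ℕ} (u : Control m) : MemLp u 2 μ01 := Lp.memLp u

theorem memLp_of_continuous {f : ℝ → F} (hf : Continuous f) : MemLp f 2 μ01 := by
  obtain ⟨C, hC⟩ := isCompact_Icc.exists_bound_of_continuousOn
    (hf.continuousOn (s := Icc (0 : ℝ) 1))
  refine MemLp.of_bound
    (hf.continuousOn.aestronglyMeasurable_of_isCompact isCompact_Icc measurableSet_Icc) C ?_
  exact (ae_restrict_iff' measurableSet_Icc).2 (.of_forall hC)

theorem memLp_clm_apply {f : ℝ → F →L[ℝ] G} {g : ℝ → F} (hf : Continuous f)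
    (hg : MemLp g 2 μ01) : MemLp (fun s => f s (g s)) 2 μ01 := by
  obtain ⟨C, hC⟩ := isCompact_Icc.exists_bound_of_continuousOn
    (hf.continuousOn (s := Icc (0 : ℝ) 1))
  refine MemLp.of_le_mul (c := C) hg ?_ ?_
  · exact (ContinuousLinearMap.apply ℝ G).flip.aestronglyMeasurable_comp₂
      (hf.continuousOn.aestronglyMeasurable_of_isCompact isCompact_Icc measurableSet_Icc) hg.1
  · refine (ae_restrict_iff' measurableSet_Icc).2 (.of_forall fun s hs => ?_)
    exact (f s).le_of_opNorm_le (hC s hs) _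

theorem intervalIntegrable_of_memLp {f : ℝ → F} (hf : MemLp f 2 μ01) {s t : ℝ}
    (hs : s ∈ Icc (0 : ℝ) 1) (ht : t ∈ Icc (0 : ℝ) 1) : IntervalIntegrable f volume s t := by
  have h : IntegrableOn f (Icc 0 1) := hf.integrable (by norm_num)
  exact (h.mono_set (uIcc_subset_Icc hs ht)).intervalIntegrable

theorem memLp_mono_interval {f : ℝ → F} (hf : MemLp f 2 μ01) {s t : ℝ}
    (hs : s ∈ Icc (0 : ℝ) 1) (ht : t ∈ Icc (0 : ℝ) 1) :
    MemLp f 2 (volume.restrict (Ioc s t)) :=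
  hf.mono_measure (Measure.restrict_mono
    (Ioc_subset_Icc_self.trans (Icc_subset_Icc hs.1 ht.2)) le_rfl)

/-- Square integrable functions have integrable products. -/
theorem intervalIntegrable_norm_mul {f : ℝ → F} {g : ℝ → G} (hf : MemLp f 2 μ01)
    (hg : MemLp g 2 μ01) {s t : ℝ} (hs : s ∈ Icc (0 : ℝ) 1) (ht : t ∈ Icc (0 : ℝ) 1) :
    IntervalIntegrable (fun r => ‖f r‖ * ‖g r‖) volume s t := by
  have h : IntegrableOn (fun r => ‖f r‖ * ‖g r‖) (Icc 0 1) :=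
    MemLp.integrable_mul hf.norm hg.norm
  exact (h.mono_set (uIcc_subset_Icc hs ht)).intervalIntegrable

theorem intervalIntegrable_norm_sq {f : ℝ → F} (hf : MemLp f 2 μ01) {s t : ℝ}
    (hs : s ∈ Icc (0 : ℝ) 1) (ht : t ∈ Icc (0 : ℝ) 1) :
    IntervalIntegrable (fun r => ‖f r‖ ^ 2) volume s t := by
  simpa only [pow_two] using intervalIntegrable_norm_mul hf hf hs ht

/-- The Cauchy–Schwarz inequality on a subinterval of `[0,1]`. -/
theorem integral_norm_mul_le {f : ℝ → F} {g : ℝ → G} (hf : MemLp f 2 μ01)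
    (hg : MemLp g 2 μ01) {s t : ℝ} (hs : s ∈ Icc (0 : ℝ) 1) (ht : t ∈ Icc (0 : ℝ) 1)
    (hst : s ≤ t) :
    ∫ r in s..t, ‖f r‖ * ‖g r‖ ≤
      √(∫ r in s..t, ‖f r‖ ^ 2) * √(∫ r in s..t, ‖g r‖ ^ 2) := by
  have h2 : ENNReal.ofReal 2 = 2 := by norm_num
  have := integral_mul_norm_le_Lp_mul_Lq (μ := volume.restrict (Ioc s t))
    (f := fun r => ‖f r‖) (g := fun r => ‖g r‖) (p := 2) (q := 2)
    Real.HolderConjugate.two_two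
    (by rw [h2]; exact (memLp_mono_interval hf hs ht).norm)
    (by rw [h2]; exact (memLp_mono_interval hg hs ht).norm)
  simp only [norm_norm] at this
  simpa only [intervalIntegral.integral_of_le hst, Real.sqrt_eq_rpow, ← Real.rpow_natCast,
    Nat.cast_ofNat] using this

theorem integral_norm_sq_le_one {f : ℝ → F} (hf : MemLp f 2 μ01) {s t : ℝ}
    (hs : s ∈ Icc (0 : ℝ) 1) (ht : t ∈ Icc (0 : ℝ) 1) (hst : s ≤ t) :
    ∫ r in s..t, ‖f r‖ ^ 2 ≤ ∫ r in (0 : ℝ)..1, ‖f r‖ ^ 2 := by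
  refine intervalIntegral.integral_mono_interval hs.1 hst ht.2 (.of_forall fun _ => by positivity)
    (intervalIntegrable_norm_sq hf (by simp) (by simp))

theorem integral_norm_le_sqrt_mul {f : ℝ → F} (hf : MemLp f 2 μ01) {s t : ℝ}
    (hs : s ∈ Icc (0 : ℝ) 1) (ht : t ∈ Icc (0 : ℝ) 1) (hst : s ≤ t) :
    ∫ r in s..t, ‖f r‖ ≤ √(t - s) * √(∫ r in s..t, ‖f r‖ ^ 2) := by
  have := integral_norm_mul_le (memLp_of_continuous (continuous_const (y := (1 : ℝ)))) hf hs ht hst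
  simpa using this

theorem integral_norm_sq_control {m : ℕ} (u : Control m) :
    ∫ r in (0 : ℝ)..1, ‖u r‖ ^ 2 = ‖u‖ ^ 2 := by
  rw [intervalIntegral.integral_of_le zero_le_one, ← integral_Icc_eq_integral_Ioc,
    ← real_inner_self_eq_norm_sq u, L2.inner_def]
  simp

theorem sqrt_integral_norm_sq_control_le {m : ℕ} (u : Control m) {s t : ℝ}
    (hs : s ∈ Icc (0 : ℝ) 1) (ht : t ∈ Icc (0 : ℝ) 1) (hst : s ≤ t) :
    √(∫ r in s..t, ‖u r‖ ^ 2) ≤ ‖u‖ := by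
  rw [← Real.sqrt_sq (norm_nonneg u), ← integral_norm_sq_control u]
  exact Real.sqrt_le_sqrt (integral_norm_sq_le_one (memLp_control u) hs ht hst)

theorem integral_norm_control_le {m : ℕ} (u : Control m) {s t : ℝ}
    (hs : s ∈ Icc (0 : ℝ) 1) (ht : t ∈ Icc (0 : ℝ) 1) (hst : s ≤ t) :
    ∫ r in s..t, ‖u r‖ ≤ √(t - s) * ‖u‖ :=
  (integral_norm_le_sqrt_mul (memLp_control u) hs ht hst).trans
    (by gcongr; exact sqrt_integral_norm_sq_control_le u hs ht hst)

/-- A bound of Grönwall type for an integral inequality with a square integrable kernel.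
By the Cauchy–Schwarz inequality, `φ²` satisfies an inequality with a constant kernel. -/
theorem le_of_le_add_integral_control {m : ℕ} (u : Control m) {φ : ℝ → ℝ} (hφ : Continuous φ)
    (hφ0 : ∀ t, 0 ≤ φ t) {α b R : ℝ} (hα : 0 ≤ α) (hb : 0 ≤ b) (hu : ‖u‖ ≤ R)
    (h : ∀ t ∈ Icc (0 : ℝ) 1, φ t ≤ α + b * ∫ s in (0 : ℝ)..t, ‖u s‖ * φ s)
    {t : ℝ} (ht : t ∈ Icc (0 : ℝ) 1) : φ t ≤ 2 * Real.exp ((b * R) ^ 2) * α := by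
  have hR : 0 ≤ R := (norm_nonneg u).trans hu
  have h01 : (0 : ℝ) ∈ Icc (0 : ℝ) 1 := by simp
  set Z : ℝ → ℝ := fun t => ∫ s in (0 : ℝ)..t, φ s ^ 2 with hZ
  have hZd : ∀ t, HasDerivAt Z (φ t ^ 2) t := fun t =>
    (hφ.pow 2).integral_hasStrictDerivAt 0 t |>.hasDerivAt
  have key : ∀ t ∈ Icc (0 : ℝ) 1, φ t ^ 2 ≤ 2 * (b * R) ^ 2 * Z t + 2 * α ^ 2 := by
    intro t ht
    have h1 : ∫ s in (0 : ℝ)..t, ‖u s‖ * φ s ≤ R * √(Z t) := by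
      have := integral_norm_mul_le (memLp_control u) (memLp_of_continuous hφ) h01 ht ht.1
      simp only [Real.norm_of_nonneg (hφ0 _)] at this
      refine this.trans ?_
      gcongr
      exact (sqrt_integral_norm_sq_control_le u h01 ht ht.1).trans hu
    have hZ0 : 0 ≤ Z t := intervalIntegral.integral_nonneg ht.1 fun s _ => by positivity
    have h2 : φ t ≤ α + b * (R * √(Z t)) := (h t ht).trans (by gcongr)
    have h3 : φ t ^ 2 ≤ (α + b * (R * √(Z t))) ^ 2 := pow_le_pow_left₀ (hφ0 t) h2 2
    have h4 : √(Z t) ^ 2 = Z t := Real.sq_sqrt hZ0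
    calc φ t ^ 2 ≤ _ := h3
      _ ≤ 2 * (b * R) ^ 2 * √(Z t) ^ 2 + 2 * α ^ 2 := by
        nlinarith [sq_nonneg (α - b * (R * √(Z t)))]
      _ = _ := by rw [h4]
  set K := 2 * (b * R) ^ 2 with hK
  have hK0 : 0 ≤ K := by positivity
  have hgr : Z t ≤ gronwallBound 0 K (2 * α ^ 2) (t - 0) := by
    refine le_gronwallBound_of_liminf_deriv_right_le (f := Z) (f' := fun t => φ t ^ 2) (b := 1)
      (fun t _ => (hZd t).continuousAt.continuousWithinAt)
      (fun x hx r hr => (hZd x).hasDerivWithinAt.liminf_right_slope_le hr) (by simp [hZ])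
      (fun x hx => key x ⟨hx.1, hx.2.le⟩) t ht
  have hfin : φ t ^ 2 ≤ 2 * α ^ 2 * Real.exp (K * t) := by
    rcases hK0.eq_or_lt with hK' | hK'
    · have := key t ht
      rw [← hK'] at this ⊢
      simpa using this
    · rw [gronwallBound_of_K_ne_0 hK'.ne', sub_zero] at hgr
      calc φ t ^ 2 ≤ K * Z t + 2 * α ^ 2 := key t ht
        _ ≤ K * (0 * Real.exp (K * t) + 2 * α ^ 2 / K * (Real.exp (K * t) - 1)) + 2 * α ^ 2 := by
          gcongr
        _ = _ := by field_simp; ring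
  have hexp : Real.exp (K * t) ≤ Real.exp ((b * R) ^ 2) ^ 2 := by
    rw [← Real.exp_nat_mul]
    refine Real.exp_le_exp.2 ?_
    push_cast
    nlinarith [ht.2]
  refine le_of_sq_le_sq ?_ (by positivity)
  calc φ t ^ 2 ≤ 2 * α ^ 2 * Real.exp (K * t) := hfin
    _ ≤ 2 * α ^ 2 * Real.exp ((b * R) ^ 2) ^ 2 := by gcongr
    _ ≤ _ := by nlinarith [sq_nonneg (α * Real.exp ((b * R) ^ 2))]

/-- The product rule, in integral form, for a continuous bilinear map applied to two primitives of
square integrable functions. The difference of the two sides changes by `O(|∫ₛᵗ ‖a‖| |∫ₛᵗ ‖b‖|)`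
between `s` and `t`, which is `o(t - s)` by the Cauchy–Schwarz inequality. -/
theorem bilinear_primitive [CompleteSpace F] [CompleteSpace F'] [CompleteSpace G]
    (β : F →L[ℝ] F' →L[ℝ] G) {x a : ℝ → F} {y b : ℝ → F'}
    (hxc : Continuous x) (hyc : Continuous y) (ha : MemLp a 2 μ01) (hb : MemLp b 2 μ01)
    (hx : ∀ t ∈ Icc (0 : ℝ) 1, x t = x 0 + ∫ s in (0 : ℝ)..t, a s)
    (hy : ∀ t ∈ Icc (0 : ℝ) 1, y t = y 0 + ∫ s in (0 : ℝ)..t, b s)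
    {t : ℝ} (ht : t ∈ Icc (0 : ℝ) 1) :
    β (x t) (y t) = β (x 0) (y 0) + ∫ s in (0 : ℝ)..t, (β (a s) (y s) + β (x s) (b s)) := by
  have h01 : (0 : ℝ) ∈ Icc (0 : ℝ) 1 := by simp
  have h11 : (1 : ℝ) ∈ Icc (0 : ℝ) 1 := by simp
  have hβa : ∀ {z : ℝ → F'}, Continuous z → MemLp (fun s => β (a s) (z s)) 2 μ01 := fun hz =>
    memLp_clm_apply (f := fun s => β.flip (_)) (by fun_prop) ha
  have hβb : ∀ {z : ℝ → F}, Continuous z → MemLp (fun s => β (z s) (b s)) 2 μ01 := fun hz =>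
    memLp_clm_apply (f := fun s => β (_)) (by fun_prop) hb
  have hint : MemLp (fun s => β (a s) (y s) + β (x s) (b s)) 2 μ01 := (hβa hyc).add (hβb hxc)
  -- `D` has zero right derivative, hence is constant
  set D : ℝ → G := fun t => β (x t) (y t) - ∫ s in (0 : ℝ)..t, (β (a s) (y s) + β (x s) (b s))
    with hD
  have incx : ∀ s ∈ Icc (0 : ℝ) 1, ∀ t ∈ Icc (0 : ℝ) 1, x t - x s = ∫ r in s..t, a r := by
    intro s hs t ht
    rw [hx t ht, hx s hs, add_sub_add_left_eq_sub, intervalIntegral.integral_interval_sub_left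
      (intervalIntegrable_of_memLp ha h01 ht) (intervalIntegrable_of_memLp ha h01 hs)]
  have incy : ∀ s ∈ Icc (0 : ℝ) 1, ∀ t ∈ Icc (0 : ℝ) 1, y t - y s = ∫ r in s..t, b r := by
    intro s hs t ht
    rw [hy t ht, hy s hs, add_sub_add_left_eq_sub, intervalIntegral.integral_interval_sub_left
      (intervalIntegrable_of_memLp hb h01 ht) (intervalIntegrable_of_memLp hb h01 hs)]
  have bound : ∀ s ∈ Icc (0 : ℝ) 1, ∀ t ∈ Icc (0 : ℝ) 1, s ≤ t →
      ‖D t - D s‖ ≤ 2 * ‖β‖ * ((∫ r in s..t, ‖a r‖) * ∫ r in s..t, ‖b r‖) := by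
    intro s hs t ht hst
    have ia := intervalIntegrable_of_memLp ha hs ht
    have ib := intervalIntegrable_of_memLp hb hs ht
    have e1 : D t - D s = ∫ r in s..t, (β (a r) (y t - y r) + β (x s - x r) (b r)) := by
      have h1 : β (x t) (y t) - β (x s) (y s) =
          ∫ r in s..t, (β (a r) (y t) + β (x s) (b r)) := by
        rw [intervalIntegral.integral_add (intervalIntegrable_of_memLp
          (hβa continuous_const) hs ht) (intervalIntegrable_of_memLp
          (hβb continuous_const) hs ht), (β (x s)).intervalIntegral_comp_comm ib,
          ← incy s hs t ht]
        have := (β.flip (y t)).intervalIntegral_comp_comm ia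
        simp only [ContinuousLinearMap.flip_apply] at this
        rw [this, ← incx s hs t ht]
        simp
      have h2 : (∫ r in (0 : ℝ)..t, (β (a r) (y r) + β (x r) (b r))) -
          ∫ r in (0 : ℝ)..s, (β (a r) (y r) + β (x r) (b r)) =
          ∫ r in s..t, (β (a r) (y r) + β (x r) (b r)) :=
        intervalIntegral.integral_interval_sub_left
          (intervalIntegrable_of_memLp hint h01 ht) (intervalIntegrable_of_memLp hint h01 hs)
      calc D t - D s = (β (x t) (y t) - β (x s) (y s)) -
            ((∫ r in (0 : ℝ)..t, (β (a r) (y r) + β (x r) (b r))) -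
              ∫ r in (0 : ℝ)..s, (β (a r) (y r) + β (x r) (b r))) := by simp only [hD]; abel
        _ = _ := by
          have hc : MemLp (fun r => β (a r) (y t) + β (x s) (b r)) 2 μ01 :=
            (hβa continuous_const).add (hβb continuous_const)
          rw [h1, h2, ← intervalIntegral.integral_sub (intervalIntegrable_of_memLp hc hs ht)
            (intervalIntegrable_of_memLp hint hs ht)]
          congr 1
          ext r
          simp only [map_sub, sub_apply]
          abel
    have hsub : ∀ {r}, r ∈ Ioc s t → r ∈ Icc (0 : ℝ) 1 := fun hr =>
      ⟨hs.1.trans hr.1.le, hr.2.trans ht.2⟩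
    have hnb : ∀ r ∈ Ioc s t, ‖y t - y r‖ ≤ ∫ r in s..t, ‖b r‖ := by
      intro r hr
      rw [incy r (hsub hr) t ht]
      refine (intervalIntegral.norm_integral_le_integral_norm hr.2).trans ?_
      exact intervalIntegral.integral_mono_interval hr.1.le hr.2 le_rfl
        (.of_forall fun _ => norm_nonneg _) ib.norm
    have hna : ∀ r ∈ Ioc s t, ‖x s - x r‖ ≤ ∫ r in s..t, ‖a r‖ := by
      intro r hr
      rw [norm_sub_rev, incx s hs r (hsub hr)]
      refine (intervalIntegral.norm_integral_le_integral_norm hr.1.le).trans ?_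
      exact intervalIntegral.integral_mono_interval le_rfl hr.1.le hr.2
        (.of_forall fun _ => norm_nonneg _) ia.norm
    set Ia := ∫ r in s..t, ‖a r‖
    set Ib := ∫ r in s..t, ‖b r‖
    rw [e1]
    refine (intervalIntegral.norm_integral_le_of_norm_le
      (g := fun r => ‖β‖ * Ib * ‖a r‖ + ‖β‖ * Ia * ‖b r‖) hst
      (.of_forall fun r hr => ?_) ((ia.norm.const_mul _).add (ib.norm.const_mul _))).trans ?_
    · refine (norm_add_le _ _).trans (add_le_add ?_ ?_)
      · refine (β.le_opNorm₂ _ _).trans ?_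
        rw [mul_assoc, mul_assoc, mul_comm Ib]
        gcongr
        exact hnb r hr
      · refine (β.le_opNorm₂ _ _).trans ?_
        gcongr
        exact hna r hr
    · rw [intervalIntegral.integral_add (ia.norm.const_mul _) (ib.norm.const_mul _),
        intervalIntegral.integral_const_mul, intervalIntegral.integral_const_mul]
      exact le_of_eq (by ring)
  have hDc : ContinuousOn D (Icc 0 1) := by
    have := intervalIntegral.continuousOn_primitive_interval'
      (intervalIntegrable_of_memLp hint h01 h11) (by simp : (0 : ℝ) ∈ uIcc (0 : ℝ) 1)
    rw [uIcc_of_le zero_le_one] at this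
    exact Continuous.continuousOn (by fun_prop) |>.sub this
  -- the increments of `D` over `[s, t]` are at most `θ(t) (t - s)` with `θ(t) → 0` as `t → s`
  have hderiv : ∀ s ∈ Ico (0 : ℝ) 1, HasDerivWithinAt D 0 (Ici s) s := by
    intro s hs
    have hs' : s ∈ Icc (0 : ℝ) 1 := ⟨hs.1, hs.2.le⟩
    set θ : ℝ → ℝ := fun t => 2 * ‖β‖ * (√(∫ r in s..t, ‖a r‖ ^ 2) *
      √(∫ r in (0 : ℝ)..1, ‖b r‖ ^ 2)) with hθ
    have hθ0 : Filter.Tendsto θ (nhdsWithin s (Ici s)) (nhds 0) := by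
      have h1 := intervalIntegral.continuousOn_primitive_interval'
        (intervalIntegrable_norm_sq ha hs' h11) (by simp : s ∈ uIcc s 1)
      rw [uIcc_of_le hs.2.le] at h1
      have h2 : ContinuousWithinAt (fun t => ∫ r in s..t, ‖a r‖ ^ 2) (Ici s) s :=
        (h1 s (by simp [hs.2.le])).mono_of_mem_nhdsWithin (Icc_mem_nhdsGE hs.2)
      have h3 : ContinuousWithinAt θ (Ici s) s :=
        continuousWithinAt_const.mul (h2.sqrt.mul continuousWithinAt_const)
      simpa [ContinuousWithinAt, hθ] using h3
    rw [hasDerivWithinAt_iff_isLittleO, Asymptotics.isLittleO_iff]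
    intro c hc
    filter_upwards [hθ0.eventually (gt_mem_nhds hc), Icc_mem_nhdsGE hs.2] with t htc ht
    have ht' : t ∈ Icc (0 : ℝ) 1 := ⟨hs.1.trans ht.1, ht.2⟩
    have hts : 0 ≤ t - s := sub_nonneg.2 ht.1
    rw [smul_zero, sub_zero, Real.norm_of_nonneg hts]
    have h1 := integral_norm_le_sqrt_mul ha hs' ht' ht.1
    have h2 := (integral_norm_le_sqrt_mul hb hs' ht' ht.1).trans
      (mul_le_mul_of_nonneg_left (Real.sqrt_le_sqrt (integral_norm_sq_le_one hb hs' ht' ht.1))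
        (Real.sqrt_nonneg _))
    calc ‖D t - D s‖ ≤ _ := bound s hs' t ht' ht.1
      _ ≤ 2 * ‖β‖ * ((√(t - s) * √(∫ r in s..t, ‖a r‖ ^ 2)) *
          (√(t - s) * √(∫ r in (0 : ℝ)..1, ‖b r‖ ^ 2))) := by
        gcongr
        exact intervalIntegral.integral_nonneg ht.1 fun _ _ => norm_nonneg _
      _ = θ t * (√(t - s) * √(t - s)) := by simp only [hθ]; ring
      _ ≤ c * (t - s) := by
        rw [Real.mul_self_sqrt hts]
        gcongr
  have := constant_of_has_deriv_right_zero hDc hderiv t ht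
  simp only [hD, intervalIntegral.integral_same, sub_zero] at this
  rw [← this]
  abel

end Integrals

/-! ### Linear Volterra equations driven by a control -/

section Volterra

set_option linter.unusedSectionVars false

variable {m : ℕ} {F G : Type*} [NormedAddCommGroup F] [NormedSpace ℝ F]
  [NormedAddCommGroup G] [NormedSpace ℝ G]

/-- Continuous paths `[0,1] → F`, with the sup norm. -/
abbrev Path (F : Type*) [NormedAddCommGroup F] : Type _ := C(Icc (0 : ℝ) 1, F)

/-- The extension of a path to `ℝ`, constant on both sides of `[0,1]`. -/
def Path.ext (f : Path F) : ℝ → F := IccExtend zero_le_one f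

theorem Path.continuous_ext (f : Path F) :
    Continuous f.ext := f.continuous.Icc_extend'

theorem Path.ext_of_mem (f : Path F) {t : ℝ}
    (ht : t ∈ Icc (0 : ℝ) 1) : f.ext t = f ⟨t, ht⟩ := IccExtend_of_mem _ _ ht

theorem Path.ext_coe (f : Path F) (t : Icc (0 : ℝ) 1) :
    f.ext t = f t := f.ext_of_mem t.2

theorem Path.norm_ext_le (f : Path F) (t : ℝ) : ‖f.ext t‖ ≤ ‖f‖ :=
  f.norm_coe_le_norm _

theorem memLp_path_control (f : Path (E m →L[ℝ] F)) (u : Control m) :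
    MemLp (fun s => f.ext s (u s)) 2 μ01 :=
  memLp_clm_apply f.continuous_ext (memLp_control u)

theorem norm_integral_path_control_le (f : Path (E m →L[ℝ] F)) (u : Control m) {t : ℝ}
    (ht : t ∈ Icc (0 : ℝ) 1) : ‖∫ s in (0 : ℝ)..t, f.ext s (u s)‖ ≤ ‖u‖ * ‖f‖ := by
  have h01 : (0 : ℝ) ∈ Icc (0 : ℝ) 1 := by simp
  have hi := (intervalIntegrable_of_memLp (memLp_control u) h01 ht).norm
  calc ‖∫ s in (0 : ℝ)..t, f.ext s (u s)‖ ≤ ∫ s in (0 : ℝ)..t, ‖f‖ * ‖u s‖ :=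
        intervalIntegral.norm_integral_le_of_norm_le ht.1
          (.of_forall fun s _ => (f.ext s).le_of_opNorm_le (f.norm_ext_le s) _) (hi.const_mul _)
    _ = ‖f‖ * ∫ s in (0 : ℝ)..t, ‖u s‖ := intervalIntegral.integral_const_mul _ _
    _ ≤ ‖f‖ * (1 * ‖u‖) := by
      gcongr
      refine (integral_norm_control_le u h01 ht ht.1).trans ?_
      gcongr
      rw [Real.sqrt_le_one]
      simpa using ht.2
    _ = _ := by ring

theorem continuous_integral_path_control (f : Path (E m →L[ℝ] F)) (u : Control m) :
    Continuous fun t : Icc (0 : ℝ) 1 => ∫ s in (0 : ℝ)..t, f.ext s (u s) := by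
  have := intervalIntegral.continuousOn_primitive_interval'
    (intervalIntegrable_of_memLp (memLp_path_control f u) (s := 0) (t := 1) (by simp) (by simp))
    (by simp : (0 : ℝ) ∈ uIcc (0 : ℝ) 1)
  rw [uIcc_of_le zero_le_one] at this
  exact continuousOn_iff_continuous_domRestrict.1 this

/-- The continuous bilinear map `(u, f) ↦ (t ↦ ∫₀ᵗ f(s) u(s) ds)`. -/
def controlIntegral (m : ℕ) (F : Type*) [NormedAddCommGroup F] [NormedSpace ℝ F] :
    Control m →L[ℝ] Path (E m →L[ℝ] F) →L[ℝ] Path F :=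
  LinearMap.mkContinuous₂
    (LinearMap.mk₂ ℝ (fun (u : Control m) (f : Path (E m →L[ℝ] F)) =>
        (⟨fun t => ∫ s in (0 : ℝ)..t, f.ext s (u s),
          continuous_integral_path_control f u⟩ : Path F))
      (fun u v f => by
        ext1 t
        have h01 : (0 : ℝ) ∈ Icc (0 : ℝ) 1 := by simp
        simp only [ContinuousMap.coe_mk, ContinuousMap.add_apply]
        rw [← intervalIntegral.integral_add
          (intervalIntegrable_of_memLp (memLp_path_control f u) h01 t.2)
          (intervalIntegrable_of_memLp (memLp_path_control f v) h01 t.2)]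
        refine intervalIntegral.integral_congr_ae_restrict ?_
        have h : ∀ᵐ s ∂μ01, (u + v : Control m) s = u s + v s := Lp.coeFn_add u v
        refine (ae_restrict_of_ae_restrict_of_subset ?_ h).mono fun s hs => by
          simp only [hs, map_add]
        rw [uIoc_of_le t.2.1]
        exact Ioc_subset_Icc_self.trans (Icc_subset_Icc_right t.2.2))
      (fun c u f => by
        ext1 t
        simp only [ContinuousMap.coe_mk, ContinuousMap.smul_apply]
        rw [← intervalIntegral.integral_smul]
        refine intervalIntegral.integral_congr_ae_restrict ?_
        have h : ∀ᵐ s ∂μ01, (c • u : Control m) s = c • u s := Lp.coeFn_smul c u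
        refine (ae_restrict_of_ae_restrict_of_subset ?_ h).mono fun s hs => by
          simp only [hs, map_smul]
        rw [uIoc_of_le t.2.1]
        exact Ioc_subset_Icc_self.trans (Icc_subset_Icc_right t.2.2))
      (fun u f g => by
        ext1 t
        have h01 : (0 : ℝ) ∈ Icc (0 : ℝ) 1 := by simp
        simp only [ContinuousMap.coe_mk, ContinuousMap.add_apply]
        rw [← intervalIntegral.integral_add
          (intervalIntegrable_of_memLp (memLp_path_control f u) h01 t.2)
          (intervalIntegrable_of_memLp (memLp_path_control g u) h01 t.2)]
        rfl)
      (fun c u f => by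
        ext1 t
        simp only [ContinuousMap.coe_mk, ContinuousMap.smul_apply]
        rw [← intervalIntegral.integral_smul]
        rfl))
    1 fun u f => by
      rw [one_mul, ContinuousMap.norm_le _ (by positivity)]
      exact fun t => norm_integral_path_control_le f u t.2

theorem controlIntegral_apply (u : Control m) (f : Path (E m →L[ℝ] F)) (t : Icc (0 : ℝ) 1) :
    controlIntegral m F u f t = ∫ s in (0 : ℝ)..t, f.ext s (u s) := rfl

/-- The continuous bilinear map `(g, h) ↦ (t ↦ g(t) h(t))` on paths. -/
def pathApply (F G : Type*) [NormedAddCommGroup F] [NormedSpace ℝ F] [NormedAddCommGroup G]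
    [NormedSpace ℝ G] : Path (F →L[ℝ] G) →L[ℝ] Path F →L[ℝ] Path G :=
  LinearMap.mkContinuous₂
    (LinearMap.mk₂ ℝ (fun (g : Path (F →L[ℝ] G)) (h : Path F) =>
        (⟨fun t => g t (h t), by fun_prop⟩ : Path G))
      (fun _ _ _ => by ext1; simp) (fun _ _ _ => by ext1; simp)
      (fun _ _ _ => by ext1; simp) (fun _ _ _ => by ext1; simp))
    1 fun g h => by
      rw [one_mul, ContinuousMap.norm_le _ (by positivity)]
      exact fun t => (g t).le_of_opNorm_le_of_le (g.norm_coe_le_norm t) (h.norm_coe_le_norm t)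

/-- The Volterra operator `h ↦ (t ↦ ∫₀ᵗ (g(s) h(s)) u(s) ds)`. -/
def volterra (u : Control m) (g : Path (F →L[ℝ] E m →L[ℝ] F)) : Path F →L[ℝ] Path F :=
  (controlIntegral m F u).comp (pathApply F (E m →L[ℝ] F) g)

theorem volterra_apply (u : Control m) (g : Path (F →L[ℝ] E m →L[ℝ] F)) (h : Path F)
    (t : Icc (0 : ℝ) 1) : volterra u g h t = ∫ s in (0 : ℝ)..t, g.ext s (h.ext s) (u s) := rfl

/-- Cauchy–Schwarz turns the `L²` kernel of the Volterra operator into a constant one, at the price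
of squaring, so that the powers of the operator are bounded by those of ordinary integration. -/
theorem norm_volterra_sq_le (u : Control m) (g : Path (F →L[ℝ] E m →L[ℝ] F)) (h : Path F)
    (t : Icc (0 : ℝ) 1) :
    ‖volterra u g h t‖ ^ 2 ≤ (‖u‖ * ‖g‖) ^ 2 * ∫ s in (0 : ℝ)..t, ‖h.ext s‖ ^ 2 := by
  have h01 : (0 : ℝ) ∈ Icc (0 : ℝ) 1 := by simp
  have hm : MemLp h.ext 2 μ01 := memLp_of_continuous h.continuous_ext
  have hi := intervalIntegrable_norm_mul (memLp_control u) hm h01 t.2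
  have h0 : 0 ≤ ∫ s in (0 : ℝ)..t, ‖h.ext s‖ ^ 2 :=
    intervalIntegral.integral_nonneg t.2.1 fun _ _ => by positivity
  have h1 : ‖volterra u g h t‖ ≤ ‖g‖ * (‖u‖ * √(∫ s in (0 : ℝ)..t, ‖h.ext s‖ ^ 2)) := by
    rw [volterra_apply]
    calc _ ≤ ∫ s in (0 : ℝ)..t, ‖g‖ * (‖u s‖ * ‖h.ext s‖) := by
          refine intervalIntegral.norm_integral_le_of_norm_le t.2.1
            (.of_forall fun s _ => ?_) (hi.const_mul _)
          refine ((g.ext s).le_opNorm₂ _ _).trans ?_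
          rw [mul_comm ‖u s‖, ← mul_assoc]
          gcongr
          exact g.norm_ext_le s
      _ = ‖g‖ * ∫ s in (0 : ℝ)..t, ‖u s‖ * ‖h.ext s‖ := intervalIntegral.integral_const_mul _ _
      _ ≤ _ := by
        gcongr
        refine (integral_norm_mul_le (memLp_control u) hm h01 t.2 t.2.1).trans ?_
        gcongr
        exact sqrt_integral_norm_sq_control_le u h01 t.2 t.2.1
  calc _ ≤ (‖g‖ * (‖u‖ * √(∫ s in (0 : ℝ)..t, ‖h.ext s‖ ^ 2))) ^ 2 := by gcongr
    _ = (‖u‖ * ‖g‖) ^ 2 * √(∫ s in (0 : ℝ)..t, ‖h.ext s‖ ^ 2) ^ 2 := by ring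
    _ = _ := by rw [Real.sq_sqrt h0]

theorem norm_volterra_pow_sq_le (u : Control m) (g : Path (F →L[ℝ] E m →L[ℝ] F)) (h : Path F)
    (j : ℕ) (t : Icc (0 : ℝ) 1) :
    ‖(volterra u g ^ j) h t‖ ^ 2 ≤
      ((‖u‖ * ‖g‖) ^ 2) ^ j * ‖h‖ ^ 2 * ((t : ℝ) ^ j / j.factorial) := by
  induction j generalizing t with
  | zero => simpa using pow_le_pow_left₀ (norm_nonneg _) (h.norm_coe_le_norm t) 2
  | succ j ih =>
    have hj : (0 : ℝ) < (j.factorial : ℝ) := by exact_mod_cast j.factorial_pos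
    rw [pow_succ' (volterra u g), mul_apply_eq_comp]
    refine (norm_volterra_sq_le u g _ t).trans ?_
    have h1 : ∫ s in (0 : ℝ)..t, ‖((volterra u g ^ j) h).ext s‖ ^ 2 ≤
        ∫ s in (0 : ℝ)..t, ((‖u‖ * ‖g‖) ^ 2) ^ j * ‖h‖ ^ 2 * (s ^ j / j.factorial) := by
      refine intervalIntegral.integral_mono_on t.2.1 ?_ ?_ fun s hs => ?_
      · exact ((Path.continuous_ext _).norm.pow 2).intervalIntegrable _ _
      · exact Continuous.intervalIntegrable (by fun_prop) _ _
      · have hs' : s ∈ Icc (0 : ℝ) 1 := ⟨hs.1, hs.2.trans t.2.2⟩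
        rw [Path.ext_of_mem _ hs']
        exact ih ⟨s, hs'⟩
    refine (mul_le_mul_of_nonneg_left h1 (by positivity)).trans (le_of_eq ?_)
    rw [intervalIntegral.integral_const_mul, intervalIntegral.integral_div, integral_pow,
      Nat.factorial_succ]
    push_cast
    field_simp
    ring

/-- A Volterra operator is quasi-nilpotent, so that `1 - K` is invertible. -/
theorem isUnit_one_sub_volterra [CompleteSpace F] (u : Control m)
    (g : Path (F →L[ℝ] E m →L[ℝ] F)) : IsUnit (1 - volterra u g) := by
  have hlim := (FloorSemiring.tendsto_pow_div_factorial_atTop ((‖u‖ * ‖g‖) ^ 2)).eventually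
    (gt_mem_nhds (by norm_num : (0 : ℝ) < 1 / 4))
  obtain ⟨j, hj⟩ := hlim.exists
  -- a power with norm less than `1`; `1 - K` divides `1 - K ^ j`
  have hK : ‖volterra u g ^ j‖ ≤ 1 / 2 := by
    refine ContinuousLinearMap.opNorm_le_bound _ (by norm_num) fun h => ?_
    rw [ContinuousMap.norm_le _ (by positivity)]
    intro t
    refine le_of_sq_le_sq ?_ (by positivity)
    refine (norm_volterra_pow_sq_le u g h j t).trans ?_
    have ht : (t : ℝ) ^ j ≤ 1 := pow_le_one₀ t.2.1 t.2.2
    calc ((‖u‖ * ‖g‖) ^ 2) ^ j * ‖h‖ ^ 2 * ((t : ℝ) ^ j / j.factorial)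
        ≤ ((‖u‖ * ‖g‖) ^ 2) ^ j * ‖h‖ ^ 2 * (1 / j.factorial) := by gcongr
      _ = ((‖u‖ * ‖g‖) ^ 2) ^ j / j.factorial * ‖h‖ ^ 2 := by ring
      _ ≤ 1 / 4 * ‖h‖ ^ 2 := by gcongr
      _ = _ := by ring
  have h1 : IsUnit (1 - volterra u g ^ j) :=
    isUnit_one_sub_of_norm_lt_one (R := Path F →L[ℝ] Path F) (hK.trans_lt (by norm_num))
  rw [← mul_neg_geom_sum] at h1
  have hc : Commute (1 - volterra u g) (∑ i ∈ Finset.range j, volterra u g ^ i) :=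
    Commute.sum_right _ _ _ fun i _ =>
      (Commute.one_left _).sub_left ((Commute.refl _).pow_right _)
  exact (hc.isUnit_mul_iff.1 h1).1

/-- A linear Volterra equation has a solution. -/
theorem exists_eq_add_volterra [CompleteSpace F] (u : Control m)
    (g : Path (F →L[ℝ] E m →L[ℝ] F)) (f : Path F) : ∃ h : Path F, h = f + volterra u g h := by
  obtain ⟨A, hA⟩ := (isUnit_one_sub_volterra u g).exists_right_inv
  refine ⟨A f, ?_⟩
  have := congrArg (fun T : Path F →L[ℝ] Path F => T f) hA
  simp only [mul_apply_eq_comp, sub_apply, one_apply_eq_self] at this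
  exact eq_add_of_sub_eq this

end Volterra

/-! ### Smoothness of superposition operators -/

section Superposition

set_option linter.unusedSectionVars false

variable {V : Type} [NormedAddCommGroup V] [NormedSpace ℝ V]

/-- The superposition operator `c ↦ f ∘ c` on continuous paths. -/
def superpose {V W : Type} [NormedAddCommGroup V] [NormedAddCommGroup W] (f : V → W)
    (hf : Continuous f) (c : Path V) : Path W := ⟨fun t => f (c t), hf.comp c.continuous⟩

theorem superpose_ext {W : Type} [NormedAddCommGroup W] (f : V → W) (hf : Continuous f)
    (c : Path V) (t : ℝ) : (superpose f hf c).ext t = f (c.ext t) := rfl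

theorem exists_nonneg_bound_of_hasCompactSupport {W : Type} [NormedAddCommGroup W]
    {f : V → W} (hf : Continuous f) (hs : HasCompactSupport f) : ∃ C, 0 ≤ C ∧ ∀ z, ‖f z‖ ≤ C := by
  obtain ⟨C, hC⟩ := hs.exists_bound_of_continuous hf
  exact ⟨C, (norm_nonneg _).trans (hC 0), hC⟩

/-- The differential of `c ↦ f ∘ c` is `h ↦ (Df ∘ c) h`: as `Df` is globally Lipschitz, the Taylor
remainder is quadratic, uniformly in the base point. -/
theorem hasFDerivAt_superpose {W : Type} [NormedAddCommGroup W] [NormedSpace ℝ W] {f : V → W}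
    (hf : ContDiff ℝ ∞ f) (hs : HasCompactSupport f) (c : Path V) :
    HasFDerivAt (superpose f hf.continuous)
      (pathApply V W (superpose (fderiv ℝ f) (hf.continuous_fderiv (by simp)) c)) c := by
  obtain ⟨C, hC⟩ := ((hf.fderiv_right (m := 1) (by norm_cast)).lipschitzWith_of_hasCompactSupport
    (hs.fderiv ℝ) (by simp))
  have hbd : ∀ x h : V, ‖f (x + h) - f x - fderiv ℝ f x h‖ ≤ C * ‖h‖ * ‖h‖ := by
    intro x h
    have := (convex_segment x (x + h)).norm_image_sub_le_of_norm_hasFDerivWithin_le'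
      (f := f) (f' := fderiv ℝ f) (φ := fderiv ℝ f x) (C := C * ‖h‖)
      (fun y _ => ((hf.differentiable (by simp)) y).hasFDerivAt.hasFDerivWithinAt)
      (fun y hy => ?_) (left_mem_segment ℝ _ _) (right_mem_segment ℝ _ _)
    · simpa using this
    · rw [← dist_eq_norm]
      refine (hC.dist_le_mul _ _).trans ?_
      gcongr
      rw [dist_eq_norm]
      simpa using norm_sub_le_of_mem_segment hy
  rw [hasFDerivAt_iff_isLittleO_nhds_zero]
  refine Asymptotics.IsBigO.trans_isLittleO (g := fun h : Path V => ‖h‖ ^ 2) ?_ ?_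
  · refine Asymptotics.IsBigO.of_bound C (.of_forall fun h => ?_)
    rw [ContinuousMap.norm_le _ (by positivity)]
    intro t
    refine (hbd (c t) (h t)).trans ?_
    rw [norm_pow, norm_norm, pow_two, mul_assoc]
    gcongr <;> exact h.norm_coe_le_norm t
  · exact Asymptotics.isLittleO_norm_pow_id one_lt_two

/-- Induction on the order: the differential of the superposition operator of `f` is that of `Df`,
followed by a continuous linear map. -/
theorem contDiff_superpose_nat (n : ℕ) : ∀ {W : Type} [NormedAddCommGroup W] [NormedSpace ℝ W]
    {f : V → W} (hf : ContDiff ℝ ∞ f) (_ : HasCompactSupport f),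
    ContDiff ℝ n (superpose f hf.continuous) := by
  induction n with
  | zero =>
    intro W _ _ f hf hs
    exact contDiff_zero.2 (continuous_iff_continuousAt.2 fun c =>
      (hasFDerivAt_superpose hf hs c).continuousAt)
  | succ n ih =>
    intro W _ _ f hf hs
    refine (contDiff_succ_iff_fderiv (n := n)).2 ⟨fun c =>
      (hasFDerivAt_superpose hf hs c).differentiableAt, by simp, ?_⟩
    have : fderiv ℝ (superpose f hf.continuous) =
        fun c => pathApply V W (superpose (fderiv ℝ f) (hf.continuous_fderiv (by simp)) c) :=
      funext fun c => (hasFDerivAt_superpose hf hs c).fderiv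
    rw [this]
    have hL : ContDiff ℝ n (fun g : Path (V →L[ℝ] W) => pathApply V W g) :=
      ContinuousLinearMap.contDiff (E := Path (V →L[ℝ] W)) (F := Path V →L[ℝ] Path W) _
    exact hL.comp (ih (hf.fderiv_right (m := ∞) (by norm_cast)) (hs.fderiv ℝ))

theorem contDiff_superpose {W : Type} [NormedAddCommGroup W] [NormedSpace ℝ W] {f : V → W}
    (hf : ContDiff ℝ ∞ f) (hs : HasCompactSupport f) :
    ContDiff ℝ 2 (superpose f hf.continuous) := contDiff_superpose_nat 2 hf hs

end Superposition

/-! ### The solution map of a control system and its first two derivatives -/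

section SolutionMap

open scoped Topology

variable {n m : ℕ} {B : E n → E m →L[ℝ] E n}

/-- The path `c` solves the integral equation `c(t) = a + ∫₀ᵗ B(c(s)) u(s) ds`. -/
def IsSolution (B : E n → E m →L[ℝ] E n) (hB : Continuous B) (a : E n) (u : Control m)
    (c : Path (E n)) : Prop :=
  c = ContinuousMap.const _ a + controlIntegral m (E n) u (superpose B hB c)

/-- The implicit function theorem solves the control system for all controls near a given one. The
partial differential of the equation with respect to the path is `1 - K` with `K` a Volterra
operator. -/
theorem exists_solutionMap (hB : ContDiff ℝ ∞ B) (hs : HasCompactSupport B) (a : E n)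
    {u₀ : Control m} {c₀ : Path (E n)} (h₀ : IsSolution B hB.continuous a u₀ c₀) :
    ∃ ψ : Control m → Path (E n), ψ u₀ = c₀ ∧ ContDiffAt ℝ 2 ψ u₀ ∧
      ∀ᶠ u in 𝓝 u₀, IsSolution B hB.continuous a u (ψ u) := by
  set J := controlIntegral m (E n)
  set f : Control m × Path (E n) → Path (E n) :=
    fun q => q.2 - J q.1 (superpose B hB.continuous q.2) with hf
  have hsup := contDiff_superpose hB hs
  have hcd : ContDiff ℝ 2 f := by
    refine contDiff_snd.sub ?_
    exact (J.isBoundedBilinearMap.contDiff (n := 2)).comp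
      (contDiff_fst.prodMk (hsup.comp contDiff_snd))
  have hpart : fderiv ℝ f (u₀, c₀) ∘L .inr ℝ (Control m) (Path (E n)) =
      1 - volterra u₀ (superpose (fderiv ℝ B) (hB.continuous_fderiv (by simp)) c₀) := by
    have h1 : HasFDerivAt (fun c : Path (E n) => (u₀, c))
        (ContinuousLinearMap.inr ℝ (Control m) (Path (E n))) c₀ := hasFDerivAt_prodMk_right u₀ c₀
    have h2 : HasFDerivAt (fun c => f (u₀, c))
        (fderiv ℝ f (u₀, c₀) ∘L .inr ℝ (Control m) (Path (E n))) c₀ :=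
      ((hcd.differentiable (by simp)) (u₀, c₀)).hasFDerivAt.comp c₀ h1
    have h3 : HasFDerivAt (fun c => f (u₀, c))
        (1 - volterra u₀ (superpose (fderiv ℝ B) (hB.continuous_fderiv (by simp)) c₀)) c₀ :=
      (hasFDerivAt_id c₀).sub ((J u₀).hasFDerivAt.comp c₀ (hasFDerivAt_superpose hB hs c₀))
    exact h2.unique h3
  have hinv : (fderiv ℝ f (u₀, c₀) ∘L .inr ℝ (Control m) (Path (E n))).IsInvertible := by
    rw [hpart]
    obtain ⟨w, hw⟩ := isUnit_one_sub_volterra u₀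
      (superpose (fderiv ℝ B) (hB.continuous_fderiv (by simp)) c₀)
    exact ⟨ContinuousLinearEquiv.unitsEquiv ℝ _ w, by rw [← hw]; rfl⟩
  refine ⟨hcd.contDiffAt.implicitFunction two_ne_zero hinv,
    hcd.contDiffAt.implicitFunction_apply_self two_ne_zero hinv,
    hcd.contDiffAt.contDiffAt_implicitFunction two_ne_zero hinv, ?_⟩
  filter_upwards [hcd.contDiffAt.eventually_apply_implicitFunction two_ne_zero hinv] with u hu
  have h0 : f (u₀, c₀) = ContinuousMap.const _ a := sub_eq_of_eq_add h₀
  exact eq_add_of_sub_eq (hu.trans h0)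

/-- The product rule, with the differential given only through its values. -/
theorem exists_hasFDerivAt_bilinear {X Y Y' Z : Type*} [NormedAddCommGroup X] [NormedSpace ℝ X]
    [NormedAddCommGroup Y] [NormedSpace ℝ Y] [NormedAddCommGroup Y'] [NormedSpace ℝ Y']
    [NormedAddCommGroup Z] [NormedSpace ℝ Z] (β : Y →L[ℝ] Y' →L[ℝ] Z) {f : X → Y} {g : X → Y'}
    {f' : X →L[ℝ] Y} {g' : X →L[ℝ] Y'} {x : X} (hf : HasFDerivAt f f' x)
    (hg : HasFDerivAt g g' x) :
    ∃ T : X →L[ℝ] Z, HasFDerivAt (fun y => β (f y) (g y)) T x ∧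
      ∀ v, T v = β (f' v) (g x) + β (f x) (g' v) :=
  ⟨_, β.hasFDerivAt_of_bilinear hf hg, fun _ => add_comm _ _⟩

theorem exists_hasFDerivAt_superpose_comp {W : Type} [NormedAddCommGroup W] [NormedSpace ℝ W]
    {f : E n → W} (hf : ContDiff ℝ ∞ f) (hs : HasCompactSupport f)
    {X : Type*} [NormedAddCommGroup X] [NormedSpace ℝ X] {ψ : X → Path (E n)}
    {ψ' : X →L[ℝ] Path (E n)} {x : X} (hψ : HasFDerivAt ψ ψ' x) :
    ∃ T : X →L[ℝ] Path W, HasFDerivAt (fun y => superpose f hf.continuous (ψ y)) T x ∧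
      ∀ v, T v = pathApply (E n) W (superpose (fderiv ℝ f) (hf.continuous_fderiv (by simp)) (ψ x))
        (ψ' v) :=
  ⟨_, (hasFDerivAt_superpose hf hs (ψ x)).comp x hψ, fun _ => rfl⟩

variable {a : E n} {ψ : Control m → Path (E n)} {u : Control m}

/-- The equation of the first variation of the solution map. -/
theorem fderiv_solutionMap (hB : ContDiff ℝ ∞ B) (hs : HasCompactSupport B)
    (hψ : DifferentiableAt ℝ ψ u)
    (hsol : ∀ᶠ u' in 𝓝 u, IsSolution B hB.continuous a u' (ψ u')) (v : Control m) :
    fderiv ℝ ψ u v =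
      controlIntegral m (E n) v (superpose B hB.continuous (ψ u)) +
      controlIntegral m (E n) u (pathApply _ _
        (superpose (fderiv ℝ B) (hB.continuous_fderiv (by simp)) (ψ u)) (fderiv ℝ ψ u v)) := by
  set J := controlIntegral m (E n)
  have h1 : HasFDerivAt (fun u' => J u' (superpose B hB.continuous (ψ u'))) _ u :=
    J.hasFDerivAt_of_bilinear (hasFDerivAt_id u)
      ((hasFDerivAt_superpose hB hs (ψ u)).comp u hψ.hasFDerivAt)
  have h2 := (h1.const_add (ContinuousMap.const _ a)).congr_of_eventuallyEq hsol
  refine (congrArg (fun T : Control m →L[ℝ] Path (E n) => T v)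
    (hψ.hasFDerivAt.unique h2)).trans ?_
  exact add_comm _ _

set_option maxHeartbeats 1000000 in
/-- The equation of the second variation of the solution map. -/
theorem fderiv_fderiv_solutionMap (hB : ContDiff ℝ ∞ B) (hs : HasCompactSupport B)
    (hψ : ContDiffAt ℝ 2 ψ u)
    (hsol : ∀ᶠ u' in 𝓝 u, IsSolution B hB.continuous a u' (ψ u')) (v : Control m) :
    fderiv ℝ (fderiv ℝ ψ) u v v =
      (2 : ℝ) • controlIntegral m (E n) v (pathApply (E n) (E m →L[ℝ] E n)
        (superpose (fderiv ℝ B) (hB.continuous_fderiv (by simp)) (ψ u)) (fderiv ℝ ψ u v)) +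
      controlIntegral m (E n) u (pathApply (E n) (E m →L[ℝ] E n)
        (pathApply (E n) (E n →L[ℝ] E m →L[ℝ] E n)
        (superpose (fderiv ℝ (fderiv ℝ B))
          ((hB.fderiv_right (m := ∞) (by norm_cast)).continuous_fderiv (by simp)) (ψ u))
        (fderiv ℝ ψ u v)) (fderiv ℝ ψ u v)) +
      controlIntegral m (E n) u (pathApply (E n) (E m →L[ℝ] E n)
        (superpose (fderiv ℝ B) (hB.continuous_fderiv (by simp)) (ψ u))
        (fderiv ℝ (fderiv ℝ ψ) u v v)) := by
  set J := controlIntegral m (E n)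
  have hB' : ContDiff ℝ ∞ (fderiv ℝ B) := hB.fderiv_right (m := ∞) (by norm_cast)
  have hd : DifferentiableAt ℝ (fderiv ℝ ψ) u :=
    (hψ.fderiv_right (m := 1) (by norm_num)).differentiableAt (by simp)
  have hψd : ∀ᶠ u' in 𝓝 u, DifferentiableAt ℝ ψ u' :=
    (hψ.eventually (by simp)).mono fun u' h => h.differentiableAt (by simp)
  have hev : ∀ᶠ u' in 𝓝 u, fderiv ℝ ψ u' v =
      J v (superpose B hB.continuous (ψ u')) +
      J u' (pathApply (E n) (E m →L[ℝ] E n)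
        (superpose (fderiv ℝ B) (hB.continuous_fderiv (by simp)) (ψ u')) (fderiv ℝ ψ u' v)) := by
    filter_upwards [hψd, hsol.eventually_nhds] with u' h1 h2
    exact fderiv_solutionMap hB hs h1 h2 v
  have hψu := hψd.self_of_nhds.hasFDerivAt
  have hdv : HasFDerivAt (fun u' => fderiv ℝ ψ u' v) ((fderiv ℝ (fderiv ℝ ψ) u).flip v) u := by
    simpa using hd.hasFDerivAt.clm_apply (hasFDerivAt_const v u)
  obtain ⟨S₁, hS₁, hS₁v⟩ := exists_hasFDerivAt_superpose_comp hB hs hψu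
  obtain ⟨S₂, hS₂, hS₂v⟩ := exists_hasFDerivAt_superpose_comp hB' (hs.fderiv ℝ) hψu
  obtain ⟨T₁, hT₁, hT₁v⟩ := exists_hasFDerivAt_bilinear J (hasFDerivAt_const v u) hS₁
  obtain ⟨T₂, hT₂, hT₂v⟩ := exists_hasFDerivAt_bilinear (pathApply (E n) (E m →L[ℝ] E n)) hS₂ hdv
  obtain ⟨T₃, hT₃, hT₃v⟩ := exists_hasFDerivAt_bilinear J (hasFDerivAt_id u) hT₂
  have h4 := hdv.unique ((hT₁.add hT₃).congr_of_eventuallyEq hev)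
  have h5 := congrArg (fun T : Control m →L[ℝ] Path (E n) => T v) h4
  simp only [add_apply, hS₁v, hS₂v, hT₁v, hT₂v, hT₃v, ContinuousLinearMap.flip_apply, map_add, id,
    zero_apply, map_zero, zero_add,
    ContinuousLinearMap.id_apply] at h5
  refine h5.trans ?_
  rw [two_smul]
  abel

/-- The second differential of `u ↦ (L (ψ u), ½ ‖u‖²)` for a continuous linear map `L`. -/
theorem fderiv_fderiv_prodMk_cost {G : Type*} [NormedAddCommGroup G] [NormedSpace ℝ G]
    (L : Path (E n) →L[ℝ] G) (hψ : ContDiffAt ℝ 2 ψ u) {Φ : Control m → G × ℝ}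
    (hΦ : Φ =ᶠ[𝓝 u] fun u' => (L (ψ u'), cost u')) (v : Control m) :
    fderiv ℝ (fderiv ℝ Φ) u v v = (L (fderiv ℝ (fderiv ℝ ψ) u v v), ‖v‖ ^ 2) := by
  have hcost : ContDiff ℝ 2 (cost (m := m)) := contDiff_const.mul (contDiff_norm_sq ℝ)
  have hcd : ContDiffAt ℝ 2 (fun u' => (L (ψ u'), cost u')) u :=
    (L.contDiff.contDiffAt.comp u hψ).prodMk hcost.contDiffAt
  have hd : DifferentiableAt ℝ (fderiv ℝ fun u' => (L (ψ u'), cost u')) u :=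
    (hcd.fderiv_right (m := 1) (by norm_num)).differentiableAt (by simp)
  have hdψ : DifferentiableAt ℝ (fderiv ℝ ψ) u :=
    (hψ.fderiv_right (m := 1) (by norm_num)).differentiableAt (by simp)
  have hev : (fun u' => fderiv ℝ (fun u' => (L (ψ u'), cost u')) u' v) =ᶠ[𝓝 u]
      fun u' => (L (fderiv ℝ ψ u' v), inner ℝ u' v) := by
    filter_upwards [hψ.eventually (by simp)] with u' h
    have h1 := L.hasFDerivAt.comp u' (h.differentiableAt (by simp)).hasFDerivAt
    have h2 := ((hasStrictFDerivAt_norm_sq u').hasFDerivAt.const_mul (1 / 2 : ℝ))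
    have h3 := (h1.prodMk h2).fderiv
    have h4 : fderiv ℝ (fun u' => (L (ψ u'), cost u')) u' = _ := h3
    rw [h4]
    simp
  have h1 : HasFDerivAt (fun u' => fderiv ℝ (fun u' => (L (ψ u'), cost u')) u' v)
      ((fderiv ℝ (fderiv ℝ fun u' => (L (ψ u'), cost u')) u).flip v) u := by
    simpa using hd.hasFDerivAt.clm_apply (hasFDerivAt_const v u)
  have h2 : HasFDerivAt (fun u' => fderiv ℝ ψ u' v) ((fderiv ℝ (fderiv ℝ ψ) u).flip v) u := by
    simpa using hdψ.hasFDerivAt.clm_apply (hasFDerivAt_const v u)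
  have h3 : HasFDerivAt (fun u' : Control m => inner ℝ u' v) ((innerSL ℝ).flip v) u :=
    ((innerSL ℝ (E := Control m)).flip v).hasFDerivAt
  have h4 := h1.unique (((L.hasFDerivAt.comp u h2).prodMk h3).congr_of_eventuallyEq hev)
  have h5 := congrArg (fun T : Control m →L[ℝ] G × ℝ => T v) h4
  rw [(hΦ.fderiv).fderiv_eq]
  refine h5.trans ?_
  rw [← real_inner_self_eq_norm_sq v]
  rfl

end SolutionMap

/-! ### Localization near a trajectory -/

section Localization

open scoped Topology

variable {n m : ℕ}

/-- The vector fields `Y¹, …, Yᵐ` as one map `z ↦ (e ↦ ∑ᵢ eᵢ Yⁱ(z))`. -/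
def controlField (Y : Fin m → E n → E n) (z : E n) : E m →L[ℝ] E n :=
  ∑ i, (EuclideanSpace.proj i : E m →L[ℝ] ℝ).smulRight (Y i z)

theorem controlField_apply (Y : Fin m → E n → E n) (z : E n) (e : E m) :
    controlField Y z e = ∑ i, e i • Y i z := by
  simp [controlField]

theorem contDiffOn_controlField {Ω : Set (E n)} {Y : Fin m → E n → E n}
    (hY : ∀ i, ContDiffOn ℝ ∞ (Y i) Ω) : ContDiffOn ℝ ∞ (controlField Y) Ω :=
  ContDiffOn.sum fun i _ => contDiffOn_const.smulRight (hY i)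

/-- Multiplication by a cut-off function makes the vector fields globally smooth with compact
support, without changing them near a given compact set. -/
theorem exists_cutoff_controlField {Ω K : Set (E n)} (hΩ : IsOpen Ω) {Y : Fin m → E n → E n}
    (hY : ∀ i, ContDiffOn ℝ ∞ (Y i) Ω) (hK : IsCompact K) (hKΩ : K ⊆ Ω) :
    ∃ B : E n → E m →L[ℝ] E n, ContDiff ℝ ∞ B ∧ HasCompactSupport B ∧
      ∃ V, IsOpen V ∧ K ⊆ V ∧ V ⊆ Ω ∧ ∀ z ∈ V, B z = controlField Y z := by
  obtain ⟨L, hL, hKL, hLΩ⟩ := exists_compact_between hK hΩ hKΩ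
  obtain ⟨f, hf1, hf0, -⟩ := exists_contMDiffMap_one_nhds_of_subset_interior (n := ⊤)
    𝓘(ℝ, E n) hK.isClosed hKL
  have hf : ContDiff ℝ ∞ f := f.contMDiff.contDiff
  obtain ⟨V, hV, hKV, hV1⟩ := eventually_nhdsSet_iff_exists.1 hf1
  refine ⟨fun z => f z • controlField Y z, ?_, ?_, V ∩ Ω, hV.inter hΩ, subset_inter hKV hKΩ,
    inter_subset_right, fun z hz => by simp [hV1 z hz.1]⟩
  · rw [contDiff_iff_contDiffAt]
    intro z
    by_cases hz : z ∈ Ω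
    · exact hf.contDiffAt.smul ((contDiffOn_controlField hY).contDiffAt (hΩ.mem_nhds hz))
    · have h0 : (fun z => f z • controlField Y z) =ᶠ[𝓝 z] fun _ => 0 := by
        filter_upwards [hL.isClosed.isOpen_compl.mem_nhds fun h => hz (hLΩ h)] with w hw
        simp only [hf0 w hw]
        exact zero_smul ℝ (controlField Y w)
      exact contDiffAt_const.congr_of_eventuallyEq h0
  · exact HasCompactSupport.intro hL fun z hz => by
      simp only [hf0 z hz]
      exact zero_smul ℝ (controlField Y z)

variable {B : E n → E m →L[ℝ] E n} {V Ω : Set (E n)} {Y : Fin m → E n → E n} {a : E n}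
  {u : Control m}

theorem IsSolution.isTrajectory {hB : Continuous B} {c : Path (E n)}
    (hc : IsSolution B hB a u c) (hVΩ : V ⊆ Ω) (hBV : ∀ z ∈ V, B z = controlField Y z)
    (hcV : ∀ t, c t ∈ V) : IsTrajectory Ω Y a u c.ext where
  continuousOn := c.continuous_ext.continuousOn
  mapsTo t _ := hVΩ (hcV _)
  eq_integral t ht := by
    have h := congrArg (fun p : Path (E n) => p ⟨t, ht⟩) hc
    rw [c.ext_of_mem ht]
    refine h.trans (congrArg (a + ·) ?_)
    rw [controlIntegral_apply]
    congr 1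
    ext1 s
    rw [superpose_ext, ← controlField_apply, hBV (c.ext s) (hcV _)]

theorem IsTrajectory.exists_isSolution {c : ℝ → E n} (hc : IsTrajectory Ω Y a u c)
    (hB : Continuous B) (hBV : ∀ z ∈ V, B z = controlField Y z) (hcV : MapsTo c (Icc 0 1) V) :
    ∃ p : Path (E n), IsSolution B hB a u p ∧ EqOn p.ext c (Icc 0 1) := by
  set p : Path (E n) := ⟨(Icc (0 : ℝ) 1).domRestrict c,
    continuousOn_iff_continuous_domRestrict.1 hc.continuousOn⟩ with hp
  have hpc : EqOn p.ext c (Icc 0 1) := fun t ht => by rw [p.ext_of_mem ht]; rfl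
  refine ⟨p, ?_, hpc⟩
  ext1 t
  change c t = a + ∫ s in (0 : ℝ)..t, (superpose B hB p).ext s (u s)
  rw [hc.eq_integral t t.2]
  congr 1
  refine intervalIntegral.integral_congr fun s hs => ?_
  rw [uIcc_of_le t.2.1] at hs
  have hs' : s ∈ Icc (0 : ℝ) 1 := ⟨hs.1, hs.2.trans t.2.2⟩
  simp only [superpose_ext, hpc hs', hBV _ (hcV hs'), controlField_apply]

/-- Solutions are unique, by the Grönwall estimate. -/
theorem IsSolution.eq (hB : ContDiff ℝ ∞ B) (hs : HasCompactSupport B) {c d : Path (E n)}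
    (hc : IsSolution B hB.continuous a u c) (hd : IsSolution B hB.continuous a u d) : c = d := by
  obtain ⟨C, hC⟩ := hB.lipschitzWith_of_hasCompactSupport hs (by simp)
  have h01 : (0 : ℝ) ∈ Icc (0 : ℝ) 1 := by simp
  ext1 t
  have key := le_of_le_add_integral_control u (φ := fun t => ‖c.ext t - d.ext t‖) (α := 0)
    (b := C) (R := ‖u‖) (c.continuous_ext.sub d.continuous_ext).norm (fun _ => norm_nonneg _)
    le_rfl C.2 le_rfl (fun t ht => ?_) t.2
  · rw [mul_zero, Path.ext_coe, Path.ext_coe] at key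
    exact sub_eq_zero.1 (norm_le_zero_iff.1 key)
  · have h1 : c ⟨t, ht⟩ = a + ∫ s in (0 : ℝ)..t, (superpose B hB.continuous c).ext s (u s) :=
      congrArg (fun p : Path (E n) => p ⟨t, ht⟩) hc
    have h2 : d ⟨t, ht⟩ = a + ∫ s in (0 : ℝ)..t, (superpose B hB.continuous d).ext s (u s) :=
      congrArg (fun p : Path (E n) => p ⟨t, ht⟩) hd
    rw [c.ext_of_mem ht, d.ext_of_mem ht, h1, h2, add_sub_add_left_eq_sub,
      ← intervalIntegral.integral_sub (intervalIntegrable_of_memLp (memLp_path_control _ u) h01 ht)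
        (intervalIntegrable_of_memLp (memLp_path_control _ u) h01 ht), zero_add,
      ← intervalIntegral.integral_const_mul]
    refine intervalIntegral.norm_integral_le_of_norm_le ht.1 (.of_forall fun s _ => ?_) ?_
    · rw [superpose_ext, superpose_ext, ← sub_apply]
      refine (ContinuousLinearMap.le_opNorm _ _).trans ?_
      rw [mul_comm ‖u s‖, ← mul_assoc]
      gcongr
      simpa [dist_eq_norm] using hC.dist_le_mul (c.ext s) (d.ext s)
    · simpa using ((intervalIntegrable_norm_mul (memLp_control u)
        (memLp_of_continuous (c.continuous_ext.sub d.continuous_ext)) h01 ht).const_mul (C : ℝ))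

/-- Trajectories are unique: two of them solve the system cut off near the union of their images. -/
theorem IsTrajectory.eqOn (hΩ : IsOpen Ω) (hY : ∀ i, ContDiffOn ℝ ∞ (Y i) Ω) {c d : ℝ → E n}
    (hc : IsTrajectory Ω Y a u c) (hd : IsTrajectory Ω Y a u d) : EqOn c d (Icc 0 1) := by
  obtain ⟨B, hB, hs, V, -, hKV, -, hBV⟩ := exists_cutoff_controlField hΩ hY
    ((isCompact_Icc.image_of_continuousOn hc.continuousOn).union
      (isCompact_Icc.image_of_continuousOn hd.continuousOn))
    (union_subset hc.mapsTo.image_subset hd.mapsTo.image_subset)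
  obtain ⟨p, hp, hpc⟩ := hc.exists_isSolution hB.continuous hBV
    (fun t ht => hKV (.inl (mem_image_of_mem c ht)))
  obtain ⟨q, hq, hqd⟩ := hd.exists_isSolution hB.continuous hBV
    (fun t ht => hKV (.inr (mem_image_of_mem d ht)))
  intro t ht
  rw [← hpc ht, ← hqd ht, hp.eq hB hs hq]

theorem IsTrajectory.eqOn_trajectory (hΩ : IsOpen Ω) (hY : ∀ i, ContDiffOn ℝ ∞ (Y i) Ω)
    {c : ℝ → E n} (hc : IsTrajectory Ω Y a u c) : EqOn (trajectory Ω Y a u) c (Icc 0 1) := by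
  have h : ∃ c, IsTrajectory Ω Y a u c := ⟨c, hc⟩
  rw [trajectory, dif_pos h]
  exact h.choose_spec.eqOn hΩ hY hc

/-- Near a control which has a trajectory, the trajectories are given by a map `ψ` of class `C²`
with values in the continuous paths, and solve a control system with compactly supported fields. -/
theorem exists_localization (hΩ : IsOpen Ω) (hY : ∀ i, ContDiffOn ℝ ∞ (Y i) Ω)
    (hu : ∃ c, IsTrajectory Ω Y a u c) :
    ∃ (B : E n → E m →L[ℝ] E n) (hB : ContDiff ℝ ∞ B) (_ : HasCompactSupport B) (V : Set (E n))
      (ψ : Control m → Path (E n)), IsOpen V ∧ V ⊆ Ω ∧ (∀ z ∈ V, B z = controlField Y z) ∧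
      ∀ᶠ u' in 𝓝 u, ContDiffAt ℝ 2 ψ u' ∧ IsSolution B hB.continuous a u' (ψ u') ∧
        (∀ t, ψ u' t ∈ V) ∧ EqOn (trajectory Ω Y a u') (ψ u').ext (Icc 0 1) := by
  obtain ⟨c, hc⟩ := hu
  obtain ⟨B, hB, hs, V, hV, hKV, hVΩ, hBV⟩ := exists_cutoff_controlField hΩ hY
    (isCompact_Icc.image_of_continuousOn hc.continuousOn) hc.mapsTo.image_subset
  obtain ⟨p, hp, hpc⟩ := hc.exists_isSolution hB.continuous hBV
    (fun t ht => hKV (mem_image_of_mem c ht))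
  obtain ⟨ψ, rfl, hψ, hsol⟩ := exists_solutionMap hB hs a hp
  refine ⟨B, hB, hs, V, ψ, hV, hVΩ, hBV, ?_⟩
  have hmaps : ∀ᶠ u' in 𝓝 u, ∀ t, ψ u' t ∈ V := by
    have hopen : IsOpen {q : Path (E n) | MapsTo q univ V} :=
      ContinuousMap.isOpen_setOfPred_mapsTo isCompact_univ hV
    have hmem : MapsTo (ψ u) univ V := fun t _ => by
      rw [← Path.ext_coe, hpc t.2]
      exact hKV (mem_image_of_mem c t.2)
    exact (hψ.continuousAt.eventually (hopen.mem_nhds hmem)).mono fun u' h t => h (mem_univ t)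
  filter_upwards [hψ.eventually (by simp), hsol, hmaps] with u' h1 h2 h3
  exact ⟨h1, h2, h3, (h2.isTrajectory hVΩ hBV h3).eqOn_trajectory hΩ hY⟩

theorem fderiv_controlField_apply {z : E n} (hY : ∀ i, DifferentiableAt ℝ (Y i) z)
    (h : E n) (e : E m) :
    fderiv ℝ (controlField Y) z h e = ∑ i, e i • fderiv ℝ (Y i) z h := by
  have h1 : HasFDerivAt (fun z => controlField Y z e) (∑ i, e i • fderiv ℝ (Y i) z) z := by
    simp only [controlField_apply]
    exact HasFDerivAt.fun_sum fun i _ => (hY i).hasFDerivAt.const_smul (e i)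
  have h2 : DifferentiableAt ℝ (controlField Y) z := by
    have : controlField Y = fun z => ∑ i, (EuclideanSpace.proj i : E m →L[ℝ] ℝ).smulRight (Y i z) :=
      rfl
    rw [this]
    refine DifferentiableAt.fun_sum fun i _ => ?_
    exact ((ContinuousLinearMap.smulRightL ℝ (E m) (E n)
      (EuclideanSpace.proj i : E m →L[ℝ] ℝ)).differentiableAt).comp z (hY i)
  have h3 : HasFDerivAt (fun z => controlField Y z e) ((fderiv ℝ (controlField Y) z).flip e) z := by
    simpa using h2.hasFDerivAt.clm_apply (hasFDerivAt_const e z)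
  have h4 := congrArg (fun T : E n →L[ℝ] E n => T h) (h3.unique h1)
  simpa [sum_apply] using h4

/-- Lie brackets in terms of the map `B z e = ∑ᵢ eᵢ Yⁱ(z)`. -/
theorem lieBracket_eq_fderiv {z : E n} (hV : IsOpen V) (hz : z ∈ V)
    (hY : ∀ i, DifferentiableAt ℝ (Y i) z) (hBV : ∀ z ∈ V, B z = controlField Y z) (i j : Fin m) :
    VectorField.lieBracket ℝ (Y i) (Y j) z =
      fderiv ℝ B z (B z (EuclideanSpace.single i 1)) (EuclideanSpace.single j 1) -
      fderiv ℝ B z (B z (EuclideanSpace.single j 1)) (EuclideanSpace.single i 1) := by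
  have hev : B =ᶠ[𝓝 z] controlField Y := Filter.eventuallyEq_of_mem (hV.mem_nhds hz) hBV
  rw [hev.fderiv_eq, hBV z hz, fderiv_controlField_apply hY, fderiv_controlField_apply hY]
  simp [VectorField.lieBracket, controlField_apply, PiLp.single_apply]

end Localization

/-! ### The linearized system and its adjoint -/

section Linearized

variable {n m : ℕ}

section Mul

variable {V H : Type} [NormedAddCommGroup V] [NormedSpace ℝ V] [NormedAddCommGroup H]
  [NormedSpace ℝ H]

/-- For `D = DB(z)`, the map `T ↦ (e ↦ D(·)e ∘ T)` on endomorphisms. -/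
def leftMul (D : V →L[ℝ] H →L[ℝ] V) : (V →L[ℝ] V) →L[ℝ] H →L[ℝ] V →L[ℝ] V :=
  ((ContinuousLinearMap.compL ℝ H (V →L[ℝ] V) (V →L[ℝ] V)).flip D.flip).comp
    (ContinuousLinearMap.compL ℝ V V V).flip

/-- For `D = DB(z)`, the map `T ↦ (e ↦ T ∘ D(·)e)` on endomorphisms. -/
def rightMul (D : V →L[ℝ] H →L[ℝ] V) : (V →L[ℝ] V) →L[ℝ] H →L[ℝ] V →L[ℝ] V :=
  ((ContinuousLinearMap.compL ℝ H (V →L[ℝ] V) (V →L[ℝ] V)).flip D.flip).comp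
    (ContinuousLinearMap.compL ℝ V V V)

theorem continuous_leftMul : Continuous (leftMul (V := V) (H := H)) :=
  ((ContinuousLinearMap.continuous _).comp
    (ContinuousLinearMap.flipₗᵢ ℝ V H V).continuous).clm_comp continuous_const

theorem continuous_rightMul : Continuous (rightMul (V := V) (H := H)) :=
  ((ContinuousLinearMap.continuous _).comp
    (ContinuousLinearMap.flipₗᵢ ℝ V H V).continuous).clm_comp continuous_const

theorem rightMul_neg_apply (D : V →L[ℝ] H →L[ℝ] V) (T : V →L[ℝ] V) (e : H) :
    rightMul (-D) T e = -T.comp (D.flip e) := by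
  ext x
  exact map_neg T _

end Mul

theorem norm_flip_apply_le {V : Type} [NormedAddCommGroup V] [NormedSpace ℝ V]
    (D : Path (V →L[ℝ] E m →L[ℝ] V)) (u : Control m) {b : ℝ} (hD : ∀ t, ‖D t‖ ≤ b) (s : ℝ) :
    ‖(D.ext s).flip (u s)‖ ≤ b * ‖u s‖ := by
  refine ((D.ext s).flip.le_opNorm _).trans ?_
  rw [ContinuousLinearMap.opNorm_flip]
  gcongr
  exact hD _

variable (D : Path (E n →L[ℝ] E m →L[ℝ] E n)) (u : Control m)

/-- The fundamental solution of the linearized system exists. -/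
theorem exists_fundamental : ∃ S : Path (E n →L[ℝ] E n), ∀ t ∈ Icc (0 : ℝ) 1,
    S.ext t = ContinuousLinearMap.id ℝ (E n) +
      ∫ s in (0 : ℝ)..t, ((D.ext s).flip (u s)).comp (S.ext s) := by
  obtain ⟨S, hS⟩ := exists_eq_add_volterra u (F := E n →L[ℝ] E n)
    (superpose leftMul continuous_leftMul D)
    (ContinuousMap.const _ (ContinuousLinearMap.id ℝ (E n)))
  refine ⟨S, fun t ht => ?_⟩
  rw [S.ext_of_mem ht]
  exact congrArg (fun p : Path (E n →L[ℝ] E n) => p ⟨t, ht⟩) hS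

/-- The inverse of the fundamental solution solves the adjoint equation. -/
theorem exists_adjoint_fundamental : ∃ R : Path (E n →L[ℝ] E n), ∀ t ∈ Icc (0 : ℝ) 1,
    R.ext t = ContinuousLinearMap.id ℝ (E n) +
      ∫ s in (0 : ℝ)..t, -(R.ext s).comp ((D.ext s).flip (u s)) := by
  obtain ⟨R, hR⟩ := exists_eq_add_volterra u (F := E n →L[ℝ] E n)
    (superpose (fun D => rightMul (-D)) (continuous_rightMul.comp continuous_neg) D)
    (ContinuousMap.const _ (ContinuousLinearMap.id ℝ (E n)))
  refine ⟨R, fun t ht => ?_⟩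
  rw [R.ext_of_mem ht]
  have h : R ⟨t, ht⟩ = ContinuousLinearMap.id ℝ (E n) +
      ∫ s in (0 : ℝ)..t, rightMul (-(D.ext s)) (R.ext s) (u s) :=
    congrArg (fun p : Path (E n →L[ℝ] E n) => p ⟨t, ht⟩) hR
  simpa only [rightMul_neg_apply] using h

theorem memLp_flip_apply_comp {S : ℝ → E n →L[ℝ] E n} (hS : Continuous S) :
    MemLp (fun s => ((D.ext s).flip (u s)).comp (S s)) 2 μ01 :=
  memLp_clm_apply (f := fun s => leftMul (D.ext s) (S s))
    ((continuous_leftMul.comp D.continuous_ext).clm_apply hS) (memLp_control u)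

theorem memLp_comp_flip_apply {R : ℝ → E n →L[ℝ] E n} (hR : Continuous R) :
    MemLp (fun s => (R s).comp ((D.ext s).flip (u s))) 2 μ01 :=
  memLp_clm_apply (f := fun s => rightMul (D.ext s) (R s))
    ((continuous_rightMul.comp D.continuous_ext).clm_apply hR) (memLp_control u)

/-- The Grönwall estimate for solutions of linear equations driven by a control. -/
theorem norm_le_of_eq_add_integral {F : Type*} [NormedAddCommGroup F] [NormedSpace ℝ F]
    {f g k : ℝ → F} (hf : Continuous f) {b R α : ℝ} (hα : 0 ≤ α) (hb : 0 ≤ b) (hu : ‖u‖ ≤ R)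
    (hg : ∀ t ∈ Icc (0 : ℝ) 1, ‖g t‖ ≤ α) (hk : ∀ s ∈ Icc (0 : ℝ) 1, ‖k s‖ ≤ b * (‖u s‖ * ‖f s‖))
    (h : ∀ t ∈ Icc (0 : ℝ) 1, f t = g t + ∫ s in (0 : ℝ)..t, k s) {t : ℝ}
    (ht : t ∈ Icc (0 : ℝ) 1) : ‖f t‖ ≤ 2 * Real.exp ((b * R) ^ 2) * α := by
  refine le_of_le_add_integral_control u (φ := fun t => ‖f t‖) hf.norm (fun _ => norm_nonneg _)
    hα hb hu (fun t ht => ?_) ht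
  have hi := intervalIntegrable_norm_mul (memLp_control u) (memLp_of_continuous hf)
    (by simp : (0 : ℝ) ∈ Icc (0 : ℝ) 1) ht
  calc ‖f t‖ = ‖g t + ∫ s in (0 : ℝ)..t, k s‖ := by rw [← h t ht]
    _ ≤ ‖g t‖ + ‖∫ s in (0 : ℝ)..t, k s‖ := norm_add_le _ _
    _ ≤ α + ∫ s in (0 : ℝ)..t, b * (‖u s‖ * ‖f s‖) := by
      refine add_le_add (hg t ht) (intervalIntegral.norm_integral_le_of_norm_le ht.1
        (.of_forall fun s hs => hk s ⟨hs.1.le, hs.2.trans ht.2⟩) (hi.const_mul b))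
    _ = _ := by rw [intervalIntegral.integral_const_mul]

/-- The covector `t ↦ ξ S(1) S(t)⁻¹` solves the adjoint equation with final value `ξ`, and is
bounded in terms of `ξ`. -/
theorem exists_adjoint_path {D : Path (E n →L[ℝ] E m →L[ℝ] E n)} {u : Control m}
    {S : ℝ → E n →L[ℝ] E n} (hSc : ContinuousOn S (Icc 0 1))
    (hS : ∀ t ∈ Icc (0 : ℝ) 1, S t = ContinuousLinearMap.id ℝ (E n) +
      ∫ s in (0 : ℝ)..t, ((D.ext s).flip (u s)).comp (S s)) {b R : ℝ} (hD : ∀ t, ‖D t‖ ≤ b)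
    (hu : ‖u‖ ≤ R) (ξ : E n →L[ℝ] ℝ) :
    ∃ P : Path (E n →L[ℝ] ℝ), P.ext 1 = ξ ∧
      (∀ t ∈ Icc (0 : ℝ) 1, P.ext t = ξ.comp ((S 1).comp (S t).inverse)) ∧
      (∀ t ∈ Icc (0 : ℝ) 1, P.ext t = P.ext 0 +
        ∫ s in (0 : ℝ)..t, -(P.ext s).comp ((D.ext s).flip (u s))) ∧
      ∀ t, ‖P.ext t‖ ≤ (2 * Real.exp ((b * R) ^ 2)) ^ 2 * ‖ξ‖ := by
  have h01 : (0 : ℝ) ∈ Icc (0 : ℝ) 1 := by simp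
  have h11 : (1 : ℝ) ∈ Icc (0 : ℝ) 1 := by simp
  have hb : 0 ≤ b := (norm_nonneg (D ⟨0, h01⟩)).trans (hD ⟨0, h01⟩)
  set G := 2 * Real.exp ((b * R) ^ 2) with hG
  set T : Path (E n →L[ℝ] E n) := ⟨(Icc (0 : ℝ) 1).domRestrict S,
    continuousOn_iff_continuous_domRestrict.1 hSc⟩ with hT
  have hTS : EqOn T.ext S (Icc 0 1) := fun t ht => by rw [T.ext_of_mem ht]; rfl
  have hTeq : ∀ t ∈ Icc (0 : ℝ) 1, T.ext t = ContinuousLinearMap.id ℝ (E n) +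
      ∫ s in (0 : ℝ)..t, ((D.ext s).flip (u s)).comp (T.ext s) := by
    intro t ht
    rw [hTS ht, hS t ht]
    congr 1
    refine intervalIntegral.integral_congr fun s hs => ?_
    rw [uIcc_of_le ht.1] at hs
    simp only [hTS ⟨hs.1, hs.2.trans ht.2⟩]
  obtain ⟨Q, hQ⟩ := exists_adjoint_fundamental D u
  have hid : ‖ContinuousLinearMap.id ℝ (E n)‖ ≤ 1 := ContinuousLinearMap.norm_id_le
  have hTn : ∀ t ∈ Icc (0 : ℝ) 1, ‖T.ext t‖ ≤ G := fun t ht => by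
    have := norm_le_of_eq_add_integral u T.continuous_ext zero_le_one hb hu
      (fun _ _ => hid) (fun s _ => ?_) hTeq ht
    · rwa [mul_one] at this
    · refine (ContinuousLinearMap.opNorm_comp_le _ _).trans ?_
      rw [← mul_assoc]
      gcongr
      exact norm_flip_apply_le D u hD s
  have hQn : ∀ t ∈ Icc (0 : ℝ) 1, ‖Q.ext t‖ ≤ G := fun t ht => by
    have := norm_le_of_eq_add_integral u Q.continuous_ext zero_le_one hb hu
      (fun _ _ => hid) (fun s _ => ?_) hQ ht
    · rwa [mul_one] at this
    · rw [norm_neg]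
      refine (ContinuousLinearMap.opNorm_comp_le _ _).trans ?_
      rw [mul_comm, ← mul_assoc]
      gcongr
      exact norm_flip_apply_le D u hD s
  have hT0 : T.ext 0 = ContinuousLinearMap.id ℝ (E n) := by simpa using hTeq 0 h01
  have hQ0 : Q.ext 0 = ContinuousLinearMap.id ℝ (E n) := by simpa using hQ 0 h01
  have hQT : ∀ t ∈ Icc (0 : ℝ) 1, (Q.ext t).comp (T.ext t) = ContinuousLinearMap.id ℝ (E n) := by
    intro t ht
    have h := bilinear_primitive (ContinuousLinearMap.compL ℝ (E n) (E n) (E n))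
      Q.continuous_ext T.continuous_ext (memLp_comp_flip_apply D u Q.continuous_ext).neg
      (memLp_flip_apply_comp D u T.continuous_ext)
      (fun t ht => by rw [hQ0]; exact hQ t ht) (fun t ht => by rw [hT0]; exact hTeq t ht) ht
    have h0 : ∀ s, ContinuousLinearMap.compL ℝ (E n) (E n) (E n)
        ((-fun s => (Q.ext s).comp ((D.ext s).flip (u s))) s) (T.ext s) +
        ContinuousLinearMap.compL ℝ (E n) (E n) (E n) (Q.ext s)
          (((D.ext s).flip (u s)).comp (T.ext s)) = 0 := by
      intro s
      ext x
      simp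
    simp only [h0, intervalIntegral.integral_zero, hQ0, hT0, add_zero] at h
    simpa using h
  -- in finite dimension a left inverse is a right inverse
  have hTQ : ∀ t ∈ Icc (0 : ℝ) 1, (T.ext t).comp (Q.ext t) = ContinuousLinearMap.id ℝ (E n) := by
    intro t ht
    have h : (Q.ext t).toLinearMap * (T.ext t).toLinearMap = 1 :=
      congrArg ContinuousLinearMap.toLinearMap (hQT t ht)
    have h' := mul_eq_one_comm.1 h
    ext1 x
    exact congrArg (fun L : E n →ₗ[ℝ] E n => L x) h'
  have hinv : ∀ t ∈ Icc (0 : ℝ) 1, (S t).inverse = Q.ext t := fun t ht => by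
    rw [← hTS ht]
    exact ContinuousLinearMap.inverse_eq (hTQ t ht) (hQT t ht)
  set η := ξ.comp (S 1) with hη
  set L := ContinuousLinearMap.compL ℝ (E n) (E n) ℝ η with hL
  set P : Path (E n →L[ℝ] ℝ) := superpose L L.continuous Q with hP
  have hPe : ∀ t, P.ext t = η.comp (Q.ext t) := fun t => rfl
  refine ⟨P, ?_, fun t ht => ?_, fun t ht => ?_, fun t => ?_⟩
  · rw [hPe, hη, ContinuousLinearMap.comp_assoc, ← hTS h11, hTQ 1 h11, ContinuousLinearMap.comp_id]
  · rw [hPe, hinv t ht, hη, ContinuousLinearMap.comp_assoc]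
  · have hi := intervalIntegrable_of_memLp (memLp_comp_flip_apply D u Q.continuous_ext).neg h01 ht
    have h1 : P.ext t = L (Q.ext t) := rfl
    have h2 : P.ext 0 = L (Q.ext 0) := rfl
    rw [h1, h2, hQ0, hQ t ht, map_add]
    congr 1
    refine (L.intervalIntegral_comp_comm hi).symm.trans (intervalIntegral.integral_congr ?_)
    intro s _
    simp only [Pi.neg_apply, map_neg]
    rfl
  · rw [hPe, hη]
    have hq : ‖Q.ext t‖ ≤ G := by
      have := hQn (projIcc (0 : ℝ) 1 zero_le_one t) (projIcc (0 : ℝ) 1 zero_le_one t).2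
      rwa [Path.ext_coe] at this
    have hs : ‖S 1‖ ≤ G := by rw [← hTS h11]; exact hTn 1 h11
    calc _ ≤ ‖ξ.comp (S 1)‖ * ‖Q.ext t‖ := ContinuousLinearMap.opNorm_comp_le _ _
      _ ≤ ‖ξ‖ * ‖S 1‖ * ‖Q.ext t‖ := by
        gcongr
        exact ContinuousLinearMap.opNorm_comp_le _ _
      _ ≤ ‖ξ‖ * G * G := by gcongr
      _ = _ := by ring

end Linearized

/-! ### The second variation along controls supported in a short interval -/

section SecondVariation

variable {m : ℕ} {V : Type} [NormedAddCommGroup V] [NormedSpace ℝ V]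

/-- The map `B` is smooth with compact support, and `b` bounds `B`, `DB` and `D²B`. -/
structure IsBoundedField (B : V → E m →L[ℝ] V) (b : ℝ) : Prop where
  contDiff : ContDiff ℝ ∞ B
  hasCompactSupport : HasCompactSupport B
  norm_le : ∀ z, ‖B z‖ ≤ b
  norm_fderiv_le : ∀ z, ‖fderiv ℝ B z‖ ≤ b
  norm_fderiv_fderiv_le : ∀ z, ‖fderiv ℝ (fderiv ℝ B) z‖ ≤ b

theorem exists_isBoundedField {B : V → E m →L[ℝ] V} (hB : ContDiff ℝ ∞ B)
    (hs : HasCompactSupport B) : ∃ b, IsBoundedField B b := by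
  have hB' : ContDiff ℝ ∞ (fderiv ℝ B) := hB.fderiv_right (m := ∞) (by norm_cast)
  obtain ⟨b₀, -, h₀⟩ := exists_nonneg_bound_of_hasCompactSupport hB.continuous hs
  obtain ⟨b₁, -, h₁⟩ := exists_nonneg_bound_of_hasCompactSupport hB'.continuous (hs.fderiv ℝ)
  obtain ⟨b₂, -, h₂⟩ := exists_nonneg_bound_of_hasCompactSupport
    (hB'.continuous_fderiv (by simp)) ((hs.fderiv ℝ).fderiv ℝ)
  exact ⟨max b₀ (max b₁ b₂), hB, hs, fun z => (h₀ z).trans (le_max_left _ _),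
    fun z => (h₁ z).trans ((le_max_left _ _).trans (le_max_right _ _)),
    fun z => (h₂ z).trans ((le_max_right _ _).trans (le_max_right _ _))⟩

namespace IsBoundedField

variable {B : V → E m →L[ℝ] V} {b : ℝ} (h : IsBoundedField B b)
include h

theorem nonneg : 0 ≤ b := (norm_nonneg _).trans (h.norm_le 0)

theorem contDiff_fderiv : ContDiff ℝ ∞ (fderiv ℝ B) :=
  h.contDiff.fderiv_right (m := ∞) (by norm_cast)

theorem norm_sub_le (z w : V) : ‖B z - B w‖ ≤ b * ‖z - w‖ :=
  convex_univ.norm_image_sub_le_of_norm_fderiv_le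
    (fun x _ => h.contDiff.differentiable (by simp) x) (fun x _ => h.norm_fderiv_le x)
    (mem_univ _) (mem_univ _)

theorem norm_fderiv_sub_le (z w : V) : ‖fderiv ℝ B z - fderiv ℝ B w‖ ≤ b * ‖z - w‖ :=
  convex_univ.norm_image_sub_le_of_norm_fderiv_le
    (fun x _ => h.contDiff_fderiv.differentiable (by simp) x)
    (fun x _ => h.norm_fderiv_fderiv_le x) (mem_univ _) (mem_univ _)

/-- The path `t ↦ B(c(t))`. -/
def field (c : Path V) : Path (E m →L[ℝ] V) := superpose B h.contDiff.continuous c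

/-- The path `t ↦ DB(c(t))`. -/
def dfield (c : Path V) : Path (V →L[ℝ] E m →L[ℝ] V) :=
  superpose (fderiv ℝ B) h.contDiff_fderiv.continuous c

/-- The path `t ↦ D²B(c(t))`. -/
def ddfield (c : Path V) : Path (V →L[ℝ] V →L[ℝ] E m →L[ℝ] V) :=
  superpose (fderiv ℝ (fderiv ℝ B)) (h.contDiff_fderiv.continuous_fderiv (by simp)) c

end IsBoundedField

/-- The primitive `t ↦ ∫₀ᵗ v` of a control. -/
def controlPrimitive (v : Control m) : Path (E m) :=
  controlIntegral m (E m) v (ContinuousMap.const _ (ContinuousLinearMap.id ℝ (E m)))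

theorem controlPrimitive_ext (v : Control m) {t : ℝ} (ht : t ∈ Icc (0 : ℝ) 1) :
    (controlPrimitive v).ext t = ∫ s in (0 : ℝ)..t, v s := Path.ext_of_mem _ ht

section Support

variable {s₀ s₁ : ℝ} (h0 : 0 ≤ s₀) (h01 : s₀ ≤ s₁) (h1 : s₁ ≤ 1)
include h0 h01 h1

theorem integral_indicator_norm_le (u : Control m) {t : ℝ} (ht : t ∈ Icc (0 : ℝ) 1) :
    ∫ s in (0 : ℝ)..t, (Icc s₀ s₁).indicator (fun s => ‖u s‖) s ≤ √(s₁ - s₀) * ‖u‖ := by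
  have hs0 : s₀ ∈ Icc (0 : ℝ) 1 := ⟨h0, h01.trans h1⟩
  have hs1 : s₁ ∈ Icc (0 : ℝ) 1 := ⟨h0.trans h01, h1⟩
  refine le_trans ?_ (integral_norm_control_le u hs0 hs1 h01)
  have hint : IntegrableOn (fun s => ‖u s‖) (Icc 0 1) :=
    ((memLp_control u).integrable (by norm_num)).norm
  rw [intervalIntegral.integral_of_le ht.1, intervalIntegral.integral_of_le h01,
    setIntegral_indicator measurableSet_Icc, ← integral_Icc_eq_integral_Ioc]
  refine setIntegral_mono_set (hint.mono_set (Icc_subset_Icc h0 h1))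
    (.of_forall fun _ => norm_nonneg _) inter_subset_right.eventuallyLE

variable {v : Control m} (hv : ∀ᵐ s ∂μ01, s ∉ Icc s₀ s₁ → v s = 0)
include hv

theorem integral_norm_le_of_support {t : ℝ} (ht : t ∈ Icc (0 : ℝ) 1) :
    ∫ s in (0 : ℝ)..t, ‖v s‖ ≤ √(s₁ - s₀) * ‖v‖ := by
  refine le_trans (le_of_eq ?_) (integral_indicator_norm_le h0 h01 h1 v ht)
  refine intervalIntegral.integral_congr_ae_restrict ?_
  refine (ae_restrict_of_ae_restrict_of_subset ?_ hv).mono fun s hs => ?_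
  · rw [uIoc_of_le ht.1]
    exact Ioc_subset_Icc_self.trans (Icc_subset_Icc_right ht.2)
  · by_cases h : s ∈ Icc s₀ s₁
    · simp [h]
    · simp [h, hs h]

/-- A control with zero mean which is supported in `[s₀, s₁]` has its primitive supported there
too. -/
theorem norm_controlPrimitive_le (hw : (controlPrimitive v).ext 1 = 0) {t : ℝ}
    (ht : t ∈ Icc (0 : ℝ) 1) :
    ‖(controlPrimitive v).ext t‖ ≤
      (Icc s₀ s₁).indicator (fun _ => √(s₁ - s₀) * ‖v‖) t := by
  have m0 : (0 : ℝ) ∈ Icc (0 : ℝ) 1 := by simp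
  have m1 : (1 : ℝ) ∈ Icc (0 : ℝ) 1 := by simp
  have hzero : ∀ {r r' : ℝ}, r ∈ Icc (0 : ℝ) 1 → r' ∈ Icc (0 : ℝ) 1 → r ≤ r' →
      (∀ s ∈ Ioo r r', s ∉ Icc s₀ s₁) → ∫ s in r..r', v s = 0 := by
    intro r r' hr hr' hrr h
    rw [intervalIntegral.integral_of_le hrr, integral_Ioc_eq_integral_Ioo]
    refine integral_eq_zero_of_ae ?_
    have h2 : ∀ᵐ s ∂(volume.restrict (Ioo r r')), s ∉ Icc s₀ s₁ → v s = 0 :=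
      ae_restrict_of_ae_restrict_of_subset
        (Ioo_subset_Icc_self.trans (Icc_subset_Icc hr.1 hr'.2)) hv
    filter_upwards [h2, ae_restrict_mem measurableSet_Ioo] with s hs hsm
    exact hs (h s hsm)
  by_cases hts : t ∈ Icc s₀ s₁
  · rw [indicator_of_mem hts, controlPrimitive_ext v ht]
    exact (intervalIntegral.norm_integral_le_integral_norm ht.1).trans
      (integral_norm_le_of_support h0 h01 h1 hv ht)
  · rw [indicator_of_notMem hts, norm_le_zero_iff]
    rw [mem_Icc, not_and_or, not_le, not_le] at hts
    rcases hts with hts | hts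
    · rw [controlPrimitive_ext v ht]
      exact hzero m0 ht ht.1 fun s hs h => absurd h.1 (by linarith [hs.2])
    · have h2 := intervalIntegral.integral_add_adjacent_intervals
        (intervalIntegrable_of_memLp (memLp_control v) m0 ht)
        (intervalIntegrable_of_memLp (memLp_control v) ht m1)
      rw [hzero ht m1 ht.2 fun s hs h => absurd h.2 (by linarith [hs.1]), add_zero] at h2
      rw [controlPrimitive_ext v ht, h2, ← controlPrimitive_ext v m1, hw]

end Support

theorem memLp_covector_comp_flip_apply {P : ℝ → V →L[ℝ] ℝ} (hP : Continuous P)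
    (D : Path (V →L[ℝ] E m →L[ℝ] V)) (u : Control m) :
    MemLp (fun s => (P s).comp ((D.ext s).flip (u s))) 2 μ01 :=
  memLp_clm_apply (f := fun s => (ContinuousLinearMap.compL ℝ V V ℝ (P s)).comp (D.ext s).flip)
    (((ContinuousLinearMap.compL ℝ V V ℝ).continuous.comp hP).clm_comp
      ((ContinuousLinearMap.flipₗᵢ ℝ V (E m) V).continuous.comp D.continuous_ext))
    (memLp_control u)

/-- The second variation `y₂`, paired with the adjoint path, is an integral in which only the first
variation `y` occurs. -/
theorem adjoint_secondVariation [CompleteSpace V] {B : V → E m →L[ℝ] V} {b : ℝ}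
    (h : IsBoundedField B b) {u v : Control m} {c y y₂ : Path V} {P : Path (V →L[ℝ] ℝ)}
    (hy₂ : y₂ = (2 : ℝ) • controlIntegral m V v (pathApply _ _ (h.dfield c) y) +
      controlIntegral m V u (pathApply V (E m →L[ℝ] V)
        (pathApply V (V →L[ℝ] E m →L[ℝ] V) (h.ddfield c) y) y) +
      controlIntegral m V u (pathApply _ _ (h.dfield c) y₂))
    (hP : ∀ t ∈ Icc (0 : ℝ) 1, P.ext t = P.ext 0 +
        ∫ s in (0 : ℝ)..t, -(P.ext s).comp (((h.dfield c).ext s).flip (u s))) :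
    P.ext 1 (y₂.ext 1) = ∫ s in (0 : ℝ)..1, P.ext s
      ((2 : ℝ) • (h.dfield c).ext s (y.ext s) (v s) +
        (h.ddfield c).ext s (y.ext s) (y.ext s) (u s)) := by
  have m0 : (0 : ℝ) ∈ Icc (0 : ℝ) 1 := by simp
  have m1 : (1 : ℝ) ∈ Icc (0 : ℝ) 1 := by simp
  have i1 : MemLp (fun s => (h.dfield c).ext s (y.ext s) (v s)) 2 μ01 :=
    memLp_path_control (pathApply _ _ (h.dfield c) y) v
  have i2 : MemLp (fun s => (h.ddfield c).ext s (y.ext s) (y.ext s) (u s)) 2 μ01 :=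
    memLp_path_control (pathApply V (E m →L[ℝ] V)
        (pathApply V (V →L[ℝ] E m →L[ℝ] V) (h.ddfield c) y) y) u
  have i3 : MemLp (fun s => (h.dfield c).ext s (y₂.ext s) (u s)) 2 μ01 :=
    memLp_path_control (pathApply _ _ (h.dfield c) y₂) u
  have i1' : MemLp (fun s => (2 : ℝ) • (h.dfield c).ext s (y.ext s) (v s)) 2 μ01 :=
    i1.const_smul (2 : ℝ)
  have i12 : MemLp (fun s => (2 : ℝ) • (h.dfield c).ext s (y.ext s) (v s) +
      (h.ddfield c).ext s (y.ext s) (y.ext s) (u s)) 2 μ01 := i1'.add i2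
  have hi : MemLp (fun s => (2 : ℝ) • (h.dfield c).ext s (y.ext s) (v s) +
      (h.ddfield c).ext s (y.ext s) (y.ext s) (u s) +
      (h.dfield c).ext s (y₂.ext s) (u s)) 2 μ01 := i12.add i3
  have hy : ∀ t ∈ Icc (0 : ℝ) 1, y₂.ext t = ∫ s in (0 : ℝ)..t,
      ((2 : ℝ) • (h.dfield c).ext s (y.ext s) (v s) +
      (h.ddfield c).ext s (y.ext s) (y.ext s) (u s) +
      (h.dfield c).ext s (y₂.ext s) (u s)) := by
    intro t ht
    have e1 : y₂ ⟨t, ht⟩ = (2 : ℝ) • (∫ s in (0 : ℝ)..t, (h.dfield c).ext s (y.ext s) (v s)) +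
        (∫ s in (0 : ℝ)..t, (h.ddfield c).ext s (y.ext s) (y.ext s) (u s)) +
        ∫ s in (0 : ℝ)..t, (h.dfield c).ext s (y₂.ext s) (u s) :=
      congrArg (fun p : Path V => p ⟨t, ht⟩) hy₂
    rw [y₂.ext_of_mem ht, intervalIntegral.integral_add (intervalIntegrable_of_memLp i12 m0 ht)
        (intervalIntegrable_of_memLp i3 m0 ht), intervalIntegral.integral_add
        (intervalIntegrable_of_memLp i1' m0 ht) (intervalIntegrable_of_memLp i2 m0 ht),
      intervalIntegral.integral_smul]
    exact e1
  have hy0 : y₂.ext 0 = 0 := by rw [hy 0 m0, intervalIntegral.integral_same]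
  have key := bilinear_primitive (ContinuousLinearMap.id ℝ (V →L[ℝ] ℝ)) P.continuous_ext
    y₂.continuous_ext (memLp_covector_comp_flip_apply P.continuous_ext (h.dfield c) u).neg hi
    hP (fun t ht => by rw [hy0, zero_add]; exact hy t ht) m1
  simp only [ContinuousLinearMap.id_apply, hy0, map_zero, zero_add] at key
  rw [key]
  refine intervalIntegral.integral_congr fun s _ => ?_
  simp only [Pi.neg_apply, neg_apply, ContinuousLinearMap.comp_apply,
    ContinuousLinearMap.flip_apply, map_add]
  ring

end SecondVariation

section Estimate

variable {m : ℕ} {V : Type} [NormedAddCommGroup V] [NormedSpace ℝ V] [CompleteSpace V]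
  {B : V → E m →L[ℝ] V} {b : ℝ} (h : IsBoundedField B b) {R : ℝ} {u v : Control m}
  (hu : ‖u‖ ≤ R) {c y : Path V} {P : Path (V →L[ℝ] ℝ)} {s₀ s₁ : ℝ} (h0 : 0 ≤ s₀)
  (h01 : s₀ ≤ s₁) (h1 : s₁ ≤ 1) {τ : ℝ} (hτ : τ ∈ Icc s₀ s₁)

/-- A primitive of a function bounded by a multiple of the control varies little on a short
interval. -/
theorem norm_sub_le_of_eq_integral {F : Type*} [NormedAddCommGroup F] [NormedSpace ℝ F]
    {f k : ℝ → F} {C : ℝ} (hC : 0 ≤ C) (hu : ‖u‖ ≤ R) (h0 : 0 ≤ s₀) (h1 : s₁ ≤ 1)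
    (hτ : τ ∈ Icc s₀ s₁) (hk : MemLp k 2 μ01) (hku : ∀ s, ‖k s‖ ≤ C * ‖u s‖)
    (hf : ∀ t ∈ Icc (0 : ℝ) 1, f t = f 0 + ∫ s in (0 : ℝ)..t, k s) {t : ℝ} (ht : t ∈ Icc s₀ s₁) :
    ‖f t - f τ‖ ≤ C * (R * √(s₁ - s₀)) := by
  have m0 : (0 : ℝ) ∈ Icc (0 : ℝ) 1 := by simp
  have hR : 0 ≤ R := (norm_nonneg _).trans hu
  have hsub : Icc s₀ s₁ ⊆ Icc (0 : ℝ) 1 := Icc_subset_Icc h0 h1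
  have key : ∀ {r t : ℝ}, r ∈ Icc s₀ s₁ → t ∈ Icc s₀ s₁ → r ≤ t →
      ‖f t - f r‖ ≤ C * (R * √(s₁ - s₀)) := by
    intro r t hr ht hrt
    have hr' := hsub hr
    have ht' := hsub ht
    rw [hf t ht', hf r hr', add_sub_add_left_eq_sub, intervalIntegral.integral_interval_sub_left
      (intervalIntegrable_of_memLp hk m0 ht') (intervalIntegrable_of_memLp hk m0 hr')]
    refine (intervalIntegral.norm_integral_le_of_norm_le hrt (.of_forall fun s _ => hku s)
      ((intervalIntegrable_of_memLp (memLp_control u) hr' ht').norm.const_mul C)).trans ?_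
    rw [intervalIntegral.integral_const_mul]
    gcongr
    refine (integral_norm_control_le u hr' ht' hrt).trans ?_
    rw [mul_comm R]
    gcongr
    · exact ht.2
    · exact hr.1
  rcases le_total τ t with hle | hle
  · exact key hτ ht hle
  · rw [norm_sub_rev]
    exact key ht hτ hle

/-- The remainder in the expansion of the first variation is at most this constant times
`(s₁ - s₀) ‖v‖`. -/
def firstVariationConst (b R : ℝ) : ℝ := 2 * Real.exp ((b * R) ^ 2) * (2 * b ^ 2 * R)

theorem firstVariationConst_nonneg (hR : 0 ≤ R) : 0 ≤ firstVariationConst b R := by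
  unfold firstVariationConst
  positivity

include h hu h0 h01 h1 hτ in
/-- The first variation along `v` is `B(c(τ)) w + O((s₁ - s₀) ‖v‖)`, with `w` the primitive of
`v`. -/
theorem firstVariation_estimate {a : V}
    (hc : c = ContinuousMap.const _ a + controlIntegral m V u (h.field c))
    (hy : y = controlIntegral m V v (h.field c) +
      controlIntegral m V u (pathApply _ _ (h.dfield c) y))
    (hv : ∀ᵐ s ∂μ01, s ∉ Icc s₀ s₁ → v s = 0) (hw : (controlPrimitive v).ext 1 = 0)
    {t : ℝ} (ht : t ∈ Icc (0 : ℝ) 1) :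
    ‖y.ext t - B (c.ext τ) ((controlPrimitive v).ext t)‖ ≤
      firstVariationConst b R * (√(s₁ - s₀) ^ 2 * ‖v‖) := by
  have m0 : (0 : ℝ) ∈ Icc (0 : ℝ) 1 := by simp
  have hb := h.nonneg
  have hR : 0 ≤ R := (norm_nonneg _).trans hu
  set σ := √(s₁ - s₀) with hσ
  have hσ0 : 0 ≤ σ := Real.sqrt_nonneg _
  set w := controlPrimitive v with hwdef
  set Bτ := B (c.ext τ) with hBτ
  set f : ℝ → V := fun t => y.ext t - Bτ (w.ext t) with hf
  -- the two parts of the inhomogeneous term in the equation of `y - B(c(τ)) w`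
  set g₁ : ℝ → V := fun s => ((h.field c).ext s - Bτ) (v s) with hg₁
  set g₂ : ℝ → V := fun s => (h.dfield c).ext s (Bτ (w.ext s)) (u s) with hg₂
  have i₀ : MemLp (fun s => (h.field c).ext s (v s)) 2 μ01 := memLp_path_control _ v
  have iB : MemLp (fun s => Bτ (v s)) 2 μ01 :=
    memLp_clm_apply (f := fun _ => Bτ) continuous_const (memLp_control v)
  have i₁ : MemLp g₁ 2 μ01 := i₀.sub iB
  have i₂ : MemLp g₂ 2 μ01 := memLp_clm_apply
    (((h.dfield c).continuous_ext).clm_apply (Bτ.continuous.comp w.continuous_ext))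
    (memLp_control u)
  have iy : MemLp (fun s => (h.dfield c).ext s (y.ext s) (u s)) 2 μ01 :=
    memLp_path_control (pathApply _ _ (h.dfield c) y) u
  have if' : MemLp (fun s => (h.dfield c).ext s (f s) (u s)) 2 μ01 := memLp_clm_apply
    (((h.dfield c).continuous_ext).clm_apply
      (y.continuous_ext.sub (Bτ.continuous.comp w.continuous_ext))) (memLp_control u)
  have hye : ∀ t ∈ Icc (0 : ℝ) 1, y.ext t = (∫ s in (0 : ℝ)..t, (h.field c).ext s (v s)) +
      ∫ s in (0 : ℝ)..t, (h.dfield c).ext s (y.ext s) (u s) := fun t ht => by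
    rw [y.ext_of_mem ht]
    exact congrArg (fun p : Path V => p ⟨t, ht⟩) hy
  have hce : ∀ t ∈ Icc (0 : ℝ) 1, c.ext t = a + ∫ s in (0 : ℝ)..t, (h.field c).ext s (u s) :=
    fun t ht => by
      rw [c.ext_of_mem ht]
      exact congrArg (fun p : Path V => p ⟨t, ht⟩) hc
  have hc0 : c.ext 0 = a := by simpa using hce 0 m0
  have hfe : ∀ t ∈ Icc (0 : ℝ) 1, f t = ((∫ s in (0 : ℝ)..t, g₁ s) + ∫ s in (0 : ℝ)..t, g₂ s) +
      ∫ s in (0 : ℝ)..t, (h.dfield c).ext s (f s) (u s) := by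
    intro t ht
    have e1 : ∫ s in (0 : ℝ)..t, g₁ s =
        (∫ s in (0 : ℝ)..t, (h.field c).ext s (v s)) - Bτ (w.ext t) := by
      rw [controlPrimitive_ext v ht, ← Bτ.intervalIntegral_comp_comm
        (intervalIntegrable_of_memLp (memLp_control v) m0 ht), ← intervalIntegral.integral_sub
        (intervalIntegrable_of_memLp i₀ m0 ht) (intervalIntegrable_of_memLp iB m0 ht)]
      rfl
    have e2 : (∫ s in (0 : ℝ)..t, g₂ s) + ∫ s in (0 : ℝ)..t, (h.dfield c).ext s (f s) (u s) =
        ∫ s in (0 : ℝ)..t, (h.dfield c).ext s (y.ext s) (u s) := by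
      rw [← intervalIntegral.integral_add (intervalIntegrable_of_memLp i₂ m0 ht)
        (intervalIntegrable_of_memLp if' m0 ht)]
      refine intervalIntegral.integral_congr fun s _ => ?_
      simp only [hg₂, hf, map_sub, sub_apply]
      abel
    rw [add_assoc, e2, e1]
    simp only [hf, hye t ht]
    abel
  have hcτ : ∀ s ∈ Icc s₀ s₁, ‖c.ext s - c.ext τ‖ ≤ b * (R * σ) := fun s hs =>
    norm_sub_le_of_eq_integral hb hu h0 h1 hτ (memLp_path_control (h.field c) u)
      (fun s => ((h.field c).ext s).le_of_opNorm_le (h.norm_le _) _)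
      (fun t ht => by rw [hc0]; exact hce t ht) hs
  have hb₁ : ∀ t ∈ Icc (0 : ℝ) 1, ‖∫ s in (0 : ℝ)..t, g₁ s‖ ≤ b * (b * (R * σ)) * (σ * ‖v‖) := by
    intro t ht
    have hae : ∀ᵐ s, s ∈ Ioc 0 t → ‖g₁ s‖ ≤ b * (b * (R * σ)) * ‖v s‖ := by
      have := (ae_restrict_iff' measurableSet_Icc).1 hv
      filter_upwards [this] with s hs hst
      by_cases hsJ : s ∈ Icc s₀ s₁
      · refine ContinuousLinearMap.le_of_opNorm_le _ ?_ _
        refine (h.norm_sub_le _ _).trans ?_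
        gcongr
        exact hcτ s hsJ
      · simp [hg₁, hs ⟨hst.1.le, hst.2.trans ht.2⟩ hsJ]
    refine (intervalIntegral.norm_integral_le_of_norm_le ht.1 hae
      ((intervalIntegrable_of_memLp (memLp_control v) m0 ht).norm.const_mul _)).trans ?_
    rw [intervalIntegral.integral_const_mul]
    gcongr
    exact integral_norm_le_of_support h0 h01 h1 hv ht
  have hiu : ∀ t ∈ Icc (0 : ℝ) 1, IntervalIntegrable
      (fun s => (Icc s₀ s₁).indicator (fun s => ‖u s‖) s) volume 0 t := fun t ht => by
    have := (intervalIntegrable_of_memLp (memLp_control u) m0 ht).norm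
    rw [intervalIntegrable_iff] at this ⊢
    exact this.indicator measurableSet_Icc
  have hb₂ : ∀ t ∈ Icc (0 : ℝ) 1, ‖∫ s in (0 : ℝ)..t, g₂ s‖ ≤
      b * (b * (σ * ‖v‖)) * (σ * R) := by
    intro t ht
    refine (intervalIntegral.norm_integral_le_of_norm_le ht.1 (.of_forall fun s hs => ?_)
      ((hiu t ht).const_mul (b * (b * (σ * ‖v‖))))).trans ?_
    · have hw' := norm_controlPrimitive_le h0 h01 h1 hv hw (t := s) ⟨hs.1.le, hs.2.trans ht.2⟩
      refine ((ContinuousLinearMap.le_opNorm₂ _ _ _).trans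
        (mul_le_mul_of_nonneg_right (mul_le_mul (h.norm_fderiv_le _)
          (Bτ.le_of_opNorm_le (h.norm_le _) _) (norm_nonneg _) hb) (norm_nonneg _))).trans ?_
      by_cases hsJ : s ∈ Icc s₀ s₁
      · rw [indicator_of_mem hsJ] at hw' ⊢
        gcongr
      · rw [indicator_of_notMem hsJ] at hw' ⊢
        rw [le_antisymm hw' (norm_nonneg _)]
        simp
    · rw [intervalIntegral.integral_const_mul]
      gcongr
      exact (integral_indicator_norm_le h0 h01 h1 u ht).trans (by gcongr)
  have := norm_le_of_eq_add_integral u (f := f)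
    (g := fun t => (∫ s in (0 : ℝ)..t, g₁ s) + ∫ s in (0 : ℝ)..t, g₂ s)
    (k := fun s => (h.dfield c).ext s (f s) (u s)) (b := b) (R := R)
    (α := 2 * b ^ 2 * R * (σ ^ 2 * ‖v‖))
    (y.continuous_ext.sub (Bτ.continuous.comp w.continuous_ext)) (by positivity) hb hu
    (fun t ht => ?_) (fun s _ => ?_) hfe ht
  · refine this.trans (le_of_eq ?_)
    unfold firstVariationConst
    ring
  · refine (norm_add_le _ _).trans ((add_le_add (hb₁ t ht) (hb₂ t ht)).trans (le_of_eq ?_))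
    ring
  · refine (ContinuousLinearMap.le_opNorm₂ _ _ _).trans ?_
    rw [mul_assoc, mul_comm ‖f s‖]
    gcongr
    exact h.norm_fderiv_le _

end Estimate

section Estimate

variable {m : ℕ} {V : Type} [NormedAddCommGroup V] [NormedSpace ℝ V] [CompleteSpace V]
  {B : V → E m →L[ℝ] V} {b : ℝ} (h : IsBoundedField B b) {R : ℝ} {u v : Control m}
  (hu : ‖u‖ ≤ R) {c y : Path V} {P : Path (V →L[ℝ] ℝ)} {s₀ s₁ : ℝ} (h0 : 0 ≤ s₀)
  (h01 : s₀ ≤ s₁) (h1 : s₁ ≤ 1) {τ : ℝ} (hτ : τ ∈ Icc s₀ s₁)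

/-- The remainder in the expansion of the second variation is at most this constant times
`(s₁ - s₀)^(3/2) ‖v‖²`. -/
def secondVariationConst (b R : ℝ) : ℝ :=
  2 * b * firstVariationConst b R + 6 * b ^ 3 * R + 2 * b * firstVariationConst b R ^ 2 * R

theorem secondVariationConst_nonneg (hb : 0 ≤ b) (hR : 0 ≤ R) : 0 ≤ secondVariationConst b R := by
  have := firstVariationConst_nonneg (b := b) hR
  unfold secondVariationConst
  positivity

include h hu h0 h01 h1 hτ in
/-- The second variation along `v`, supported in `[s₀, s₁]`, is a quadratic form in `v` with
coefficients frozen at `τ`, up to a remainder of order `(s₁ - s₀)^(3/2) ‖v‖²`. -/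
theorem secondVariation_estimate {a : V}
    (hc : c = ContinuousMap.const _ a + controlIntegral m V u (h.field c))
    (hy : y = controlIntegral m V v (h.field c) +
      controlIntegral m V u (pathApply _ _ (h.dfield c) y))
    (hv : ∀ᵐ s ∂μ01, s ∉ Icc s₀ s₁ → v s = 0) (hw : (controlPrimitive v).ext 1 = 0)
    (hP : ∀ t ∈ Icc (0 : ℝ) 1, P.ext t = P.ext 0 +
        ∫ s in (0 : ℝ)..t, -(P.ext s).comp (((h.dfield c).ext s).flip (u s)))
    {p : ℝ} (hp : ∀ t, ‖P.ext t‖ ≤ p) :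
    |(∫ s in (0 : ℝ)..1, P.ext s ((2 : ℝ) • (h.dfield c).ext s (y.ext s) (v s) +
        (h.ddfield c).ext s (y.ext s) (y.ext s) (u s))) -
      2 * ∫ s in (0 : ℝ)..1, P.ext τ (fderiv ℝ B (c.ext τ)
        (B (c.ext τ) ((controlPrimitive v).ext s)) (v s))| ≤
      p * secondVariationConst b R * (√(s₁ - s₀) ^ 3 * ‖v‖ ^ 2) := by
  have m0 : (0 : ℝ) ∈ Icc (0 : ℝ) 1 := by simp
  have m1 : (1 : ℝ) ∈ Icc (0 : ℝ) 1 := by simp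
  have hb := h.nonneg
  have hR : 0 ≤ R := (norm_nonneg _).trans hu
  have hp0 : 0 ≤ p := (norm_nonneg _).trans (hp 0)
  set σ := √(s₁ - s₀) with hσ
  have hσ0 : 0 ≤ σ := Real.sqrt_nonneg _
  have hσ1 : σ ≤ 1 := Real.sqrt_le_one.2 (by linarith)
  set w := controlPrimitive v with hwdef
  set Bτ := B (c.ext τ) with hBτ
  set Dτ := fderiv ℝ B (c.ext τ) with hDτ
  set Pτ := P.ext τ with hPτ
  set r₀ := firstVariationConst b R with hr₀
  have hr₀0 : 0 ≤ r₀ := firstVariationConst_nonneg hR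
  have hfirst : ∀ s ∈ Icc (0 : ℝ) 1, ‖y.ext s - Bτ (w.ext s)‖ ≤ r₀ * (σ ^ 2 * ‖v‖) :=
    fun s hs => firstVariation_estimate h hu h0 h01 h1 hτ hc hy hv hw hs
  have hwn : ∀ s ∈ Icc (0 : ℝ) 1, ‖w.ext s‖ ≤ (Icc s₀ s₁).indicator (fun _ => σ * ‖v‖) s :=
    fun s hs => norm_controlPrimitive_le h0 h01 h1 hv hw hs
  have hcτ : ∀ s ∈ Icc s₀ s₁, ‖c.ext s - c.ext τ‖ ≤ b * (R * σ) := fun s hs => by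
    have hce : ∀ t ∈ Icc (0 : ℝ) 1, c.ext t = a + ∫ s in (0 : ℝ)..t, (h.field c).ext s (u s) :=
      fun t ht => by
        rw [c.ext_of_mem ht]
        exact congrArg (fun p : Path V => p ⟨t, ht⟩) hc
    have hc0 : c.ext 0 = a := by simpa using hce 0 m0
    exact norm_sub_le_of_eq_integral hb hu h0 h1 hτ (memLp_path_control (h.field c) u)
      (fun s => ((h.field c).ext s).le_of_opNorm_le (h.norm_le _) _)
      (fun t ht => by rw [hc0]; exact hce t ht) hs
  have hPd : ∀ s ∈ Icc s₀ s₁, ‖P.ext s - Pτ‖ ≤ p * b * (R * σ) := fun s hs => by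
    refine norm_sub_le_of_eq_integral (by positivity) hu h0 h1 hτ
      (memLp_covector_comp_flip_apply P.continuous_ext (h.dfield c) u).neg (fun s => ?_) hP hs
    rw [Pi.neg_apply, norm_neg]
    refine (ContinuousLinearMap.opNorm_comp_le _ _).trans ?_
    rw [mul_assoc]
    gcongr
    · exact hp s
    · exact norm_flip_apply_le (h.dfield c) u (fun _ => h.norm_fderiv_le _) s
  have i1 : MemLp (fun s => (h.dfield c).ext s (y.ext s) (v s)) 2 μ01 :=
    memLp_path_control (pathApply _ _ (h.dfield c) y) v
  have i2 : MemLp (fun s => (h.ddfield c).ext s (y.ext s) (y.ext s) (u s)) 2 μ01 :=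
    memLp_path_control (pathApply V (E m →L[ℝ] V)
        (pathApply V (V →L[ℝ] E m →L[ℝ] V) (h.ddfield c) y) y) u
  have i1' : MemLp (fun s => (2 : ℝ) • (h.dfield c).ext s (y.ext s) (v s)) 2 μ01 :=
    i1.const_smul (2 : ℝ)
  have i12 : MemLp (fun s => P.ext s ((2 : ℝ) • (h.dfield c).ext s (y.ext s) (v s) +
      (h.ddfield c).ext s (y.ext s) (y.ext s) (u s))) 2 μ01 :=
    memLp_clm_apply P.continuous_ext (i1'.add i2)
  have iτ : MemLp (fun s => Pτ (Dτ (Bτ (w.ext s)) (v s))) 2 μ01 :=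
    memLp_clm_apply (f := fun _ => Pτ) continuous_const
      (memLp_clm_apply (Dτ.continuous.comp (Bτ.continuous.comp w.continuous_ext))
        (memLp_control v))
  have hiu : IntervalIntegrable (fun s => ‖u s‖) volume 0 1 :=
    (intervalIntegrable_of_memLp (memLp_control u) m0 m1).norm
  have hiJ : IntervalIntegrable (fun s => (Icc s₀ s₁).indicator (fun s => ‖u s‖) s) volume 0 1 := by
    rw [intervalIntegrable_iff] at hiu ⊢
    exact hiu.indicator measurableSet_Icc
  have hiv : IntervalIntegrable (fun s => ‖v s‖) volume 0 1 :=
    (intervalIntegrable_of_memLp (memLp_control v) m0 m1).norm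
  -- the terms with `v`, in which the coefficients are frozen
  have hv1 : ∀ s ∈ Icc (0 : ℝ) 1, (s ∉ Icc s₀ s₁ → v s = 0) →
      |P.ext s ((2 : ℝ) • (h.dfield c).ext s (y.ext s) (v s)) -
        2 * Pτ (Dτ (Bτ (w.ext s)) (v s))| ≤
      p * (2 * b * r₀ + 4 * b ^ 3 * R) * (σ ^ 2 * ‖v‖) * ‖v s‖ := by
    intro s hs hvs
    by_cases hsJ : s ∈ Icc s₀ s₁
    · have hws : ‖w.ext s‖ ≤ σ * ‖v‖ := by simpa [hsJ] using hwn s hs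
      set D := (h.dfield c).ext s with hD
      have hDn : ‖D‖ ≤ b := h.norm_fderiv_le _
      have hDd : ‖D - Dτ‖ ≤ b * (b * (R * σ)) :=
        (h.norm_fderiv_sub_le _ _).trans (by gcongr; exact hcτ s hsJ)
      have hBw : ‖Bτ (w.ext s)‖ ≤ b * (σ * ‖v‖) :=
        (Bτ.le_of_opNorm_le (h.norm_le _) _).trans (by gcongr)
      have e : P.ext s ((2 : ℝ) • D (y.ext s) (v s)) - 2 * Pτ (Dτ (Bτ (w.ext s)) (v s)) =
          2 * (P.ext s (D (y.ext s - Bτ (w.ext s)) (v s)) +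
            (P.ext s - Pτ) (D (Bτ (w.ext s)) (v s)) +
            Pτ ((D - Dτ) (Bτ (w.ext s)) (v s))) := by
        simp only [map_smul, map_sub, sub_apply, smul_eq_mul]
        ring
      have t1 : ‖P.ext s (D (y.ext s - Bτ (w.ext s)) (v s))‖ ≤
          p * (b * (r₀ * (σ ^ 2 * ‖v‖)) * ‖v s‖) := by
        refine (P.ext s).le_of_opNorm_le_of_le (hp s) ((D.le_opNorm₂ _ _).trans ?_)
        gcongr
        exact hfirst s hs
      have t2 : ‖(P.ext s - Pτ) (D (Bτ (w.ext s)) (v s))‖ ≤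
          p * b * (R * σ) * (b * (b * (σ * ‖v‖)) * ‖v s‖) := by
        refine ContinuousLinearMap.le_of_opNorm_le_of_le _ (hPd s hsJ)
          ((D.le_opNorm₂ _ _).trans ?_)
        gcongr
      have t3 : ‖Pτ ((D - Dτ) (Bτ (w.ext s)) (v s))‖ ≤
          p * (b * (b * (R * σ)) * (b * (σ * ‖v‖)) * ‖v s‖) := by
        refine Pτ.le_of_opNorm_le_of_le (hp τ) (((D - Dτ).le_opNorm₂ _ _).trans ?_)
        gcongr
      rw [e, abs_mul, abs_two]
      calc _ ≤ 2 * (p * (b * (r₀ * (σ ^ 2 * ‖v‖)) * ‖v s‖) +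
            p * b * (R * σ) * (b * (b * (σ * ‖v‖)) * ‖v s‖) +
            p * (b * (b * (R * σ)) * (b * (σ * ‖v‖)) * ‖v s‖)) := by
              gcongr
              exact norm_add₃_le.trans (add_le_add (add_le_add t1 t2) t3)
        _ = _ := by ring
    · rw [hvs hsJ]
      simp
  -- the term with `u`, which is quadratic in the first variation
  have hu1 : ∀ s ∈ Icc (0 : ℝ) 1, |P.ext s ((h.ddfield c).ext s (y.ext s) (y.ext s) (u s))| ≤
      p * (2 * b ^ 3 * (σ ^ 2 * ‖v‖ ^ 2)) * (Icc s₀ s₁).indicator (fun s => ‖u s‖) s +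
      p * (2 * b * r₀ ^ 2 * (σ ^ 4 * ‖v‖ ^ 2)) * ‖u s‖ := by
    intro s hs
    -- `χ ∈ {0, 1}` records that the main part of the first variation is supported in `[s₀, s₁]`
    set χ : ℝ := (Icc s₀ s₁).indicator (fun _ => (1 : ℝ)) s with hχ
    have hχu : (Icc s₀ s₁).indicator (fun s => ‖u s‖) s = χ * ‖u s‖ := by
      by_cases hsJ : s ∈ Icc s₀ s₁ <;> simp [hχ, hsJ]
    have hχ2 : χ ^ 2 = χ := by
      by_cases hsJ : s ∈ Icc s₀ s₁ <;> simp [hχ, hsJ]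
    have hwχ : ‖w.ext s‖ ≤ χ * (σ * ‖v‖) := by
      refine (hwn s hs).trans (le_of_eq ?_)
      by_cases hsJ : s ∈ Icc s₀ s₁ <;> simp [hχ, hsJ]
    have hyn : ‖y.ext s‖ ≤ b * (χ * (σ * ‖v‖)) + r₀ * (σ ^ 2 * ‖v‖) := by
      have e : y.ext s = Bτ (w.ext s) + (y.ext s - Bτ (w.ext s)) := by abel
      rw [e]
      refine (norm_add_le _ _).trans (add_le_add ?_ (hfirst s hs))
      exact (Bτ.le_of_opNorm_le (h.norm_le _) _).trans (by gcongr)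
    have hy2 : ‖y.ext s‖ ^ 2 ≤
        2 * (b ^ 2 * (χ * (σ ^ 2 * ‖v‖ ^ 2)) + r₀ ^ 2 * (σ ^ 4 * ‖v‖ ^ 2)) := by
      calc ‖y.ext s‖ ^ 2 ≤ (b * (χ * (σ * ‖v‖)) + r₀ * (σ ^ 2 * ‖v‖)) ^ 2 := by gcongr
        _ ≤ 2 * ((b * (χ * (σ * ‖v‖))) ^ 2 + (r₀ * (σ ^ 2 * ‖v‖)) ^ 2) := add_sq_le
        _ = 2 * (b ^ 2 * (χ ^ 2 * (σ ^ 2 * ‖v‖ ^ 2)) + r₀ ^ 2 * (σ ^ 4 * ‖v‖ ^ 2)) := by ring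
        _ = _ := by rw [hχ2]
    have hD2 : ‖(h.ddfield c).ext s (y.ext s) (y.ext s) (u s)‖ ≤ b * ‖y.ext s‖ ^ 2 * ‖u s‖ := by
      refine (ContinuousLinearMap.le_opNorm _ _).trans ?_
      gcongr
      refine (ContinuousLinearMap.le_opNorm₂ _ _ _).trans ?_
      rw [mul_assoc, ← pow_two]
      gcongr
      exact h.norm_fderiv_fderiv_le _
    refine ((P.ext s).le_of_opNorm_le_of_le (hp s) hD2).trans ?_
    rw [hχu]
    calc p * (b * ‖y.ext s‖ ^ 2 * ‖u s‖) ≤ p * (b * (2 * (b ^ 2 * (χ * (σ ^ 2 * ‖v‖ ^ 2)) +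
          r₀ ^ 2 * (σ ^ 4 * ‖v‖ ^ 2))) * ‖u s‖) := by gcongr
      _ = _ := by ring
  have hae : ∀ᵐ s, s ∈ Ioc (0 : ℝ) 1 →
      ‖P.ext s ((2 : ℝ) • (h.dfield c).ext s (y.ext s) (v s) +
        (h.ddfield c).ext s (y.ext s) (y.ext s) (u s)) - 2 * Pτ (Dτ (Bτ (w.ext s)) (v s))‖ ≤
      p * (2 * b * r₀ + 4 * b ^ 3 * R) * (σ ^ 2 * ‖v‖) * ‖v s‖ +
      (p * (2 * b ^ 3 * (σ ^ 2 * ‖v‖ ^ 2)) * (Icc s₀ s₁).indicator (fun s => ‖u s‖) s +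
      p * (2 * b * r₀ ^ 2 * (σ ^ 4 * ‖v‖ ^ 2)) * ‖u s‖) := by
    filter_upwards [(ae_restrict_iff' measurableSet_Icc).1 hv] with s hs hs1
    have hs' : s ∈ Icc (0 : ℝ) 1 := Ioc_subset_Icc_self hs1
    rw [map_add, add_sub_right_comm]
    exact (norm_add_le _ _).trans (add_le_add (hv1 s hs' (hs hs')) (hu1 s hs'))
  rw [← intervalIntegral.integral_const_mul, ← intervalIntegral.integral_sub
    (intervalIntegrable_of_memLp i12 m0 m1) ((intervalIntegrable_of_memLp iτ m0 m1).const_mul 2)]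
  refine (intervalIntegral.norm_integral_le_of_norm_le zero_le_one hae
    ((hiv.const_mul _).add ((hiJ.const_mul _).add (hiu.const_mul _)))).trans ?_
  rw [intervalIntegral.integral_add (hiv.const_mul _) ((hiJ.const_mul _).add (hiu.const_mul _)),
    intervalIntegral.integral_add (hiJ.const_mul _) (hiu.const_mul _),
    intervalIntegral.integral_const_mul, intervalIntegral.integral_const_mul,
    intervalIntegral.integral_const_mul]
  have b1 := integral_norm_le_of_support h0 h01 h1 hv m1
  have b2 : ∫ s in (0 : ℝ)..1, (Icc s₀ s₁).indicator (fun s => ‖u s‖) s ≤ σ * R :=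
    (integral_indicator_norm_le h0 h01 h1 u m1).trans (by gcongr)
  have b3 : ∫ s in (0 : ℝ)..1, ‖u s‖ ≤ R := by
    refine (integral_norm_control_le u m0 m1 zero_le_one).trans ?_
    simpa using hu
  calc _ ≤ p * (2 * b * r₀ + 4 * b ^ 3 * R) * (σ ^ 2 * ‖v‖) * (σ * ‖v‖) +
      (p * (2 * b ^ 3 * (σ ^ 2 * ‖v‖ ^ 2)) * (σ * R) +
        p * (2 * b * r₀ ^ 2 * (σ ^ 4 * ‖v‖ ^ 2)) * R) := by gcongr
    _ = p * (2 * b * r₀ + 6 * b ^ 3 * R) * (σ ^ 3 * ‖v‖ ^ 2) +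
        p * (2 * b * r₀ ^ 2 * R) * (σ ^ 3 * ‖v‖ ^ 2) * σ := by ring
    _ ≤ p * (2 * b * r₀ + 6 * b ^ 3 * R) * (σ ^ 3 * ‖v‖ ^ 2) +
        p * (2 * b * r₀ ^ 2 * R) * (σ ^ 3 * ‖v‖ ^ 2) * 1 := by gcongr
    _ = _ := by
      unfold secondVariationConst
      ring

end Estimate

/-! ### Fast loops in two components of the control -/

section Loops

variable {m : ℕ}

theorem integral_indicator_Icc {F : Type*} [NormedAddCommGroup F] [NormedSpace ℝ F]
    {s₀ s₁ t : ℝ} (h0 : 0 ≤ s₀) (h01 : s₀ ≤ s₁) (ht : s₀ ≤ t) (f : ℝ → F) :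
    ∫ s in (0 : ℝ)..t, (Icc s₀ s₁).indicator f s = ∫ s in s₀..min t s₁, f s := by
  rw [intervalIntegral.integral_of_le (h0.trans ht),
    intervalIntegral.integral_of_le (le_min ht h01), ← integral_Icc_eq_integral_Ioc,
    ← integral_Icc_eq_integral_Ioc, setIntegral_indicator measurableSet_Icc, Icc_inter_Icc,
    sup_eq_right.2 h0]

theorem integral_congr_of_ae {F : Type*} [NormedAddCommGroup F] [NormedSpace ℝ F] {f g : ℝ → F}
    (h : f =ᵐ[μ01] g) {t : ℝ} (ht : t ∈ Icc (0 : ℝ) 1) :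
    ∫ s in (0 : ℝ)..t, f s = ∫ s in (0 : ℝ)..t, g s := by
  refine intervalIntegral.integral_congr_ae ?_
  filter_upwards [(ae_restrict_iff' measurableSet_Icc).1 h] with s hs hst
  rw [uIoc_of_le ht.1] at hst
  exact hs ⟨hst.1.le, hst.2.trans ht.2⟩

theorem integral_cos_int_mul {s₀ s₁ : ℝ} (h : s₀ < s₁) (q : ℤ) :
    ∫ t in s₀..s₁, Real.cos (q * (2 * Real.pi / (s₁ - s₀)) * (t - s₀)) =
      if q = 0 then s₁ - s₀ else 0 := by
  split_ifs with hq
  · simp [hq]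
  · have hd : s₁ - s₀ ≠ 0 := (sub_pos.2 h).ne'
    have hc : (q : ℝ) * (2 * Real.pi / (s₁ - s₀)) ≠ 0 := by
      have : (q : ℝ) ≠ 0 := by exact_mod_cast hq
      have := Real.pi_ne_zero
      positivity
    rw [intervalIntegral.integral_comp_sub_right
      (fun x => Real.cos (q * (2 * Real.pi / (s₁ - s₀)) * x)) s₀,
      intervalIntegral.integral_comp_mul_left Real.cos hc, integral_cos]
    have : (q : ℝ) * (2 * Real.pi / (s₁ - s₀)) * (s₁ - s₀) = (2 * q : ℤ) * Real.pi := by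
      push_cast
      field_simp
    rw [this, Real.sin_int_mul_pi]
    simp

variable (s₀ s₁ : ℝ)

/-- The phase `2π(k+1)(t - s₀)/(s₁ - s₀)` of the `k`-th loop. -/
def loopPhase (k : ℕ) (t : ℝ) : ℝ := ((k + 1 : ℕ) : ℤ) * (2 * Real.pi / (s₁ - s₀)) * (t - s₀)

/-- The angular velocity of the `k`-th loop. -/
def loopSpeed (k : ℕ) : ℝ := (k + 1) * (2 * Real.pi / (s₁ - s₀))

/-- Superposition of circular motions in the plane of `e` and `f`. -/
def loopVelocity {K : ℕ} (e f : E m) (c : Fin K → ℝ) (t : ℝ) : E m :=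
  (∑ k, c k * Real.cos (loopPhase s₀ s₁ k t)) • e + (∑ k, c k * Real.sin (loopPhase s₀ s₁ k t)) • f

/-- The primitive of `loopVelocity` which vanishes at `s₀`. -/
def loopPosition {K : ℕ} (e f : E m) (c : Fin K → ℝ) (t : ℝ) : E m :=
  (∑ k, c k / loopSpeed s₀ s₁ k * Real.sin (loopPhase s₀ s₁ k t)) • e +
    (∑ k, c k / loopSpeed s₀ s₁ k * (1 - Real.cos (loopPhase s₀ s₁ k t))) • f

theorem continuous_loopPhase (k : ℕ) : Continuous (loopPhase s₀ s₁ k) := by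
  unfold loopPhase
  fun_prop

theorem continuous_loopVelocity {K : ℕ} (e f : E m) (c : Fin K → ℝ) :
    Continuous (loopVelocity s₀ s₁ e f c) := by
  have := fun k => continuous_loopPhase s₀ s₁ k
  unfold loopVelocity
  fun_prop

variable {s₀ s₁} (h01 : s₀ < s₁)
include h01

theorem loopSpeed_pos (k : ℕ) : 0 < loopSpeed s₀ s₁ k := by
  have := sub_pos.2 h01
  have := Real.pi_pos
  unfold loopSpeed
  positivity

theorem hasDerivAt_loopPosition {K : ℕ} (e f : E m) (c : Fin K → ℝ) (t : ℝ) :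
    HasDerivAt (loopPosition s₀ s₁ e f c) (loopVelocity s₀ s₁ e f c t) t := by
  have hp : ∀ k : ℕ, HasDerivAt (loopPhase s₀ s₁ k) (loopSpeed s₀ s₁ k) t := fun k => by
    have h := ((hasDerivAt_id t).sub_const s₀).const_mul
      ((((k + 1 : ℕ) : ℤ) : ℝ) * (2 * Real.pi / (s₁ - s₀)))
    have h' : HasDerivAt (loopPhase s₀ s₁ k)
        ((((k + 1 : ℕ) : ℤ) : ℝ) * (2 * Real.pi / (s₁ - s₀)) * 1) t := h
    simpa [loopSpeed] using h'
  have hs := fun k : ℕ => (loopSpeed_pos h01 k).ne'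
  refine HasDerivAt.add ?_ ?_
  · refine HasDerivAt.smul_const (HasDerivAt.fun_sum fun k _ => ?_) e
    refine (((hp k).sin).const_mul (c k / loopSpeed s₀ s₁ k)).congr_deriv ?_
    have := hs k
    field_simp
  · refine HasDerivAt.smul_const (HasDerivAt.fun_sum fun k _ => ?_) f
    refine ((((hp k).cos).const_sub 1).const_mul (c k / loopSpeed s₀ s₁ k)).congr_deriv ?_
    have := hs k
    field_simp

theorem integral_loopVelocity {K : ℕ} (e f : E m) (c : Fin K → ℝ) (t : ℝ) :
    ∫ s in s₀..t, loopVelocity s₀ s₁ e f c s = loopPosition s₀ s₁ e f c t := by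
  rw [intervalIntegral.integral_eq_sub_of_hasDerivAt
    (fun s _ => hasDerivAt_loopPosition h01 e f c s)
    ((continuous_loopVelocity s₀ s₁ e f c).intervalIntegrable _ _)]
  simp [loopPosition, loopPhase]

theorem loopPosition_right {K : ℕ} (e f : E m) (c : Fin K → ℝ) :
    loopPosition s₀ s₁ e f c s₁ = 0 := by
  have hd : s₁ - s₀ ≠ 0 := (sub_pos.2 h01).ne'
  have hp : ∀ k : ℕ, loopPhase s₀ s₁ k s₁ = ((k + 1 : ℕ) : ℤ) * (2 * Real.pi) := fun k => by
    unfold loopPhase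
    field_simp
  have hsin : ∀ k : ℕ, Real.sin (loopPhase s₀ s₁ k s₁) = 0 := fun k => by
    have := Real.sin_int_mul_pi (((k + 1 : ℕ) : ℤ) * 2)
    rw [hp, ← this]
    push_cast
    ring_nf
  have hcos : ∀ k : ℕ, Real.cos (loopPhase s₀ s₁ k s₁) = 1 := fun k => by
    rw [hp, Real.cos_int_mul_two_pi]
  simp [loopPosition, hsin, hcos]

omit h01 in
/-- `cos(a)cos(b) + sin(a)sin(b) = cos(a-b)` for the phases of two loops. -/
theorem cos_loopPhase_sub (k l : ℕ) (t : ℝ) :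
    Real.cos (loopPhase s₀ s₁ k t) * Real.cos (loopPhase s₀ s₁ l t) +
      Real.sin (loopPhase s₀ s₁ k t) * Real.sin (loopPhase s₀ s₁ l t) =
      Real.cos (((k : ℤ) - l : ℤ) * (2 * Real.pi / (s₁ - s₀)) * (t - s₀)) := by
  rw [← Real.cos_sub]
  congr 1
  unfold loopPhase
  push_cast
  ring

theorem integral_cos_loopPhase (k : ℕ) : ∫ t in s₀..s₁, Real.cos (loopPhase s₀ s₁ k t) = 0 := by
  unfold loopPhase
  rw [integral_cos_int_mul h01, if_neg (by positivity)]

theorem integral_norm_loopVelocity_sq {K : ℕ} {e f : E m} (he : ‖e‖ = 1) (hf : ‖f‖ = 1)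
    (hef : inner ℝ e f = 0) (c : Fin K → ℝ) :
    ∫ t in s₀..s₁, ‖loopVelocity s₀ s₁ e f c t‖ ^ 2 = (s₁ - s₀) * ∑ k, c k ^ 2 := by
  have hn : ∀ t, ‖loopVelocity s₀ s₁ e f c t‖ ^ 2 = ∑ k : Fin K, ∑ l : Fin K, c k * c l *
      Real.cos (((k : ℤ) - l : ℤ) * (2 * Real.pi / (s₁ - s₀)) * (t - s₀)) := by
    intro t
    unfold loopVelocity
    rw [norm_add_sq_real, norm_smul, norm_smul, inner_smul_left, inner_smul_right, hef, he, hf,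
      mul_one, mul_one, Real.norm_eq_abs, Real.norm_eq_abs, sq_abs, sq_abs, pow_two, pow_two,
      Finset.sum_mul_sum, Finset.sum_mul_sum, mul_zero, mul_zero, mul_zero, add_zero,
      ← Finset.sum_add_distrib]
    refine Finset.sum_congr rfl fun k _ => ?_
    rw [← Finset.sum_add_distrib]
    refine Finset.sum_congr rfl fun l _ => ?_
    rw [← cos_loopPhase_sub]
    ring
  simp only [hn]
  rw [intervalIntegral.integral_finsetSum fun k _ =>
    Continuous.intervalIntegrable (by fun_prop) _ _, Finset.mul_sum]
  refine Finset.sum_congr rfl fun k _ => ?_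
  rw [intervalIntegral.integral_finsetSum fun l _ =>
    Continuous.intervalIntegrable (by fun_prop) _ _, Finset.sum_eq_single k]
  · rw [intervalIntegral.integral_const_mul, integral_cos_int_mul h01, if_pos (by simp)]
    ring
  · intro l _ hl
    rw [intervalIntegral.integral_const_mul, integral_cos_int_mul h01, if_neg, mul_zero]
    intro h
    exact hl (Fin.ext (by omega))
  · simp

/-- The area swept by the loops: the contributions of different loops are orthogonal. -/
theorem integral_loop_area {K : ℕ} (e f : E m) (γ : E m →L[ℝ] E m →L[ℝ] ℝ) (c : Fin K → ℝ) :
    ∫ t in s₀..s₁, (γ (loopPosition s₀ s₁ e f c t) (loopVelocity s₀ s₁ e f c t) -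
      γ (loopVelocity s₀ s₁ e f c t) (loopPosition s₀ s₁ e f c t)) =
    (γ e f - γ f e) * ∑ k : Fin K, c k ^ 2 * ((s₁ - s₀) / loopSpeed s₀ s₁ k) := by
  have hn : ∀ t, γ (loopPosition s₀ s₁ e f c t) (loopVelocity s₀ s₁ e f c t) -
      γ (loopVelocity s₀ s₁ e f c t) (loopPosition s₀ s₁ e f c t) =
      (γ e f - γ f e) * ∑ k : Fin K, ∑ l : Fin K, c k / loopSpeed s₀ s₁ k * c l *
      (Real.cos (((k : ℤ) - l : ℤ) * (2 * Real.pi / (s₁ - s₀)) * (t - s₀)) -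
        Real.cos (loopPhase s₀ s₁ l t)) := by
    intro t
    have e1 : ∑ k : Fin K, ∑ l : Fin K, c k / loopSpeed s₀ s₁ k * c l *
        (Real.cos (((k : ℤ) - l : ℤ) * (2 * Real.pi / (s₁ - s₀)) * (t - s₀)) -
          Real.cos (loopPhase s₀ s₁ l t)) =
        (∑ k : Fin K, c k / loopSpeed s₀ s₁ k * Real.sin (loopPhase s₀ s₁ k t)) *
          (∑ l : Fin K, c l * Real.sin (loopPhase s₀ s₁ l t)) -
        (∑ k : Fin K, c k / loopSpeed s₀ s₁ k * (1 - Real.cos (loopPhase s₀ s₁ k t))) *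
          ∑ l : Fin K, c l * Real.cos (loopPhase s₀ s₁ l t) := by
      rw [Finset.sum_mul_sum, Finset.sum_mul_sum, ← Finset.sum_sub_distrib]
      refine Finset.sum_congr rfl fun k _ => ?_
      rw [← Finset.sum_sub_distrib]
      refine Finset.sum_congr rfl fun l _ => ?_
      rw [← cos_loopPhase_sub]
      ring
    rw [e1]
    simp only [loopPosition, loopVelocity, map_add, map_smul, add_apply, smul_apply, smul_eq_mul]
    ring
  have hc := fun k => continuous_loopPhase s₀ s₁ k
  simp only [hn]
  rw [intervalIntegral.integral_const_mul, intervalIntegral.integral_finsetSum fun k _ =>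
    Continuous.intervalIntegrable (by fun_prop) _ _]
  congr 1
  refine Finset.sum_congr rfl fun k _ => ?_
  rw [intervalIntegral.integral_finsetSum fun l _ =>
    Continuous.intervalIntegrable (by fun_prop) _ _]
  have hl : ∀ l : Fin K, ∫ t in s₀..s₁, c k / loopSpeed s₀ s₁ k * c l *
      (Real.cos (((k : ℤ) - l : ℤ) * (2 * Real.pi / (s₁ - s₀)) * (t - s₀)) -
        Real.cos (loopPhase s₀ s₁ l t)) =
      c k / loopSpeed s₀ s₁ k * c l * if (k : ℤ) - l = 0 then s₁ - s₀ else 0 := fun l => by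
    rw [intervalIntegral.integral_const_mul, intervalIntegral.integral_sub
      (Continuous.intervalIntegrable (by fun_prop) _ _)
      (Continuous.intervalIntegrable (by fun_prop) _ _), integral_cos_loopPhase h01,
      integral_cos_int_mul h01, sub_zero]
  simp only [hl]
  rw [Finset.sum_eq_single k]
  · rw [if_pos (by simp)]
    ring
  · intro l _ hlk
    rw [if_neg, mul_zero]
    intro h
    exact hlk (Fin.ext (by omega))
  · simp

variable (s₀ s₁) in
omit h01 in
theorem memLp_indicator_loopVelocity {K : ℕ} (e f : E m) (c : Fin K → ℝ) :
    MemLp ((Icc s₀ s₁).indicator (loopVelocity s₀ s₁ e f c)) 2 μ01 :=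
  (memLp_of_continuous (continuous_loopVelocity s₀ s₁ e f c)).indicator measurableSet_Icc

variable (s₀ s₁) in
omit h01 in
/-- The control which runs the loops on `[s₀, s₁]` and vanishes elsewhere, as a function of the
amplitudes. -/
def loopControl (K : ℕ) (e f : E m) : (Fin K → ℝ) →ₗ[ℝ] Control m where
  toFun c := (memLp_indicator_loopVelocity s₀ s₁ e f c).toLp
  map_add' c d := by
    rw [← MemLp.toLp_add]
    refine MemLp.toLp_congr _ _ (.of_forall fun t => ?_)
    rw [← indicator_add']
    congr 1
    funext t
    simp only [loopVelocity, Pi.add_apply, add_mul, Finset.sum_add_distrib, add_smul]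
    abel
  map_smul' r c := by
    rw [RingHom.id_apply, ← MemLp.toLp_const_smul]
    refine MemLp.toLp_congr _ _ (.of_forall fun t => ?_)
    rw [Pi.smul_apply, ← indicator_const_smul_apply]
    congr 1
    funext t
    simp only [loopVelocity, Pi.smul_apply, smul_eq_mul, mul_assoc, ← Finset.mul_sum, smul_add,
      mul_smul]

omit h01 in
theorem coeFn_loopControl {K : ℕ} (e f : E m) (c : Fin K → ℝ) :
    loopControl s₀ s₁ K e f c =ᵐ[μ01] (Icc s₀ s₁).indicator (loopVelocity s₀ s₁ e f c) :=
  (memLp_indicator_loopVelocity s₀ s₁ e f c).coeFn_toLp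

variable (h0 : 0 ≤ s₀)
include h0

theorem controlPrimitive_loopControl {K : ℕ} (e f : E m) (c : Fin K → ℝ) {t : ℝ}
    (ht : t ∈ Icc s₀ 1) : (controlPrimitive (loopControl s₀ s₁ K e f c)).ext t =
      loopPosition s₀ s₁ e f c (min t s₁) := by
  have ht' : t ∈ Icc (0 : ℝ) 1 := ⟨h0.trans ht.1, ht.2⟩
  rw [controlPrimitive_ext _ ht', integral_congr_of_ae (coeFn_loopControl e f c) ht',
    integral_indicator_Icc h0 h01.le ht.1, integral_loopVelocity h01]

variable (h1 : s₁ ≤ 1)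
include h1

theorem norm_loopControl_sq {K : ℕ} {e f : E m} (he : ‖e‖ = 1) (hf : ‖f‖ = 1)
    (hef : inner ℝ e f = 0) (c : Fin K → ℝ) :
    ‖loopControl s₀ s₁ K e f c‖ ^ 2 = (s₁ - s₀) * ∑ k, c k ^ 2 := by
  have h : (fun s => ‖loopControl s₀ s₁ K e f c s‖ ^ 2) =ᵐ[μ01]
      (Icc s₀ s₁).indicator fun s => ‖loopVelocity s₀ s₁ e f c s‖ ^ 2 := by
    filter_upwards [coeFn_loopControl e f c] with s hs
    rw [hs]
    by_cases h : s ∈ Icc s₀ s₁ <;> simp [h]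
  rw [← integral_norm_sq_control, integral_congr_of_ae h (by simp),
    integral_indicator_Icc h0 h01.le (h01.le.trans h1), min_eq_right h1,
    integral_norm_loopVelocity_sq h01 he hf hef]

theorem controlPrimitive_loopControl_one {K : ℕ} (e f : E m) (c : Fin K → ℝ) :
    (controlPrimitive (loopControl s₀ s₁ K e f c)).ext 1 = 0 := by
  rw [controlPrimitive_loopControl h01 h0 e f c ⟨h01.le.trans h1, le_rfl⟩, min_eq_right h1,
    loopPosition_right h01]

theorem two_mul_integral_loopControl {K : ℕ} (e f : E m) (γ : E m →L[ℝ] E m →L[ℝ] ℝ)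
    (c : Fin K → ℝ) :
    2 * ∫ s in (0 : ℝ)..1, γ ((controlPrimitive (loopControl s₀ s₁ K e f c)).ext s)
        (loopControl s₀ s₁ K e f c s) =
      (γ e f - γ f e) * ∑ k : Fin K, c k ^ 2 * ((s₁ - s₀) / loopSpeed s₀ s₁ k) := by
  have m1 : (1 : ℝ) ∈ Icc (0 : ℝ) 1 := by simp
  have m0 : (0 : ℝ) ∈ Icc (0 : ℝ) 1 := by simp
  set v := loopControl s₀ s₁ K e f c with hv
  set w := controlPrimitive v with hw
  have hv2 := memLp_control v
  have hw0 : w.ext 0 = 0 := by rw [hw, controlPrimitive_ext v m0]; simp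
  have hwt : ∀ t ∈ Icc (0 : ℝ) 1, w.ext t = w.ext 0 + ∫ s in (0 : ℝ)..t, v s := fun t ht => by
    rw [hw0, zero_add, hw, controlPrimitive_ext v ht]
  have i1 : IntervalIntegrable (fun s => γ (w.ext s) (v s)) volume 0 1 :=
    intervalIntegrable_of_memLp (memLp_clm_apply (γ.continuous.comp w.continuous_ext) hv2) m0 m1
  have i2 : IntervalIntegrable (fun s => γ (v s) (w.ext s)) volume 0 1 :=
    intervalIntegrable_of_memLp
      (memLp_clm_apply (γ.flip.continuous.comp w.continuous_ext) hv2) m0 m1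
  -- the symmetric part of `γ` contributes a boundary term, which vanishes for a loop
  have hsym := bilinear_primitive γ w.continuous_ext w.continuous_ext hv2 hv2 hwt hwt m1
  have hw1 : w.ext 1 = 0 := controlPrimitive_loopControl_one h01 h0 h1 e f c
  rw [hw0, hw1, map_zero, zero_add,
    intervalIntegral.integral_add i2 i1] at hsym
  have h : (fun s => γ (w.ext s) (v s) - γ (v s) (w.ext s)) =ᵐ[μ01]
      (Icc s₀ s₁).indicator fun s =>
        γ (loopPosition s₀ s₁ e f c s) (loopVelocity s₀ s₁ e f c s) -
          γ (loopVelocity s₀ s₁ e f c s) (loopPosition s₀ s₁ e f c s) := by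
    filter_upwards [coeFn_loopControl e f c] with s hs
    rw [hv, hs]
    by_cases hsI : s ∈ Icc s₀ s₁
    · rw [hw, hv, controlPrimitive_loopControl h01 h0 e f c ⟨hsI.1, hsI.2.trans h1⟩,
        min_eq_left hsI.2, indicator_of_mem hsI, indicator_of_mem hsI]
    · simp [hsI]
  have harea : ∫ s in (0 : ℝ)..1, (γ (w.ext s) (v s) - γ (v s) (w.ext s)) =
      (γ e f - γ f e) * ∑ k : Fin K, c k ^ 2 * ((s₁ - s₀) / loopSpeed s₀ s₁ k) := by
    rw [integral_congr_of_ae h m1, integral_indicator_Icc h0 h01.le (h01.le.trans h1),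
      min_eq_right h1, integral_loop_area h01]
  rw [intervalIntegral.integral_sub i1 i2] at harea
  linarith

/-- When `γ` is negative on the plane of the loops, the quadratic form `v ↦ 2 ∫ γ(∫v, v)` is
negative on the loops, with a bound which is linear in the length of the interval. -/
theorem two_mul_integral_loopControl_le {K : ℕ} {e f : E m} (he : ‖e‖ = 1) (hf : ‖f‖ = 1)
    (hef : inner ℝ e f = 0) (γ : E m →L[ℝ] E m →L[ℝ] ℝ) (hγ : γ e f - γ f e ≤ 0)
    (c : Fin K → ℝ) :
    2 * ∫ s in (0 : ℝ)..1, γ ((controlPrimitive (loopControl s₀ s₁ K e f c)).ext s)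
        (loopControl s₀ s₁ K e f c s) ≤
      (γ e f - γ f e) * ((s₁ - s₀) / (2 * Real.pi * K) * ‖loopControl s₀ s₁ K e f c‖ ^ 2) := by
  rw [two_mul_integral_loopControl h01 h0 h1, norm_loopControl_sq h01 h0 h1 he hf hef]
  refine mul_le_mul_of_nonpos_left ?_ hγ
  rw [Finset.mul_sum, Finset.mul_sum]
  refine Finset.sum_le_sum fun k _ => ?_
  have hd := sub_pos.2 h01
  have hπ := Real.pi_pos
  have hk : ((k : ℕ) : ℝ) + 1 ≤ K := by exact_mod_cast k.2
  have h : loopSpeed s₀ s₁ k ≤ 2 * Real.pi * K / (s₁ - s₀) := by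
    unfold loopSpeed
    rw [mul_div_assoc', mul_comm]
    gcongr
  calc (s₁ - s₀) / (2 * Real.pi * K) * ((s₁ - s₀) * c k ^ 2)
      = c k ^ 2 * ((s₁ - s₀) / (2 * Real.pi * K / (s₁ - s₀))) := by
        field_simp
    _ ≤ _ := by
        have := loopSpeed_pos h01 k
        gcongr

theorem loopControl_injective {K : ℕ} {e f : E m} (he : ‖e‖ = 1) (hf : ‖f‖ = 1)
    (hef : inner ℝ e f = 0) : Function.Injective (loopControl s₀ s₁ K e f) := by
  rw [injective_iff_map_eq_zero]
  intro c hc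
  have h := norm_loopControl_sq h01 h0 h1 he hf hef c
  rw [hc, norm_zero, zero_pow two_ne_zero, eq_comm, mul_eq_zero,
    or_iff_right (sub_pos.2 h01).ne', Finset.sum_eq_zero_iff_of_nonneg fun k _ => sq_nonneg _] at h
  exact funext fun k => pow_eq_zero_iff two_ne_zero |>.1 (h k (Finset.mem_univ k))

end Loops

/-! ### Vector fields and covectors in a chart -/

section Chart

open Filter Topology

variable {n m : ℕ} {M : Type*} [TopologicalSpace M] [ChartedSpace (E n) M]
  [IsManifold (𝓡 n) ∞ M] {Φ : OpenPartialHomeomorph M (E n)}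

theorem contDiffOn_chartField (hΦ : Φ ∈ IsManifold.maximalAtlas (𝓡 n) ∞ M)
    {X : Fin m → (q : M) → TangentSpace (𝓡 n) q} {i : Fin m}
    (hX : ContMDiffOn (𝓡 n) (𝓡 n).tangent ∞
      (fun q => (⟨q, X i q⟩ : TangentBundle (𝓡 n) M)) Φ.source) :
    ContDiffOn ℝ ∞ (chartField Φ X i) Φ.target := by
  have h1 := (contMDiffOn_of_mem_maximalAtlas hΦ).contMDiffOn_tangentMapWithin (m := ∞) (by simp)
    Φ.open_source.uniqueMDiffOn
  have h2 := (h1.comp hX fun q hq => hq).comp (contMDiffOn_symm_of_mem_maximalAtlas hΦ)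
    Φ.mapsTo_symm
  refine contMDiffOn_vectorSpace_iff_contDiffOn.1 (h2.congr fun z hz =>
    Bundle.TotalSpace.ext (Φ.right_inv hz).symm (heq_of_eq ?_))
  have hs : Φ.source ∈ 𝓝 (Φ.symm z) := Φ.open_source.mem_nhds (Φ.map_target hz)
  simp only [chartField, Function.comp_apply, tangentMapWithin]
  rw [mfderivWithin_of_mem_nhds hs]

variable (h : Bundle.ContMDiffRiemannianMetric (𝓡 n) ∞ (E n) (fun q : M => TangentSpace (𝓡 n) q))

/-- The metric along the coordinate vector fields of a chart is continuous. -/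
theorem continuousAt_metric_mfderiv_symm (hΦ : Φ ∈ IsManifold.maximalAtlas (𝓡 n) ∞ M)
    (e : E n) {z : E n} (hz : z ∈ Φ.target) :
    ContinuousAt (fun z => h.inner (Φ.symm z) (mfderiv 𝓘(ℝ, E n) (𝓡 n) Φ.symm z e)
      (mfderiv 𝓘(ℝ, E n) (𝓡 n) Φ.symm z e)) z := by
  have hΦs := contMDiffOn_symm_of_mem_maximalAtlas hΦ
  have h1 := hΦs.contMDiffOn_tangentMapWithin (m := ∞) (by simp) Φ.open_target.uniqueMDiffOn
  have h2 : ContMDiffOn 𝓘(ℝ, E n) 𝓘(ℝ, E n).tangent ∞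
      (fun z => (⟨z, e⟩ : TangentBundle 𝓘(ℝ, E n) (E n))) Φ.target :=
    contMDiffOn_vectorSpace_iff_contDiffOn.2 contDiffOn_const
  have h3 : ContMDiffOn 𝓘(ℝ, E n) (𝓡 n).tangent ∞
      (fun z => (⟨Φ.symm z, mfderiv 𝓘(ℝ, E n) (𝓡 n) Φ.symm z e⟩ : TangentBundle (𝓡 n) M))
      Φ.target := by
    refine (h1.comp h2 fun q hq => hq).congr fun z hz => ?_
    simp only [Function.comp_apply, tangentMapWithin]
    rw [mfderivWithin_of_mem_nhds (Φ.open_target.mem_nhds hz)]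
  have hn := Φ.open_target.mem_nhds hz
  have h4 := h3.contMDiffAt hn
  have h5 : ContMDiffAt 𝓘(ℝ, E n) ((𝓡 n).prod 𝓘(ℝ)) ∞ (fun z =>
      Bundle.TotalSpace.mk' ℝ (E := Bundle.Trivial M ℝ) (Φ.symm z)
        (h.inner (Φ.symm z) (mfderiv 𝓘(ℝ, E n) (𝓡 n) Φ.symm z e)
      (mfderiv 𝓘(ℝ, E n) (𝓡 n) Φ.symm z e))) z := by
    apply ContMDiffAt.clm_bundle_apply₂ (F₁ := E n) (F₂ := E n)
    · exact ContMDiffAt.comp z h.contMDiff.contMDiffAt (hΦs.contMDiffAt hn)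
    · exact h4
    · exact h4
  simp only [Bundle.contMDiffAt_totalSpace] at h5
  exact h5.2.continuousAt

variable {h} in
theorem bddAbove_covectorNorm (q : M) (p : TangentSpace (𝓡 n) q →L[ℝ] ℝ) :
    BddAbove {r : ℝ | ∃ w : TangentSpace (𝓡 n) q, h.inner q w w ≤ 1 ∧ r = |p w|} := by
  have hb := (NormedSpace.isVonNBounded_iff ℝ).1 ((h.isVonNBounded q).image p)
  obtain ⟨C, hC⟩ := hb.exists_norm_le
  refine ⟨2 * C, ?_⟩
  rintro r ⟨w, hw, rfl⟩
  have h1 : ‖p ((1 / 2 : ℝ) • w)‖ ≤ C := hC _ (mem_image_of_mem _ (by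
    simp only [mem_ofPred_eq, map_smul, smul_apply, smul_eq_mul]
    linarith))
  rw [map_smul, norm_smul, Real.norm_eq_abs (p w)] at h1
  norm_num at h1
  linarith

theorem covectorNorm_nonneg (q : M) (p : TangentSpace (𝓡 n) q →L[ℝ] ℝ) :
    0 ≤ covectorNorm h q p :=
  Real.sSup_nonneg (by rintro r ⟨w, -, rfl⟩; exact abs_nonneg _)

theorem abs_apply_le_covectorNorm (q : M) (p : TangentSpace (𝓡 n) q →L[ℝ] ℝ)
    (w : TangentSpace (𝓡 n) q) : |p w| ≤ covectorNorm h q p * √(h.inner q w w) := by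
  rcases eq_or_ne w 0 with rfl | hw
  · simp
  have hpos := h.pos q w hw
  have hs : 0 < √(h.inner q w w) := Real.sqrt_pos.2 hpos
  have h1 : |p ((√(h.inner q w w))⁻¹ • w)| ≤ covectorNorm h q p := by
    refine le_csSup (bddAbove_covectorNorm q p) ⟨_, ?_, rfl⟩
    simp only [map_smul, smul_apply, smul_eq_mul]
    rw [← mul_assoc, ← mul_inv, Real.mul_self_sqrt hpos.le, inv_mul_cancel₀ hpos.ne']
  rw [map_smul, smul_eq_mul, abs_mul, abs_of_pos (inv_pos.2 hs), inv_mul_le_iff₀ hs] at h1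
  linarith

/-- The Euclidean norm of a covector read in a chart is locally uniformly bounded by its
Riemannian norm. -/
theorem exists_norm_chartCovector_le (hΦ : Φ ∈ IsManifold.maximalAtlas (𝓡 n) ∞ M) {z₀ : E n}
    (hz₀ : z₀ ∈ Φ.target) : ∃ C : ℝ, 0 < C ∧ ∀ᶠ z in 𝓝 z₀,
      ∀ p : TangentSpace (𝓡 n) (Φ.symm z) →L[ℝ] ℝ,
        ‖chartCovector Φ z p‖ ≤ C * covectorNorm h (Φ.symm z) p := by
  set g : Fin n → E n → ℝ := fun k z => √(h.inner (Φ.symm z)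
    (mfderiv 𝓘(ℝ, E n) (𝓡 n) Φ.symm z (EuclideanSpace.single k 1))
    (mfderiv 𝓘(ℝ, E n) (𝓡 n) Φ.symm z (EuclideanSpace.single k 1))) with hg
  have hgc : ContinuousAt (fun z => ∑ k, g k z) z₀ := tendsto_finsetSum _ fun k _ =>
    (continuousAt_metric_mfderiv_symm h hΦ _ hz₀).sqrt
  have hg0 : 0 ≤ ∑ k, g k z₀ := Finset.sum_nonneg fun k _ => Real.sqrt_nonneg _
  refine ⟨∑ k, g k z₀ + 1, by linarith, ?_⟩
  filter_upwards [hgc.eventually (eventually_lt_nhds (lt_add_one _))] with z hz p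
  have hp := covectorNorm_nonneg h _ p
  refine ContinuousLinearMap.opNorm_le_bound _ (by positivity) fun w => ?_
  have hw : w = ∑ k, w k • EuclideanSpace.single k (1 : ℝ) := by
    ext l
    simp [Finset.sum_apply, Pi.single_apply]
  calc ‖chartCovector Φ z p w‖
      = ‖∑ k, w k * chartCovector Φ z p (EuclideanSpace.single k 1)‖ := by
        conv_lhs => rw [hw, map_sum]
        simp only [map_smul, smul_eq_mul]
    _ ≤ ∑ k, ‖w‖ * (covectorNorm h (Φ.symm z) p * g k z) := by
        refine norm_sum_le_of_le _ fun k _ => ?_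
        rw [norm_mul]
        exact mul_le_mul (PiLp.norm_apply_le w k) (abs_apply_le_covectorNorm h _ p _)
          (norm_nonneg _) (norm_nonneg _)
    _ = (∑ k, g k z) * covectorNorm h (Φ.symm z) p * ‖w‖ := by
        rw [← Finset.mul_sum, ← Finset.mul_sum]
        ring
    _ ≤ _ := by gcongr

end Chart

/-! ### Negative directions of the second variation -/

section NegativeIndex

/-- A subspace of dimension `K` on which `Q` is negative still has dimension at least `N` once it
is intersected with the kernel of a linear map into a space of dimension at most `K - N`. -/
theorem le_negIndex_ker {H G : Type*} [AddCommGroup H] [Module ℝ H] [AddCommGroup G] [Module ℝ G]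
    [FiniteDimensional ℝ G] (A : H →ₗ[ℝ] G) {K N : ℕ} (hK : N + Module.finrank ℝ G ≤ K)
    (T : (Fin K → ℝ) →ₗ[ℝ] H) (hT : Function.Injective T) {Q : LinearMap.ker A → ℝ}
    (hQ : ∀ v : LinearMap.ker A, ∀ c : Fin K → ℝ, (v : H) = T c → v ≠ 0 → Q v < 0) :
    (N : ℕ∞) ≤ negIndex Q := by
  set S := LinearMap.ker (A ∘ₗ T)
  set g : S →ₗ[ℝ] LinearMap.ker A := (T.domRestrict S).codRestrict _ fun c => c.2
  have hg : Function.Injective g := fun c d hcd =>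
    Subtype.ext (hT (congrArg (Subtype.val : LinearMap.ker A → H) hcd))
  have hneg : ∀ v ∈ LinearMap.range g, v ≠ 0 → Q v < 0 := by
    rintro _ ⟨c, rfl⟩ hne
    exact hQ _ c rfl hne
  have hdim : N ≤ Module.finrank ℝ (LinearMap.range g) := by
    rw [LinearMap.finrank_range_of_inj hg]
    have h1 : Module.finrank ℝ (LinearMap.range (A ∘ₗ T)) + Module.finrank ℝ S = _ :=
      LinearMap.finrank_range_add_finrank_ker (A ∘ₗ T)
    have h2 := Submodule.finrank_le (LinearMap.range (A ∘ₗ T))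
    rw [Module.finrank_fin_fun] at h1
    omega
  exact (Nat.cast_le.2 hdim).trans (le_iSup_of_le (LinearMap.range g)
    (le_iSup_of_le inferInstance (le_iSup_of_le hneg le_rfl)))

variable {m : ℕ} {V : Type} [NormedAddCommGroup V] [NormedSpace ℝ V]

/-- The bilinear form `(e, f) ↦ ξ (D B(z)[B(z) e] f)`, whose antisymmetric part is the covector
applied to the Lie brackets of the fields. -/
def bracketForm (B : V → E m →L[ℝ] V) (z : V) (ξ : V →L[ℝ] ℝ) : E m →L[ℝ] E m →L[ℝ] ℝ :=
  (ContinuousLinearMap.compL ℝ (E m) V ℝ ξ).comp ((fderiv ℝ B z).comp (B z))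

theorem bracketForm_apply (B : V → E m →L[ℝ] V) (z : V) (ξ : V →L[ℝ] ℝ) (e f : E m) :
    bracketForm B z ξ e f = ξ (fderiv ℝ B z (B z e) f) := rfl

/-- The second variation along loops in the plane of `e` and `f`: the main term is linear in the length
of the interval, the remainder is of higher order. -/
theorem secondVariation_loopControl_le [CompleteSpace V] {B : V → E m →L[ℝ] V} {b : ℝ}
    (h : IsBoundedField B b) {R : ℝ} {u : Control m} (hu : ‖u‖ ≤ R) {c y y₂ : Path V}
    {P : Path (V →L[ℝ] ℝ)} {s₀ s₁ : ℝ} (h0 : 0 ≤ s₀) (h01 : s₀ < s₁) (h1 : s₁ ≤ 1) {τ : ℝ}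
    (hτ : τ ∈ Icc s₀ s₁) {a : V} {K : ℕ} {e f : E m} (he : ‖e‖ = 1) (hf : ‖f‖ = 1)
    (hef : inner ℝ e f = 0) {v : Control m} {d : Fin K → ℝ} (hv : v = loopControl s₀ s₁ K e f d)
    (hc : c = ContinuousMap.const _ a + controlIntegral m V u (h.field c))
    (hy : y = controlIntegral m V v (h.field c) +
      controlIntegral m V u (pathApply _ _ (h.dfield c) y))
    (hy₂ : y₂ = (2 : ℝ) • controlIntegral m V v (pathApply _ _ (h.dfield c) y) +
      controlIntegral m V u (pathApply V (E m →L[ℝ] V)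
        (pathApply V (V →L[ℝ] E m →L[ℝ] V) (h.ddfield c) y) y) +
      controlIntegral m V u (pathApply _ _ (h.dfield c) y₂))
    (hP : ∀ t ∈ Icc (0 : ℝ) 1, P.ext t = P.ext 0 +
        ∫ s in (0 : ℝ)..t, -(P.ext s).comp (((h.dfield c).ext s).flip (u s)))
    {p : ℝ} (hp : ∀ t, ‖P.ext t‖ ≤ p)
    (hγ : bracketForm B (c.ext τ) (P.ext τ) e f - bracketForm B (c.ext τ) (P.ext τ) f e ≤ 0) :
    P.ext 1 (y₂.ext 1) ≤
      ((bracketForm B (c.ext τ) (P.ext τ) e f - bracketForm B (c.ext τ) (P.ext τ) f e) *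
        ((s₁ - s₀) / (2 * Real.pi * K)) + p * secondVariationConst b R * √(s₁ - s₀) ^ 3) *
        ‖v‖ ^ 2 := by
  have hsupp : ∀ᵐ s ∂μ01, s ∉ Icc s₀ s₁ → v s = 0 := by
    filter_upwards [hv ▸ coeFn_loopControl (s₀ := s₀) (s₁ := s₁) e f d] with s hs hsI
    rw [hs, indicator_of_notMem hsI]
  have hw : (controlPrimitive v).ext 1 = 0 :=
    hv ▸ controlPrimitive_loopControl_one h01 h0 h1 e f d
  have h2 := (abs_le.1 (secondVariation_estimate h hu h0 h01.le h1 hτ hc hy hsupp hw hP hp)).2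
  have h3 := two_mul_integral_loopControl_le h01 h0 h1 he hf hef _ hγ d
  rw [← hv] at h3
  simp only [bracketForm_apply] at h3 ⊢
  rw [adjoint_secondVariation h hy₂ hP]
  linarith

end NegativeIndex

/-! ### The bracket estimate in Euclidean space -/

section Euclidean

open scoped Topology

variable {n m : ℕ} {Ω V : Set (E n)} {Y : Fin m → E n → E n} {a : E n}
  {B : E n → E m →L[ℝ] E n} {u : Control m}

theorem flip_fderiv_eq_sum {z : E n} (hV : IsOpen V) (hz : z ∈ V)
    (hY : ∀ i, DifferentiableAt ℝ (Y i) z) (hBV : ∀ z ∈ V, B z = controlField Y z) (e : E m) :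
    (fderiv ℝ B z).flip e = ∑ i, e i • fderiv ℝ (Y i) z := by
  ext1 w
  have hev : B =ᶠ[𝓝 z] controlField Y := Filter.eventuallyEq_of_mem (hV.mem_nhds hz) hBV
  rw [ContinuousLinearMap.flip_apply, hev.fderiv_eq, fderiv_controlField_apply hY]
  simp [sum_apply]

theorem isFundamentalSolution_fundamental {D : Path (E n →L[ℝ] E m →L[ℝ] E n)}
    (hD : ∀ s ∈ Icc (0 : ℝ) 1, linA Ω Y a u s = (D.ext s).flip (u s)) :
    IsFundamentalSolution (fun s => (D.ext s).flip (u s)) (fundamental Ω Y a u) := by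
  have hcongr : ∀ S : ℝ → E n →L[ℝ] E n, ∀ t ∈ Icc (0 : ℝ) 1,
      ∫ s in (0 : ℝ)..t, (linA Ω Y a u s).comp (S s) =
        ∫ s in (0 : ℝ)..t, ((D.ext s).flip (u s)).comp (S s) := fun S t ht => by
    refine intervalIntegral.integral_congr fun s hs => ?_
    rw [uIcc_of_le ht.1] at hs
    exact congrArg (fun A : E n →L[ℝ] E n => A.comp (S s)) (hD s ⟨hs.1, hs.2.trans ht.2⟩)
  have hex : ∃ S, IsFundamentalSolution (linA Ω Y a u) S := by
    obtain ⟨S, hS⟩ := exists_fundamental D u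
    exact ⟨S.ext, S.continuous_ext.continuousOn, fun t ht => by rw [hS t ht, hcongr _ t ht]⟩
  rw [fundamental, dif_pos hex]
  exact ⟨hex.choose_spec.continuousOn, fun t ht => by
    rw [← hcongr _ t ht]
    exact hex.choose_spec.eq_integral t ht⟩

/-- For controls close to a given one, a bound on the negative index of the Hessian bounds the
extremal covector on the Lie brackets. The parameter `δ` is the length of the interval on which the
loops are run. -/
theorem exists_bracket_estimate (hΩ : IsOpen Ω) (hY : ∀ i, ContDiffOn ℝ ∞ (Y i) Ω)
    (hu : ∃ c, IsTrajectory Ω Y a u c) (N : ℕ) :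
    ∃ A : ℝ, 0 < A ∧ ∃ ψ : Control m → Path (E n), ContinuousAt ψ u ∧
      ψ u ⟨1, by simp⟩ ∈ Ω ∧ ∀ᶠ u' in 𝓝 u,
      endPoint Ω Y a u' = ψ u' ⟨1, by simp⟩ ∧ ∀ (ξ : E n →L[ℝ] ℝ) (p₀ : ℝ),
      negIndex (hessianOnKer Ω Y a u' ξ p₀) < (N : ℕ∞) →
      ∀ t ∈ Icc (0 : ℝ) 1, ∀ i j : Fin m, ∀ δ : ℝ, 0 < δ → δ ≤ 1 →
        |extremalCovector Ω Y a u' ξ t (VectorField.lieBracket ℝ (Y i) (Y j)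
          (trajectory Ω Y a u' t))| * δ ≤ A * (‖ξ‖ * √δ ^ 3 + |p₀|) := by
  obtain ⟨B, hB, hs, V, ψ, hV, hVΩ, hBV, hev⟩ := exists_localization (a := a) hΩ hY hu
  obtain ⟨b, h⟩ := exists_isBoundedField hB hs
  set R := ‖u‖ + 1 with hR
  have hS := secondVariationConst_nonneg (R := R) h.nonneg (by positivity)
  set S := secondVariationConst b R with hSdef
  set G := (2 * Real.exp ((b * R) ^ 2)) ^ 2 with hG
  -- the kernel of `D_uF`, with `F` valued in `ℝⁿ × ℝ`, has codimension at most `n + 1`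
  set K := N + (n + 1) with hKdef
  have m1 : (1 : ℝ) ∈ Icc (0 : ℝ) 1 := by simp
  have hK : (0 : ℝ) < 2 * Real.pi * K := by
    have := Real.pi_pos
    have : (0 : ℝ) < K := by exact_mod_cast (by omega : 0 < K)
    positivity
  refine ⟨2 * Real.pi * K * (G * S + 1), by positivity, ψ, hev.self_of_nhds.1.continuousAt,
    hVΩ (hev.self_of_nhds.2.2.1 _), ?_⟩
  have hnorm : ∀ᶠ u' in 𝓝 u, ‖u'‖ ≤ R :=
    (continuous_norm.continuousAt.eventually (eventually_lt_nhds (lt_add_one ‖u‖))).mono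
      fun _ h => h.le
  filter_upwards [hev.eventually_nhds, hnorm] with u' hev' hu'
  obtain ⟨hψ, hsol, hmem, heq⟩ := hev'.self_of_nhds
  refine ⟨by rw [endPoint, heq m1, Path.ext_of_mem _ m1], ?_⟩
  intro ξ p₀ hind t ht
  set c := ψ u' with hc
  have hext : ∀ s ∈ Icc (0 : ℝ) 1, c.ext s ∈ V := fun s hs => by
    rw [Path.ext_of_mem _ hs]
    exact hmem _
  have hYd : ∀ z ∈ V, ∀ i, DifferentiableAt ℝ (Y i) z := fun z hz i =>
    ((hY i).contDiffAt (hΩ.mem_nhds (hVΩ hz))).differentiableAt (by simp)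
  -- the adjoint path
  have hlin : ∀ s ∈ Icc (0 : ℝ) 1, linA Ω Y a u' s = ((h.dfield c).ext s).flip (u' s) := by
    intro s hs
    have h1 : (h.dfield c).ext s = fderiv ℝ B (c.ext s) := superpose_ext _ _ _ _
    rw [h1, flip_fderiv_eq_sum hV (hext s hs) (hYd _ (hext s hs)) hBV, linA, heq hs]
  have hfund := isFundamentalSolution_fundamental hlin
  obtain ⟨P, hP1, hPt, hPeq, hPn⟩ := exists_adjoint_path (b := b) hfund.continuousOn
    hfund.eq_integral (fun s => h.norm_fderiv_le _) hu' ξ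
  have hcov : extremalCovector Ω Y a u' ξ t = P.ext t := (hPt t ht).symm
  -- the second differential
  have hsol' := hev'.mono fun _ h => h.2.1
  have hF : endPointCost Ω Y a =ᶠ[𝓝 u'] fun w =>
      (ContinuousMap.evalCLM ℝ (⟨1, m1⟩ : Icc (0 : ℝ) 1) (ψ w), cost w) := by
    filter_upwards [hev'] with w hw
    rw [endPointCost, endPoint, hw.2.2.2 m1, Path.ext_of_mem _ m1]
    rfl
  -- exchanging `i` and `j` changes the sign of the bracket, so one sign suffices
  have key : ∀ i j : Fin m, i ≠ j → ∀ δ : ℝ, 0 < δ → δ ≤ 1 →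
      -(P.ext t (VectorField.lieBracket ℝ (Y i) (Y j) (c.ext t))) * δ ≤
        2 * Real.pi * K * (G * S + 1) * (‖ξ‖ * √δ ^ 3 + |p₀|) := by
    intro i j hij δ hδ hδ1
    by_contra! hlt
    refine hind.not_ge ?_
    rw [lieBracket_eq_fderiv hV (hext t ht) (hYd _ (hext t ht)) hBV, map_sub,
      ← bracketForm_apply, ← bracketForm_apply] at hlt
    set e : E m := EuclideanSpace.single i 1
    set f : E m := EuclideanSpace.single j 1
    have he : ‖e‖ = 1 := by simp [e]
    have hf : ‖f‖ = 1 := by simp [f]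
    have hef : inner ℝ e f = 0 := by
      rw [EuclideanSpace.inner_single_left]
      simp [f, hij]
    set β := bracketForm B (c.ext t) (P.ext t) e f - bracketForm B (c.ext t) (P.ext t) f e
      with hβ
    have hGS : 0 ≤ G * S := by positivity
    have hβ0 : β ≤ 0 := by
      have : 0 ≤ 2 * Real.pi * K * (G * S + 1) * (‖ξ‖ * √δ ^ 3 + |p₀|) := by positivity
      nlinarith
    -- the linear gain dominates the remainder and the contribution `|p₀| ‖v‖²` of the cost
    have hcoef : β * (δ / (2 * Real.pi * K)) + G * ‖ξ‖ * S * √δ ^ 3 + |p₀| < 0 := by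
      have h1 : (G * S + 1) * (‖ξ‖ * √δ ^ 3 + |p₀|) < -β * δ / (2 * Real.pi * K) := by
        rw [lt_div_iff₀ hK]
        linarith
      have h2 : 0 ≤ ‖ξ‖ * √δ ^ 3 + G * S * |p₀| := by positivity
      have h3 : β * (δ / (2 * Real.pi * K)) = -(-β * δ / (2 * Real.pi * K)) := by ring
      rw [h3]
      linarith
    -- an interval of length `δ` in `[0, 1]` which contains `t`
    obtain ⟨s₀, h0, h1, hts⟩ : ∃ s₀, 0 ≤ s₀ ∧ s₀ + δ ≤ 1 ∧ t ∈ Icc s₀ (s₀ + δ) := by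
      rcases le_total t (1 - δ) with h | h
      · exact ⟨t, ht.1, by linarith, by simp [hδ.le]⟩
      · exact ⟨1 - δ, by linarith, by linarith, h, by linarith [ht.2]⟩
    have h01 : s₀ < s₀ + δ := by linarith
    refine le_negIndex_ker _ (K := K) ?_ (loopControl s₀ (s₀ + δ) K e f)
      (loopControl_injective h01 h0 h1 he hf hef) ?_
    · simp [hKdef]
    · intro v d hvd hv0
      have hvpos : 0 < ‖(v : Control m)‖ ^ 2 := by
        have : (v : Control m) ≠ 0 := fun h => hv0 (Subtype.ext h)
        positivity
      have hbound := secondVariation_loopControl_le h hu' h0 h01 h1 hts he hf hef hvd hsol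
        (fderiv_solutionMap hB hs (hψ.differentiableAt (by simp)) hsol' v)
        (fderiv_fderiv_solutionMap hB hs hψ hsol' v) hPeq hPn hβ0
      rw [← hβ, add_sub_cancel_left, hP1, Path.ext_of_mem _ m1] at hbound
      simp only [hessianOnKer]
      rw [fderiv_fderiv_prodMk_cost _ hψ hF]
      have hp₀ : -p₀ * ‖(v : Control m)‖ ^ 2 ≤ |p₀| * ‖(v : Control m)‖ ^ 2 := by
        gcongr
        exact neg_le_abs p₀
      have hneg := mul_neg_of_neg_of_pos hcoef hvpos
      simp only [ContinuousMap.evalCLM_apply]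
      linarith
  intro i j δ hδ hδ1
  rw [hcov, heq ht]
  rcases eq_or_ne i j with rfl | hij
  · rw [VectorField.lieBracket_self, Pi.zero_apply, map_zero, abs_zero, zero_mul]
    have : 0 ≤ G * S := by positivity
    positivity
  · rw [← abs_of_pos hδ, ← abs_mul, abs_of_pos hδ, abs_le']
    refine ⟨?_, by simpa using key i j hij δ hδ hδ1⟩
    have h2 := key j i hij.symm δ hδ hδ1
    rwa [VectorField.lieBracket_swap, map_neg, neg_neg] at h2

end Euclidean

end SubRiem

end

theorem mainTheorem7 {n m : ℕ} {M : Type*} [TopologicalSpace M]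
    [ChartedSpace (SubRiem.E n) M] [IsManifold (𝓡 n) ∞ M]
    -- a smooth Riemannian metric on `M`; it gives the norms `|·|_y` on `T*_yM`
    (h : Bundle.ContMDiffRiemannianMetric (𝓡 n) ∞ (SubRiem.E n)
      (fun q : M => TangentSpace (𝓡 n) q))
    -- a diffeomorphism from the open set `Φ.source ⊆ M` onto the open set `Φ.target ⊆ ℝⁿ`
    (Φ : OpenPartialHomeomorph M (SubRiem.E n)) (hΦ : Φ ∈ IsManifold.maximalAtlas (𝓡 n) ∞ M)
    -- smooth vector fields `X¹, …, Xᵐ` on `Φ.source`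
    (X : Fin m → (q : M) → TangentSpace (𝓡 n) q)
    (hX : ∀ i, ContMDiffOn (𝓡 n) (𝓡 n).tangent ∞
      (fun q => (⟨q, X i q⟩ : TangentBundle (𝓡 n) M)) Φ.source)
    (x : M) (hx : x ∈ Φ.source)
    -- an open set of controls on which the end-point mapping is well defined
    (U : Set (SubRiem.Control m)) (hU : IsOpen U)
    (hUE : ∀ u ∈ U, ∃ c, SubRiem.IsTrajectory Φ.target (SubRiem.chartField Φ X) (Φ x) u c)
    (ubar : SubRiem.Control m) (hubar : ubar ∈ U)
    (L : ℝ) (hL : 0 < L)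
    (hubarL : eLpNorm ubar ∞ SubRiem.μ01 < ENNReal.ofReal L) :
    ∀ κ : ℝ, 0 < κ → ∀ N : ℕ, ∃ ρ : ℝ, 0 < ρ ∧ ∃ Λ : ℝ, 0 < Λ ∧
      ∀ u ∈ U, ‖u - ubar‖ < ρ → eLpNorm u ∞ SubRiem.μ01 < ENNReal.ofReal (2 * L) →
      ∀ (p : TangentSpace (𝓡 n)
            (Φ.symm (SubRiem.endPoint Φ.target (SubRiem.chartField Φ X) (Φ x) u)) →L[ℝ] ℝ)
        (p₀ : ℝ) (ξ : SubRiem.E n →L[ℝ] ℝ),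
        -- `ξ` is the covector `p`, read in the chart `Φ`
        ξ = SubRiem.chartCovector Φ
            (SubRiem.endPoint Φ.target (SubRiem.chartField Φ X) (Φ x) u) p →
        ¬ (p = 0 ∧ p₀ = 0) →
        ξ.comp (fderiv ℝ (SubRiem.endPoint Φ.target (SubRiem.chartField Φ X) (Φ x)) u)
          = p₀ • fderiv ℝ SubRiem.cost u →
        Λ * |p₀| ≤ SubRiem.covectorNorm h _ p →
        SubRiem.negIndex
          (SubRiem.hessianOnKer Φ.target (SubRiem.chartField Φ X) (Φ x) u ξ p₀) < (N : ℕ∞) →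
        ∀ t ∈ Icc (0 : ℝ) 1, ∀ i j : Fin m,
          |SubRiem.extremalCovector Φ.target (SubRiem.chartField Φ X) (Φ x) u ξ t
            (VectorField.lieBracket ℝ (SubRiem.chartField Φ X i) (SubRiem.chartField Φ X j)
              (SubRiem.trajectory Φ.target (SubRiem.chartField Φ X) (Φ x) u t))|
            ≤ κ * SubRiem.covectorNorm h _ p := by
  intro κ hκ N
  obtain ⟨A, hA, ψ, hψ, hψΩ, hev⟩ := SubRiem.exists_bracket_estimate Φ.open_target
    (fun i => SubRiem.contDiffOn_chartField hΦ (hX i)) (hUE ubar hubar) N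
  obtain ⟨C, hC, hcov⟩ := SubRiem.exists_norm_chartCovector_le h hΦ hψΩ
  have hev₁ : ContinuousAt (fun u => ψ u ⟨1, by simp⟩) ubar :=
    (ContinuousMap.evalCLM ℝ (⟨1, by simp⟩ : Icc (0 : ℝ) 1)).continuous.continuousAt.comp hψ
  obtain ⟨ρ, hρ, hball⟩ := Metric.eventually_nhds_iff.1 (hev.and (hev₁.eventually hcov))
  -- `σ²` is the length of the interval on which the loops are run
  set σ := min 1 (κ / (2 * A * C)) with hσ
  have hσ0 : 0 < σ := by positivity
  have hσC : A * C * σ ≤ κ / 2 := by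
    calc A * C * σ ≤ A * C * (κ / (2 * A * C)) := by gcongr; exact min_le_right _ _
      _ = κ / 2 := by field_simp
  refine ⟨ρ, hρ, 2 * A / (κ * σ ^ 2), by positivity, ?_⟩
  intro u _ huρ _ p p₀ ξ hξ _ _ hΛ hind t ht i j
  obtain ⟨⟨hend, hest⟩, hnorm⟩ := hball (by rwa [dist_eq_norm])
  rw [← hend] at hnorm
  have hξn := hnorm p
  rw [← hξ] at hξn
  have hbr := hest ξ p₀ hind t ht i j (σ ^ 2) (by positivity)
    (pow_le_one₀ hσ0.le (min_le_left _ _))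
  rw [Real.sqrt_sq hσ0.le] at hbr
  have hp := SubRiem.covectorNorm_nonneg h _ p
  set q := SubRiem.covectorNorm h _ p
  have hp₀ : A * |p₀| ≤ κ / 2 * q * σ ^ 2 := by
    rw [div_mul_eq_mul_div, div_le_iff₀ (by positivity)] at hΛ
    linarith
  have hξσ : A * (‖ξ‖ * σ ^ 3) ≤ κ / 2 * q * σ ^ 2 := by
    calc A * (‖ξ‖ * σ ^ 3) ≤ A * (C * q * σ ^ 3) := by gcongr
      _ = A * C * σ * (q * σ ^ 2) := by ring
      _ ≤ κ / 2 * (q * σ ^ 2) := by gcongr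
      _ = _ := by ring
  refine le_of_mul_le_mul_right (hbr.trans ?_) (pow_pos hσ0 2)
  linarith
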